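/- **Notation and parameters.** For $x\in\mathbb{R}$, $k\in\mathbb{Z}$ let $\langle x\rangle=(1+x^2)^{1/2}$, $|k,\xi|=(k^2+\xi^2)^{1/2}$, $\langle k,\xi\rangle=(1+k^2+\xi^2)^{1/2}$. Fix $\delta_0>0$, $\sigma_0\in(0,1/100]$, and an even smooth function $\varphi:\mathbb{R}\to[0,1]$ supported in $[-8/5,8/5]$ and equal to $1$ on $[-5/4,5/4]$; let $d_0=\int_{\mathbb{R}}\varphi$. Let $\delta>0$ and $\delta'\in(0,1)$ be two further parameters, and let $$L(t,\xi)=1+\frac{\delta'\langle\xi\rangle}{\langle\xi\rangle^{1/2}+\delta' t},\qquad t\ge 0,\ \xi\in\mathbb{R}.$$ **The weights $w_{NR}, w_R, w_k$.** For $\eta>\delta^{-10}$ let $k_0(\eta)=\lfloor\sqrt{\delta^3\eta}\rfloor$, $t_{0,\eta}=2\eta$, $t_{l,\eta}=\frac12\big(\frac{\eta}{l+1}+\frac{\eta}{l}\big)$ for $l\geq 1$, and $I_{l,\eta}=[t_{l,\eta},t_{l-1,\eta}]$. For $\eta>\delta^{-10}$ define $w_{NR}(t,\eta)=w_R(t,\eta)=1$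 if $t\ge 2\eta$; then, successively for $l=1,\dots,k_0(\eta)$, $$w_{NR}(t,\eta)=\Big(\frac{1+\delta^2|t-\eta/l|}{1+\delta^2|t_{l-1,\eta}-\eta/l|}\Big)^{\delta_0}w_{NR}(t_{l-1,\eta},\eta)\ \text{ if } t\in[\eta/l,t_{l-1,\eta}],$$ $$w_{NR}(t,\eta)=\Big(\frac{1}{1+\delta^2|t-\eta/l|}\Big)^{1+\delta_0}w_{NR}(\eta/l,\eta)\ \text{ if } t\in[t_{l,\eta},\eta/l],$$ and, for $t\in I_{l,\eta}$, $w_R(t,\eta)=w_{NR}(t,\eta)\frac{1+\delta^2|t-\eta/l|}{1+\delta^2\eta/(8l^2)}$ if $|t-\eta/l|\le\eta/(8l^2)$ and $w_R(t,\eta)=w_{NR}(t,\eta)$ otherwise. If $t=(1-\beta)t_{k_0(\eta),\eta}$ with $\beta\in[0,1]$, let $w_{NR}(t,\eta)=w_R(t,\eta)=(e^{-\delta\sqrt\eta})^{\beta}\,w_{NR}(t_{k_0(\eta),\eta},\eta)^{1-\beta}$. For $k\in\mathbb{Z}$ let $w_k(t,\eta)=1$ if $|\eta|\le\delta^{-10}$.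 If $\eta>\delta^{-10}$, let $w_k(t,\eta)=w_R(t,\eta)$ if $1\le k\le\sqrt{\delta^3\eta}$ and $t\in I_{k,\eta}$, and $w_k(t,\eta)=w_{NR}(t,\eta)$ otherwise. If $\eta<-\delta^{-10}$, let $w_k(t,\eta)=w_{-k}(t,-\eta)$. Finally let $$b_k(t,\xi)=\int_{\mathbb{R}}w_k(t,\rho)\,\varphi\Big(\frac{\xi-\rho}{L(t,\xi)}\Big)\frac{d\rho}{d_0L(t,\xi)}.$$ **The weights $\mu_k,\mu_R$.** For $t\ge0$, $\xi\geq0$ let $\mu^\#(t,\xi)=0$ if $\xi\le\delta^{-10}$ or $t>2\xi$; for $\xi>\delta^{-10}$ let $\mu^\#(t,\xi)=\delta^2$ if $t<t_{k_0(\xi),\xi}$ and $\mu^\#(t,\xi)=\frac{\delta^2}{1+\delta^2|t-\xi/l|}$ if $t\in I_{l,\xi}$, $1\le l\le k_0(\xi)$. Let $\mu^\#(t,\xi)=\mu^\#(t,|\xi|)$ for $\xi<0$. Let $$\mu^*(t,\xi)=\int_{\mathbb{R}}\mu^\#(t,\rho)\,\varphi\Big(\frac{\xi-\rho}{L(t,\xi)}\Big)\frac{d\rho}{d_0L(t,\xi)},$$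 $$\mu_k(t,\xi)=\frac{\langle k,\xi\rangle^{1/2}}{\langle t\rangle^{1+\sigma_0}}+\frac{\mu^*(t,\xi)}{1+e^{\sqrt\delta(|k|^{1/2}-\langle\xi\rangle^{1/2})}b_k(t,\xi)},\qquad \mu_R(t,\xi)=\frac{\langle\xi\rangle^{1/2}}{\langle t\rangle^{1+\sigma_0}}+\mu^*(t,\xi).$$ **Statement.** There is a constant $C>0$ (depending only on $\varphi,\sigma_0,\delta_0$, not on $\delta,\delta'$) such that for all sufficiently small $\delta>0$ (depending on $\varphi,\sigma_0,\delta_0$) and all sufficiently small $\delta'\in(0,1)$ (depending also on $\delta$) there are constants $C_1,C_2\ge1$, depending only on $\varphi,\sigma_0,\delta_0,\delta,\delta'$, such that for all $t\ge0$, $\xi,\eta\in\mathbb{R}$, $k\in\mathbb{Z}$: (i) if $\langle\xi-\eta\rangle\ge\langle k,\eta\rangle/100$, then $$\mu_k(t,\xi)+\mu_k(t,\eta)\le C_2\,\mu_R(t,\xi-\eta)\,e^{4\sqrt\delta|k,\eta|^{1/2}};$$ (ii) if $\langle\xi-\eta\rangle\le(\langle k,\xi\rangle+\langle k,\eta\rangle)/8$,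 then $$|\mu_k(t,\xi)-\mu_k(t,\eta)|\le C\,\langle\xi-\eta\rangle\,\mu_k(t,\eta)\,e^{4\sqrt\delta|\xi-\eta|^{1/2}}\Big[\frac{C_1}{\langle k,\xi\rangle^{1/8}}+\sqrt\delta\Big];$$ (iii) in all cases $$\mu_k(t,\xi)\le C_2\,\mu_k(t,\eta)\,e^{6\sqrt\delta|\xi-\eta|^{1/2}}.$$ -/

import Mathlib

open scoped ContDiff

noncomputable section

namespace GevreyWeights

/-! Brackets. -/

/-- `⟨x⟩ = (1 + x²)^{1/2}`. -/
def bracket (x : ℝ) : ℝ := √(1 + x ^ 2)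

/-- `|k, ξ| = (k² + ξ²)^{1/2}`. -/
def pairNorm (k : ℤ) (ξ : ℝ) : ℝ := √((k : ℝ) ^ 2 + ξ ^ 2)

/-- `⟨k, ξ⟩ = (1 + k² + ξ²)^{1/2}`. -/
def pairBracket (k : ℤ) (ξ : ℝ) : ℝ := √(1 + (k : ℝ) ^ 2 + ξ ^ 2)

/-! Critical times. -/

/-- The threshold `δ^{-10}` below which all the weights are trivial. -/
def threshold (δ : ℝ) : ℝ := (δ ^ 10)⁻¹

/-- `k₀(η) = ⌊√(δ³ η)⌋`. -/
def kZero (δ η : ℝ) : ℕ := ⌊√(δ ^ 3 * η)⌋₊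

/-- `t_{0,η} = 2η` and `t_{l,η} = (η/(l+1) + η/l)/2` for `l ≥ 1`. -/
def critTime (l : ℕ) (η : ℝ) : ℝ :=
  if l = 0 then 2 * η else (η / ((l : ℝ) + 1) + η / (l : ℝ)) / 2

/-- `I_{l,η} = [t_{l,η}, t_{l-1,η}]`, for `l ≥ 1`. -/
def critInterval (l : ℕ) (η : ℝ) : Set ℝ := Set.Icc (critTime l η) (critTime (l - 1) η)

/-- The index `k ≥ 1` of an interval `I_{k,η}` that contains `t`, for `η > 0` and
`0 < t ≤ 2η`. At a common endpoint of two consecutive intervals the smaller index is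
taken; all the formulas below agree at such points. -/
def critIndex (t η : ℝ) : ℕ := sInf {l : ℕ | 1 ≤ l ∧ critTime l η ≤ t}

/-! The weights `w_NR`, `w_R`, `w_k`. -/

/-- The formula for `w_NR(t, η)` on the interval `I_{k,η}` (first the half `t ≥ η/k`, then
the half `t ≤ η/k`), by recursion on `k`: the value at the right endpoint `t_{k-1,η}` is
the one given by the formula on the previous interval, and it is `1` at `t_{0,η}`. -/
def wNRon (δ₀ δ η : ℝ) : ℕ → ℝ → ℝ
  | 0, _ => 1
  | l + 1, t =>
    let c : ℝ := η / ((l : ℝ) + 1)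
    let s : ℝ := critTime l η
    if c ≤ t then
      ((1 + δ ^ 2 * |t - c|) / (1 + δ ^ 2 * |s - c|)) ^ δ₀ * wNRon δ₀ δ η l s
    else
      (1 / (1 + δ ^ 2 * |t - c|)) ^ (1 + δ₀)
        * ((1 / (1 + δ ^ 2 * |s - c|)) ^ δ₀ * wNRon δ₀ δ η l s)

/-- `w_NR(t, η)` for `t ≥ 0` and `η > δ^{-10}`. -/
def wNRpos (δ₀ δ t η : ℝ) : ℝ :=
  let t₀ : ℝ := critTime (kZero δ η) η
  if 2 * η ≤ t then 1
  else if t₀ ≤ t then wNRon δ₀ δ η (critIndex t η) t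
  else
    let β : ℝ := 1 - t / t₀
    (Real.exp (-(δ * √η))) ^ β * (wNRon δ₀ δ η (kZero δ η) t₀) ^ (1 - β)

/-- `w_R(t, η)` for `t ≥ 0` and `η > δ^{-10}`. -/
def wRpos (δ₀ δ t η : ℝ) : ℝ :=
  let k : ℝ := (critIndex t η : ℝ)
  if 2 * η ≤ t then 1
  else if critTime (kZero δ η) η ≤ t ∧ |t - η / k| ≤ η / (8 * k ^ 2) then
    wNRpos δ₀ δ t η * ((1 + δ ^ 2 * |t - η / k|) / (1 + δ ^ 2 * (η / (8 * k ^ 2))))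
  else wNRpos δ₀ δ t η

/-- `w_k(t, η)` for `t ≥ 0` and `η > δ^{-10}`, `k ∈ ℤ`. -/
def wKpos (δ₀ δ : ℝ) (k : ℤ) (t η : ℝ) : ℝ :=
  open Classical in
  if 1 ≤ k ∧ (k : ℝ) ≤ √(δ ^ 3 * η) ∧ t ∈ critInterval k.toNat η then wRpos δ₀ δ t η
  else wNRpos δ₀ δ t η

/-- `w_k(t, η)` for `t ≥ 0`, `η ∈ ℝ`, `k ∈ ℤ`. -/
def wK (δ₀ δ : ℝ) (k : ℤ) (t η : ℝ) : ℝ :=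
  if |η| ≤ threshold δ then 1
  else if 0 < η then wKpos δ₀ δ k t η
  else wKpos δ₀ δ (-k) t (-η)

/-! Averaging in frequency. -/

/-- The cutoff functions used for averaging: even, smooth, with values in `[0, 1]`, supported in
`[-8/5, 8/5]` and equal to `1` in `[-5/4, 5/4]`. -/
structure IsCutoff (φ : ℝ → ℝ) : Prop where
  smooth : ContDiff ℝ ∞ φ
  even : ∀ x, φ (-x) = φ x
  mem_Icc : ∀ x, φ x ∈ Set.Icc (0 : ℝ) 1
  support_subset : Function.support φ ⊆ Set.Icc (-(8 / 5)) (8 / 5)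
  eq_one : ∀ x ∈ Set.Icc (-(5 / 4) : ℝ) (5 / 4), φ x = 1

/-- The averaging length `L_{δ'}(t, ξ) = 1 + δ'⟨ξ⟩ / (⟨ξ⟩^{1/2} + δ' t)`. -/
def avgLength (δ' t ξ : ℝ) : ℝ := 1 + δ' * bracket ξ / (√(bracket ξ) + δ' * t)

/-- The average of `f` around `ξ` at scale `L_{δ'}(t, ξ)`:
`∫ f(ρ) φ((ξ - ρ)/L) / (d₀ L) dρ`, with `L = L_{δ'}(t, ξ)` and `d₀ = ∫ φ`. -/
def average (φ : ℝ → ℝ) (δ' t ξ : ℝ) (f : ℝ → ℝ) : ℝ :=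
  ∫ ρ : ℝ, f ρ * (1 / ((∫ x : ℝ, φ x) * avgLength δ' t ξ))
    * φ ((ξ - ρ) / avgLength δ' t ξ)

/-- `b_k(t, ξ)`, the average of `w_k(t, ·)`. -/
def bK (φ : ℝ → ℝ) (δ₀ δ δ' : ℝ) (k : ℤ) (t ξ : ℝ) : ℝ :=
  average φ δ' t ξ (wK δ₀ δ k t)

/-! The weights `μ_k` and `μ_R`. -/

/-- `μ^#(t, ξ)`, for `t ≥ 0` and `ξ ≥ 0`. -/
def muSharpPos (δ t ξ : ℝ) : ℝ :=
  if ξ ≤ threshold δ then 0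
  else if t < critTime (kZero δ ξ) ξ then δ ^ 2
  else if t ≤ 2 * ξ then δ ^ 2 / (1 + δ ^ 2 * |t - ξ / (critIndex t ξ : ℝ)|)
  else 0

/-- `μ^#(t, ξ)`, for `t ≥ 0` and `ξ ∈ ℝ`. -/
def muSharp (δ t ξ : ℝ) : ℝ := muSharpPos δ t |ξ|

/-- `μ^*(t, ξ)`, the average of `μ^#(t, ·)`. -/
def muStar (φ : ℝ → ℝ) (δ δ' t ξ : ℝ) : ℝ := average φ δ' t ξ (muSharp δ t)

/-- `μ_k(t, ξ)`. -/
def muK (φ : ℝ → ℝ) (σ₀ δ₀ δ δ' : ℝ) (k : ℤ) (t ξ : ℝ) : ℝ :=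
  √(pairBracket k ξ) / bracket t ^ (1 + σ₀)
    + muStar φ δ δ' t ξ
      / (1 + Real.exp (√δ * (√|(k : ℝ)| - √(bracket ξ))) * bK φ δ₀ δ δ' k t ξ)

/-- `μ_R(t, ξ)`. -/
def muR (φ : ℝ → ℝ) (σ₀ δ δ' t ξ : ℝ) : ℝ :=
  √(bracket ξ) / bracket t ^ (1 + σ₀) + muStar φ δ δ' t ξ

end GevreyWeights

end

open GevreyWeights

set_option linter.unusedSectionVars false

namespace GevreyWeights

/-! ### Brackets and elementary inequalities -/

/-! The plan is to pass to `-log w_k`, find its modulus of continuity in the frequency, transfer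
this to averages, and then to the quotient that defines `μ_k`.

Exponents. With clamped times, `-log w_k` is a sum of elementary terms (`wK_eq_exp_loss`): one
`cellLoss` for each critical interval, a term for the times before `t_{k₀}`, and a resonant term. No
case distinction on the interval containing `t` is left. The number `n` of intervals is a separate
parameter of `loss`, because the floor `k₀(ρ)` makes the true exponent jump. For frozen `n`, and up
to the scaling effect `log (ρ'/ρ)`, the term of an interval changes only while the frequency runs
through the cell of those `ρ` whose interval contains `t`. These cells are disjoint, so summation
gives two moduli (`abs_loss_sub_le`): a linear one with coefficient of order `δ`, and a Hölder one,
`(√δ/100) |ρ-ρ'|^{1/2}`. Changing `n` by one costs at most `1/(1000 δ)` (`abs_loss_succ_sub_le`).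
This is harmless in constants that may depend on `δ`, and it is absent for `t` after the last
critical interval (`loss_eq_of_critTime_le`).

The weight `μ^#` is, up to constants, a function of the distance from `t` to the critical times
`ρ/l`. This distance is 1-Lipschitz in `ρ`, and when `ρ/l` is the nearest critical time its
variation is at most `|ρ-ρ'|/l ≲ (t/ρ)|ρ-ρ'|`. The cutoff at `t = 2ρ` is discontinuous, but there
`μ^# ≲ 1/t`, which the decay term dominates.

Averages at two centers are compared in the common variable `y`, where corresponding points are at
distance at most `2|ξ-η|`. Alternatively the kernel is differentiated, which gains `|ξ-η|/L` as soon
as the weight has comparable values on the whole window.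

Claim (iii): `b_k` and `e^{√δ√⟨ξ⟩}` vary at most by factors `C e^{c√δ|ξ-η|^{1/2}}`, and `μ^*` by a
polynomial factor up to the decay term; the polynomial is absorbed by the exponential. Claim (i):
`⟨ξ-η⟩` dominates `⟨k,η⟩`, so the decay terms are comparable. `μ^*(ξ)` is compared with `μ^*(ξ-η)`
and `μ^*(η)` with `μ^*(0) = 0`, losing a polynomial in `|η|`.

Claim (ii): put `X = ⟨k,ξ⟩^{1/8}`. If `X` is bounded or `⟨ξ-η⟩ ≥ X`, claim (iii) is enough. If `|k|
≥ 4⟨ξ⟩`, the denominator of the second term is exponentially large and that term is negligible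
(`mainTerm_le_decayTerm`). Otherwise `s = |ξ|^{1/8}` is at least `X/2`, and the time is split at
`s^6 = |ξ|^{3/4}`. For `t ≤ s^6` the averaging length is at least of order `s²` and the weights have
comparable values on a window, so differentiating the kernel gives a relative error `O(1/s)`
(`abs_mainTerm_sub_le_of_time_le`). For `t ≥ s^6` all critical intervals that matter lie after the
transition time `t_{k₀} ~ δ^{-3/2} s^4`, the floor plays no role, and the pointwise linear moduli
give `O(√δ)` (`abs_mainTerm_sub_le_of_le_time`). The factor `e^{-√δ√⟨ξ⟩}` accounts for the `√δ` in
both ranges. -/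

theorem abs_sqrt_add_sq_sub_le {c : ℝ} (hc : 0 ≤ c) (x y : ℝ) :
    |√(c + x ^ 2) - √(c + y ^ 2)| ≤ |x - y| := by
  have h1 := Real.sq_sqrt (add_nonneg hc (sq_nonneg x))
  have h2 := Real.sq_sqrt (add_nonneg hc (sq_nonneg y))
  set a := √(c + x ^ 2)
  set b := √(c + y ^ 2)
  have ha : 0 ≤ a := Real.sqrt_nonneg _
  have hb : 0 ≤ b := Real.sqrt_nonneg _
  apply abs_le_of_sq_le_sq' _ (abs_nonneg _) |> abs_le.2
  rw [sq_abs]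
  -- Cauchy–Schwarz for the vectors `(√c, x)` and `(√c, y)`; the claim is the reverse triangle
  -- inequality for their lengths.
  have h3 : c + x * y ≤ a * b := by
    apply le_of_sq_le_sq _ (mul_nonneg ha hb) 
    rw [mul_pow, h1, h2]
    nlinarith [mul_nonneg hc (sq_nonneg (x - y))]
  nlinarith

theorem one_le_bracket (x : ℝ) : 1 ≤ bracket x := by
  rw [bracket, Real.one_le_sqrt]
  nlinarith [sq_nonneg x]

theorem bracket_pos (x : ℝ) : 0 < bracket x := one_pos.trans_le (one_le_bracket x)

theorem abs_le_bracket (x : ℝ) : |x| ≤ bracket x :=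
  Real.abs_le_sqrt (by linarith)

theorem bracket_le (x : ℝ) : bracket x ≤ 1 + |x| := by
  rw [bracket, Real.sqrt_le_left (by positivity)]
  nlinarith [sq_abs x, abs_nonneg x]

theorem bracket_neg (x : ℝ) : bracket (-x) = bracket x := by simp [bracket]

theorem abs_bracket_sub_le (x y : ℝ) : |bracket x - bracket y| ≤ |x - y| :=
  abs_sqrt_add_sq_sub_le zero_le_one x y

theorem bracket_le_pairBracket (k : ℤ) (x : ℝ) : bracket x ≤ pairBracket k x :=
  Real.sqrt_le_sqrt (by nlinarith [sq_nonneg (k : ℝ)])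

theorem one_le_pairBracket (k : ℤ) (x : ℝ) : 1 ≤ pairBracket k x :=
  (one_le_bracket x).trans (bracket_le_pairBracket k x)

theorem pairBracket_pos (k : ℤ) (x : ℝ) : 0 < pairBracket k x :=
  one_pos.trans_le (one_le_pairBracket k x)

theorem abs_pairBracket_sub_le (k : ℤ) (x y : ℝ) :
    |pairBracket k x - pairBracket k y| ≤ |x - y| :=
  abs_sqrt_add_sq_sub_le (by positivity) x y

theorem pairBracket_le (k : ℤ) (x : ℝ) : pairBracket k x ≤ |(k : ℝ)| + bracket x := by
  have := bracket_pos x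
  rw [pairBracket, Real.sqrt_le_left (by positivity)]
  have h := Real.sq_sqrt (show 0 ≤ 1 + x ^ 2 by positivity)
  have : 0 ≤ |(k : ℝ)| * bracket x := by positivity
  have h2 : bracket x ^ 2 = 1 + x ^ 2 := h
  nlinarith [sq_abs (k : ℝ)]

theorem abs_le_pairNorm (k : ℤ) (x : ℝ) : |x| ≤ pairNorm k x :=
  Real.abs_le_sqrt (by nlinarith [sq_nonneg (k : ℝ)])

theorem abs_sqrt_sub_le_sqrt {a b : ℝ} (ha : 0 ≤ a) (hb : 0 ≤ b) : |√a - √b| ≤ √|a - b| := by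
  apply Real.le_sqrt_of_sq_le
  have h1 := Real.sq_sqrt ha
  have h2 := Real.sq_sqrt hb
  have h3 := Real.sqrt_nonneg a
  have h4 := Real.sqrt_nonneg b
  rw [sq_abs]
  rcases le_total a b with h | h
  · have := Real.sqrt_le_sqrt h
    rw [abs_of_nonpos (by linarith)]
    nlinarith
  · have := Real.sqrt_le_sqrt h
    rw [abs_of_nonneg (by linarith)]
    nlinarith

theorem abs_sqrt_sub_le_div {a b : ℝ} (ha : 0 ≤ a) (hb : 0 < b) : |√a - √b| ≤ |a - b| / √b := by
  rw [le_div_iff₀ (Real.sqrt_pos.2 hb)]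
  have h1 := Real.sq_sqrt ha
  have h2 := Real.sq_sqrt hb.le
  have h3 := Real.sqrt_nonneg a
  have h4 := Real.sqrt_nonneg b
  have : |a - b| = |√a - √b| * (√a + √b) := by
    rw [← abs_of_nonneg (add_nonneg h3 h4), ← abs_mul]
    congr 1
    nlinarith
  rw [this]
  exact mul_le_mul_of_nonneg_left (by linarith) (abs_nonneg _)

theorem log_one_add_le_sqrt {x : ℝ} (hx : 0 ≤ x) : Real.log (1 + x) ≤ √x := by
  -- With `y = √x` this is `1 + y² ≤ e^y`, which already holds for the Taylor polynomial of degree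
  -- 4.
  have h1 : 1 + x ≤ Real.exp (√x) := by
    have h := Real.sum_le_exp_of_nonneg (Real.sqrt_nonneg x) 5
    simp only [Finset.sum_range_succ, Finset.sum_range_zero, Nat.factorial] at h
    have h2 := Real.sq_sqrt hx
    have h0 := Real.sqrt_nonneg x
    set y := √x
    norm_num at h
    rw [← h2]
    nlinarith [sq_nonneg (y ^ 2 - 4 * y), sq_nonneg (y - 2), sq_nonneg (y-1), mul_nonneg h0 (sq_nonneg (y-2)), mul_nonneg h0 (sq_nonneg (y-1)), sq_nonneg (y^2+2*y-6)]
  calc Real.log (1 + x) ≤ Real.log (Real.exp (√x)) := Real.log_le_log (by positivity) h1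
    _ = √x := Real.log_exp _

theorem log_one_add_le_self {x : ℝ} (hx : 0 ≤ x) : Real.log (1 + x) ≤ x := by
  have := Real.log_le_sub_one_of_pos (show 0 < 1 + x by positivity)
  linarith

theorem log_one_add_le_sqrt_sqrt {x : ℝ} (hx : 0 ≤ x) : Real.log (1 + x) ≤ 2 * √(√x) := by
  have h0 := Real.sqrt_nonneg x
  have h1 : 1 + x ≤ (1 + √x) ^ 2 := by nlinarith [Real.sq_sqrt hx]
  calc Real.log (1 + x) ≤ Real.log ((1 + √x) ^ 2) := Real.log_le_log (by positivity) h1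
    _ = 2 * Real.log (1 + √x) := by rw [Real.log_pow]; norm_num
    _ ≤ _ := by linarith [log_one_add_le_sqrt h0]

/-- The fourth term of the series of `e^{ε√x}` is a multiple of `x²`. Every polynomial loss below is
absorbed in this way into an arbitrarily small part of the exponential factor. -/
theorem one_add_sq_le_exp {ε : ℝ} (hε : 0 < ε) {x : ℝ} (hx : 0 ≤ x) :
    (1 + x) ^ 2 ≤ (2 + 48 / ε ^ 4) * Real.exp (ε * √x) := by
  have h0 : 0 ≤ ε * √x := by positivity
  have h := Real.pow_div_factorial_le_exp _ h0 4
  have h1 := Real.one_le_exp h0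
  have h2 : (ε * √x) ^ 4 = ε ^ 4 * x ^ 2 := by
    rw [mul_pow, show (√x) ^ 4 = ((√x) ^ 2) ^ 2 by ring, Real.sq_sqrt hx]
  rw [h2] at h
  norm_num [Nat.factorial] at h
  have h3 : x ^ 2 * 2 ≤ 48 / ε ^ 4 * Real.exp (ε * √x) := by
    rw [div_mul_eq_mul_div, le_div_iff₀ (by positivity)]
    linarith
  nlinarith [sq_nonneg (1 - x)]

theorem exp_sub_one_le {x y : ℝ} (hx : |x| ≤ y) : |Real.exp x - 1| ≤ y * Real.exp y := by
  have hy : 0 ≤ y := (abs_nonneg x).trans hx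
  have h1 := Real.add_one_le_exp x
  have h2 := Real.add_one_le_exp (-x)
  have h3 := Real.exp_le_exp.2 ((le_abs_self x).trans hx)
  have h4 := Real.one_le_exp hy
  have h5 : Real.exp (-x) * Real.exp x = 1 := by rw [← Real.exp_add]; simp
  have h6 := Real.exp_pos x
  have h7 := abs_le.1 hx
  rw [abs_le]
  constructor
  · nlinarith
  · have : Real.exp x - 1 ≤ x * Real.exp x := by nlinarith
    nlinarith

/-! ### The averaging length -/

section avgLength

variable {δ' t : ℝ} (hδ' : 0 < δ') (ht : 0 ≤ t)
include hδ' ht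

theorem avgLength_denom_pos (ξ : ℝ) : 0 < √(bracket ξ) + δ' * t :=
  add_pos_of_pos_of_nonneg (Real.sqrt_pos.2 (bracket_pos ξ)) (by positivity)

theorem one_le_avgLength (ξ : ℝ) : 1 ≤ avgLength δ' t ξ := by
  have := avgLength_denom_pos hδ' ht ξ
  have := bracket_pos ξ
  rw [avgLength, le_add_iff_nonneg_right]
  positivity

theorem avgLength_le (ξ : ℝ) : avgLength δ' t ξ ≤ 1 + δ' * √(bracket ξ) := by
  have h := bracket_pos ξ
  have h1 := Real.sqrt_pos.2 h
  have h2 := Real.sq_sqrt h.le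
  rw [avgLength, add_le_add_iff_left, div_le_iff₀ (avgLength_denom_pos hδ' ht ξ)]
  have : 0 ≤ δ' * √(bracket ξ) * (δ' * t) := by positivity
  nlinarith

theorem avgLength_mul_le (ξ : ℝ) : avgLength δ' t ξ * t ≤ t + bracket ξ := by
  have h := bracket_pos ξ
  have h0 := avgLength_denom_pos hδ' ht ξ
  have h1 := Real.sqrt_pos.2 h
  rw [avgLength, add_mul, one_mul, add_le_add_iff_left, div_mul_eq_mul_div, div_le_iff₀ h0]
  nlinarith [mul_pos h h1]

/-- As a function of `b = ⟨ξ⟩`, the quotient `b / (√b + p)` has slope at most `1`, uniformly in `p ≥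
0`, and `⟨·⟩` is 1-Lipschitz. A small `δ'` therefore keeps neighbouring averaging windows
comparable, at all times. -/
theorem abs_avgLength_sub_le (ξ η : ℝ) :
    |avgLength δ' t ξ - avgLength δ' t η| ≤ δ' * |ξ - η| := by
  have key : ∀ ξ η : ℝ, bracket η ≤ bracket ξ →
      |avgLength δ' t ξ - avgLength δ' t η| ≤ δ' * |ξ - η| := by
    intro ξ η hle
    have hξ := avgLength_denom_pos hδ' ht ξ
    have hη := avgLength_denom_pos hδ' ht η
    have hb := one_le_bracket η
    have hs := Real.sqrt_le_sqrt hle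
    have hs1 : 1 ≤ √(bracket η) := by rwa [Real.one_le_sqrt]
    have h1 := Real.sq_sqrt (bracket_pos ξ).le
    have h2 := Real.sq_sqrt (bracket_pos η).le
    have hd := (abs_le.1 (abs_bracket_sub_le ξ η)).2
    have e : avgLength δ' t ξ - avgLength δ' t η = δ' * (bracket ξ / (√(bracket ξ) + δ' * t)
        - bracket η / (√(bracket η) + δ' * t)) := by
      simp only [avgLength]; ring
    have hp : 0 ≤ δ' * t := by positivity
    rw [e, abs_mul, abs_of_pos hδ']
    refine mul_le_mul_of_nonneg_left (le_trans ?_ hd) hδ'.le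
    set a := √(bracket ξ)
    set b := √(bracket η)
    set p := δ' * t
    rw [← h1, ← h2]
    rw [div_sub_div _ _ hξ.ne' hη.ne', abs_of_nonneg]
    · rw [div_le_iff₀ (by positivity)]
      have hab : 0 ≤ a - b := by linarith
      have f1 : a ^ 2 * (b + p) - (a + p) * b ^ 2 = (a - b) * (a * b + p * (a + b)) := by ring
      have f2 : (a ^ 2 - b ^ 2) * ((a + p) * (b + p))
          = (a - b) * ((a + b) * ((a + p) * (b + p))) := by ring
      rw [f1, f2]
      apply mul_le_mul_of_nonneg_left _ hab
      have : a * b + p * (a + b) ≤ (a + p) * (b + p) := by nlinarith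
      have h5 : 0 ≤ (a + p) * (b + p) := by positivity
      nlinarith
    · have hab : 0 ≤ a - b := by linarith
      have f1 : a ^ 2 * (b + p) - (a + p) * b ^ 2 = (a - b) * (a * b + p * (a + b)) := by ring
      rw [f1]
      have : 0 ≤ a := by linarith
      positivity
  rcases le_total (bracket η) (bracket ξ) with h | h
  · exact key ξ η h
  · rw [abs_sub_comm, abs_sub_comm ξ]; exact key η ξ h

end avgLength

end GevreyWeights

namespace GevreyWeights

/-! ### An explicit formula for the weights -/

/-- `log (1 + δ² x)`. -/
noncomputable def logTerm (δ x : ℝ) : ℝ := Real.log (1 + δ ^ 2 * x)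

/-- The contribution of the interval `I_{i+1,ρ}` to `-log w_NR(t, ρ)`. -/
noncomputable def cellLoss (δ₀ δ : ℝ) (i : ℕ) (t ρ : ℝ) : ℝ :=
  δ₀ * (logTerm δ (critTime i ρ - ρ / (i + 1))
      - logTerm δ (min (max t (ρ / (i + 1))) (critTime i ρ) - ρ / (i + 1)))
    + (1 + δ₀) * logTerm δ (ρ / (i + 1) - max (min t (ρ / (i + 1))) (critTime (i + 1) ρ))

/-- The contribution of a whole interval `I_{i+1,ρ}`. -/
noncomputable def cellTotal (δ₀ δ : ℝ) (i : ℕ) (ρ : ℝ) : ℝ :=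
  δ₀ * logTerm δ (critTime i ρ - ρ / (i + 1))
    + (1 + δ₀) * logTerm δ (ρ / (i + 1) - critTime (i + 1) ρ)

/-- The contribution of the first `n` intervals to `-log w_NR(t, ρ)`. -/
noncomputable def cellSum (δ₀ δ : ℝ) (n : ℕ) (t ρ : ℝ) : ℝ :=
  ∑ i ∈ Finset.range n, cellLoss δ₀ δ i t ρ

/-- The value `-log w_NR(t_{n,ρ}, ρ)`. -/
noncomputable def totalSum (δ₀ δ : ℝ) (n : ℕ) (ρ : ℝ) : ℝ :=
  ∑ i ∈ Finset.range n, cellTotal δ₀ δ i ρ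

/-- The contribution of the times before `t_{n,ρ}` to `-log w_NR(t, ρ)`. -/
noncomputable def lowLoss (δ₀ δ : ℝ) (n : ℕ) (t ρ : ℝ) : ℝ :=
  max 0 (1 - t / critTime n ρ) * (δ * √ρ - totalSum δ₀ δ n ρ)

/-- `-log (w_R / w_NR)` around the time `ρ / k`. -/
noncomputable def resLoss (δ k t ρ : ℝ) : ℝ :=
  max 0 (logTerm δ (ρ / (8 * k ^ 2)) - logTerm δ |t - ρ / k|)

/-- The formula for `-log w_k(t, ρ)` with the number of critical intervals as a parameter. -/
noncomputable def loss (δ₀ δ : ℝ) (n : ℕ) (k : ℤ) (t ρ : ℝ) : ℝ :=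
  cellSum δ₀ δ n t ρ + lowLoss δ₀ δ n t ρ + if 1 ≤ k ∧ k ≤ n then resLoss δ k t ρ else 0

theorem logTerm_zero (δ : ℝ) : logTerm δ 0 = 0 := by simp [logTerm]

theorem one_le_logArg (δ : ℝ) {x : ℝ} (hx : 0 ≤ x) : 1 ≤ 1 + δ ^ 2 * x := by
  have : 0 ≤ δ ^ 2 * x := by positivity
  linarith

theorem logTerm_nonneg (δ : ℝ) {x : ℝ} (hx : 0 ≤ x) : 0 ≤ logTerm δ x :=
  Real.log_nonneg (one_le_logArg δ hx)

theorem logTerm_mono (δ : ℝ) {x y : ℝ} (hx : 0 ≤ x) (hxy : x ≤ y) : logTerm δ x ≤ logTerm δ y := by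
  have := one_le_logArg δ hx
  exact Real.log_le_log (by linarith) (by gcongr)

theorem exp_logTerm (δ : ℝ) {x : ℝ} (hx : 0 ≤ x) : Real.exp (logTerm δ x) = 1 + δ ^ 2 * x :=
  Real.exp_log (one_pos.trans_le (one_le_logArg δ hx))

theorem logArg_rpow (δ : ℝ) {x : ℝ} (hx : 0 ≤ x) (a : ℝ) :
    (1 + δ ^ 2 * x) ^ a = Real.exp (a * logTerm δ x) := by
  rw [← exp_logTerm δ hx, ← Real.exp_mul, mul_comm]

/-! Critical times. -/

theorem critTime_zero (ρ : ℝ) : critTime 0 ρ = 2 * ρ := by simp [critTime]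

theorem critTime_succ (i : ℕ) (ρ : ℝ) :
    critTime (i + 1) ρ = (ρ / (i + 2) + ρ / (i + 1)) / 2 := by
  rw [critTime, if_neg (Nat.succ_ne_zero i)]
  push_cast
  rw [add_assoc, one_add_one_eq_two]

section

variable {ρ : ℝ} (hρ : 0 < ρ)
include hρ

theorem center_lt_critTime (i : ℕ) : ρ / (i + 1) < critTime i ρ := by
  rcases i with _ | i
  · rw [critTime_zero]; norm_num; linarith
  · rw [critTime_succ]
    push_cast
    rw [add_assoc, one_add_one_eq_two]
    have : ρ / (i + 2 : ℝ) < ρ / (i + 1) := by gcongr; norm_num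
    linarith

theorem critTime_succ_lt_center (i : ℕ) : critTime (i + 1) ρ < ρ / (i + 1) := by
  rw [critTime_succ]
  have : ρ / (i + 2 : ℝ) < ρ / (i + 1) := by gcongr; norm_num
  linarith

theorem critTime_antitone : Antitone fun i => critTime i ρ :=
  antitone_nat_of_succ_le fun i =>
    ((critTime_succ_lt_center hρ i).trans (center_lt_critTime hρ i)).le

theorem critTime_pos (i : ℕ) : 0 < critTime i ρ :=
  (show 0 < ρ / ((i : ℝ) + 1) by positivity).trans (center_lt_critTime hρ i)

/-- Together with `le_center_sub_critTime` this puts the resonant window `|t - ρ/k| ≤ ρ/(8k²)`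
strictly inside `I_{k,ρ}`. The positive part in `resLoss` then vanishes outside `I_{k,ρ}`, and the
condition `t ∈ I_{k,ρ}` in the definition of `w_k` can be dropped. -/
theorem le_critTime_sub_center (i : ℕ) :
    ρ / (8 * ((i : ℝ) + 1) ^ 2) < critTime i ρ - ρ / (i + 1) := by
  rcases i with _ | i
  · rw [critTime_zero]; norm_num; linarith
  · rw [critTime_succ]
    push_cast
    have : (ρ / (i + 2 : ℝ) + ρ / (i + 1)) / 2 - ρ / (i + 1 + 1) - ρ / (8 * ((i : ℝ) + 1 + 1) ^ 2)
      = ρ * (3 * i + 7) / (8 * (i + 1) * (i + 2) ^ 2) := by field_simp; ring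
    have : 0 < ρ * (3 * i + 7) / (8 * (i + 1) * (i + 2) ^ 2) := by positivity
    linarith

theorem le_center_sub_critTime (i : ℕ) :
    ρ / (8 * ((i : ℝ) + 1) ^ 2) < ρ / (i + 1) - critTime (i + 1) ρ := by
  rw [critTime_succ]
  have : ρ / (i + 1) - (ρ / (i + 2 : ℝ) + ρ / (i + 1)) / 2 - ρ / (8 * ((i : ℝ) + 1) ^ 2)
      = ρ * (3 * i + 2) / (8 * (i + 2) * (i + 1) ^ 2) := by field_simp; ring
  have : 0 < ρ * (3 * i + 2) / (8 * (i + 2) * (i + 1) ^ 2) := by positivity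
  linarith

/-! The contributions outside of the active interval. -/

theorem cellLoss_eq_zero (δ₀ δ : ℝ) {i : ℕ} {t : ℝ} (h : critTime i ρ ≤ t) :
    cellLoss δ₀ δ i t ρ = 0 := by
  have h1 := center_lt_critTime hρ i
  have h2 := critTime_succ_lt_center hρ i
  rw [cellLoss, max_eq_left (by linarith : ρ / (i + 1) ≤ t), min_eq_right h, min_eq_right (by linarith),
    max_eq_left h2.le, sub_self, sub_self, logTerm_zero]
  simp

theorem cellLoss_eq_cellTotal (δ₀ δ : ℝ) {i : ℕ} {t : ℝ} (h : t ≤ critTime (i + 1) ρ) :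
    cellLoss δ₀ δ i t ρ = cellTotal δ₀ δ i ρ := by
  have h1 := center_lt_critTime hρ i
  have h2 := critTime_succ_lt_center hρ i
  rw [cellLoss, cellTotal, max_eq_right (by linarith : t ≤ ρ / (i + 1)), min_eq_left h1.le,
    min_eq_left (by linarith), max_eq_right h, sub_self, logTerm_zero]
  simp

theorem cellSum_eq_of_le (δ₀ δ : ℝ) {m n : ℕ} {t : ℝ} (hmn : m ≤ n) (h : critTime m ρ ≤ t) :
    cellSum δ₀ δ n t ρ = cellSum δ₀ δ m t ρ := by
  symm
  apply Finset.sum_subset (by simpa using hmn)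
  intro i _ hi
  apply cellLoss_eq_zero hρ
  rw [Finset.mem_range, not_lt] at hi
  exact (critTime_antitone hρ hi).trans h

theorem cellSum_eq_totalSum (δ₀ δ : ℝ) {n : ℕ} {t : ℝ} (h : t ≤ critTime n ρ) :
    cellSum δ₀ δ n t ρ = totalSum δ₀ δ n ρ := by
  apply Finset.sum_congr rfl
  intro i hi
  exact cellLoss_eq_cellTotal hρ _ _ (h.trans (critTime_antitone hρ (Finset.mem_range.1 hi)))

theorem lowLoss_eq_zero (δ₀ δ : ℝ) {n : ℕ} {t : ℝ} (h : critTime n ρ ≤ t) :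
    lowLoss δ₀ δ n t ρ = 0 := by
  rw [lowLoss, max_eq_left, zero_mul]
  rw [sub_nonpos, le_div_iff₀ (critTime_pos hρ n)]
  linarith

theorem resLoss_eq_zero_of_le (δ : ℝ) {k t : ℝ} (h : ρ / (8 * k ^ 2) ≤ |t - ρ / k|) :
    resLoss δ k t ρ = 0 := by
  rw [resLoss, max_eq_left]
  rw [sub_nonpos]
  exact logTerm_mono δ (by positivity) h

theorem le_abs_sub_of_critTime_le {i : ℕ} {t : ℝ} (h : critTime i ρ ≤ t) :
    ρ / (8 * ((i : ℝ) + 1) ^ 2) < |t - ρ / (i + 1)| := by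
  have := le_critTime_sub_center hρ i
  exact lt_of_lt_of_le (by linarith) (le_abs_self _)

theorem le_abs_sub_of_le_critTime {i : ℕ} {t : ℝ} (h : t ≤ critTime (i + 1) ρ) :
    ρ / (8 * ((i : ℝ) + 1) ^ 2) < |t - ρ / (i + 1)| := by
  have := le_center_sub_critTime hρ i
  exact lt_of_lt_of_le (by linarith) (neg_le_abs _)

theorem resLoss_eq_zero_of_critTime_le (δ : ℝ) {i : ℕ} {t : ℝ} (h : critTime i ρ ≤ t) :
    resLoss δ ((i : ℝ) + 1) t ρ = 0 :=
  resLoss_eq_zero_of_le hρ _ (le_abs_sub_of_critTime_le hρ h).le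

theorem resLoss_eq_zero_of_le_critTime (δ : ℝ) {i : ℕ} {t : ℝ} (h : t ≤ critTime (i + 1) ρ) :
    resLoss δ ((i : ℝ) + 1) t ρ = 0 :=
  resLoss_eq_zero_of_le hρ _ (le_abs_sub_of_le_critTime hρ h).le

/-! The index of the interval. -/

omit hρ in
theorem critIndex_spec {n : ℕ} (hn : 1 ≤ n) {t : ℝ} (h : critTime n ρ ≤ t) (ht : t < 2 * ρ) :
    ∃ i : ℕ, critIndex t ρ = i + 1 ∧ i + 1 ≤ n ∧ critTime (i + 1) ρ ≤ t ∧ t < critTime i ρ := by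
  have hmem : n ∈ {l : ℕ | 1 ≤ l ∧ critTime l ρ ≤ t} := ⟨hn, h⟩
  have h1 := Nat.sInf_mem ⟨n, hmem⟩
  have h2 := Nat.sInf_le hmem
  rw [← critIndex] at h1 h2
  obtain ⟨i, hi⟩ : ∃ i, critIndex t ρ = i + 1 := ⟨_, (Nat.succ_pred_eq_of_pos h1.1).symm⟩
  refine ⟨i, hi, hi ▸ h2, hi ▸ h1.2, ?_⟩
  rcases Nat.eq_zero_or_pos i with rfl | h0
  · rwa [critTime_zero]
  · by_contra hcon
    have : critIndex t ρ ≤ i := Nat.sInf_le ⟨h0, not_lt.1 hcon⟩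
    omega

theorem wNRon_critTime (δ₀ δ : ℝ) (n : ℕ) :
    (∀ t, critTime (n + 1) ρ ≤ t → t ≤ critTime n ρ →
      wNRon δ₀ δ ρ n (critTime n ρ) = Real.exp (-totalSum δ₀ δ n ρ) →
      wNRon δ₀ δ ρ (n + 1) t = Real.exp (-(cellLoss δ₀ δ n t ρ + totalSum δ₀ δ n ρ))) := by
  intro t h1 h2 h3
  have hc1 := center_lt_critTime hρ n
  have hc2 := critTime_succ_lt_center hρ n
  simp only [wNRon, h3, cellLoss]
  split_ifs with hc
  · rw [max_eq_left hc, min_eq_left h2, min_eq_right hc, max_eq_left hc2.le, sub_self,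
      logTerm_zero, abs_of_nonneg (by linarith), abs_of_nonneg (by linarith),
      Real.div_rpow (by linarith [one_le_logArg δ (sub_nonneg.2 hc)])
        (by linarith [one_le_logArg δ (sub_nonneg.2 hc1.le)]),
      logArg_rpow _ (by linarith), logArg_rpow _ (by linarith), ← Real.exp_sub, ← Real.exp_add]
    congr 1
    ring
  · rw [not_le] at hc
    rw [max_eq_right hc.le, min_eq_left hc1.le, min_eq_left hc.le, max_eq_left h1, sub_self,
      logTerm_zero, abs_of_neg (by linarith), neg_sub, abs_of_nonneg (by linarith),
      one_div, one_div, Real.inv_rpow (by linarith [one_le_logArg δ (sub_nonneg.2 hc.le)]),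
      Real.inv_rpow (by linarith [one_le_logArg δ (sub_nonneg.2 hc1.le)]),
      logArg_rpow _ (by linarith), logArg_rpow _ (by linarith), ← Real.exp_neg, ← Real.exp_neg,
      ← Real.exp_add, ← Real.exp_add]
    congr 1
    ring

theorem wNRon_eq_totalSum (δ₀ δ : ℝ) (n : ℕ) :
    wNRon δ₀ δ ρ n (critTime n ρ) = Real.exp (-totalSum δ₀ δ n ρ) := by
  induction n with
  | zero => simp [wNRon, totalSum]
  | succ n ih =>
    rw [wNRon_critTime hρ δ₀ δ n _ le_rfl (critTime_antitone hρ (Nat.le_succ n)) ih,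
      cellLoss_eq_cellTotal hρ _ _ le_rfl, totalSum, totalSum, Finset.sum_range_succ, add_comm]

theorem wNRpos_eq (δ₀ δ : ℝ) (hn : 1 ≤ kZero δ ρ) (t : ℝ) :
    wNRpos δ₀ δ t ρ
      = Real.exp (-(cellSum δ₀ δ (kZero δ ρ) t ρ + lowLoss δ₀ δ (kZero δ ρ) t ρ)) := by
  simp only [wNRpos]
  set n := kZero δ ρ
  split_ifs with h1 h2
  · have h0 : critTime 0 ρ ≤ t := by rwa [critTime_zero]
    rw [cellSum_eq_of_le hρ _ _ (Nat.zero_le n) h0,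
      lowLoss_eq_zero hρ _ _ ((critTime_antitone hρ (Nat.zero_le n)).trans h0)]
    simp [cellSum]
  · obtain ⟨i, hi, hin, hi1, hi2⟩ := critIndex_spec hn h2 (not_le.1 h1)
    rw [hi, wNRon_critTime hρ δ₀ δ i t hi1 hi2.le (wNRon_eq_totalSum hρ δ₀ δ i),
      lowLoss_eq_zero hρ _ _ h2, cellSum_eq_of_le hρ _ _ hin hi1, cellSum,
      Finset.sum_range_succ, ← cellSum, cellSum_eq_totalSum hρ _ _ hi2.le, add_zero, add_comm]
  · rw [not_le] at h2
    have : 0 ≤ 1 - t / critTime n ρ := by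
      rw [sub_nonneg, div_le_one (critTime_pos hρ n)]
      exact h2.le
    rw [wNRon_eq_totalSum hρ, cellSum_eq_totalSum hρ _ _ h2.le, lowLoss, max_eq_right this,
      ← Real.exp_mul, ← Real.exp_mul, ← Real.exp_add]
    congr 1
    ring

theorem wRpos_eq (δ₀ δ : ℝ) {t : ℝ} (h : critTime (kZero δ ρ) ρ ≤ t)
    (ht : t < 2 * ρ) :
    wRpos δ₀ δ t ρ = wNRpos δ₀ δ t ρ * Real.exp (-resLoss δ (critIndex t ρ) t ρ) := by
  simp only [wRpos]
  rw [if_neg (not_le.2 ht)]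
  split_ifs with h1
  · have h2 : 0 ≤ ρ / (8 * (critIndex t ρ : ℝ) ^ 2) := by positivity
    rw [resLoss, max_eq_right (sub_nonneg.2 (logTerm_mono δ (abs_nonneg _) h1.2)), neg_sub,
      Real.exp_sub, exp_logTerm _ h2, exp_logTerm _ (abs_nonneg _)]
  · rw [resLoss_eq_zero_of_le hρ]
    · simp
    · by_contra hcon
      exact h1 ⟨h, (not_le.1 hcon).le⟩

theorem wKpos_eq (δ₀ δ : ℝ) (hn : 1 ≤ kZero δ ρ) (k : ℤ) (t : ℝ) :
    wKpos δ₀ δ k t ρ = Real.exp (-loss δ₀ δ (kZero δ ρ) k t ρ) := by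
  have hnr := wNRpos_eq hρ δ₀ δ hn t
  rw [wKpos, loss, neg_add, Real.exp_add, ← hnr]
  have hiff : (1 ≤ k ∧ k ≤ (kZero δ ρ : ℤ)) ↔ (1 ≤ k ∧ (k : ℝ) ≤ √(δ ^ 3 * ρ)) := by
    refine and_congr_right fun hk => ?_
    lift k to ℕ using by omega
    rw [kZero]
    rw [Nat.cast_le, Nat.le_floor_iff (Real.sqrt_nonneg _)]
    simp
  by_cases hk : 1 ≤ k ∧ k ≤ (kZero δ ρ : ℤ)
  swap
  · rw [if_neg hk, if_neg]
    · simp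
    · intro hcon
      exact hk (hiff.2 ⟨hcon.1, hcon.2.1⟩)
  rw [if_pos hk]
  obtain ⟨i, rfl⟩ : ∃ i : ℕ, k = i + 1 := ⟨(k - 1).toNat, by omega⟩
  have hi : i + 1 ≤ kZero δ ρ := by exact_mod_cast hk.2
  have htn : ((i : ℤ) + 1).toNat = i + 1 := by omega
  have hcast : (((i : ℤ) + 1 : ℤ) : ℝ) = (i : ℝ) + 1 := by push_cast; rfl
  rw [htn, hcast]
  by_cases hmem : t ∈ critInterval (i + 1) ρ
  swap
  · rw [if_neg (fun hcon => hmem hcon.2.2)]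
    have : resLoss δ ((i : ℝ) + 1) t ρ = 0 := by
      rw [critInterval, Set.mem_Icc, not_and_or, not_le, not_le, Nat.add_sub_cancel] at hmem
      rcases hmem with h | h
      · exact resLoss_eq_zero_of_le_critTime hρ _ h.le
      · exact resLoss_eq_zero_of_critTime_le hρ _ h.le
    rw [this]
    simp
  · rw [if_pos ⟨hk.1, by simpa using (hiff.1 hk).2, hmem⟩]
    rw [critInterval, Set.mem_Icc, Nat.add_sub_cancel] at hmem
    rcases lt_or_ge t (2 * ρ) with ht | ht
    · have h : critTime (kZero δ ρ) ρ ≤ t := (critTime_antitone hρ hi).trans hmem.1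
      rw [wRpos_eq hρ δ₀ δ h ht]
      obtain ⟨j, hj, -, hj1, hj2⟩ := critIndex_spec (Nat.succ_le_succ (Nat.zero_le i)) hmem.1 ht
      rw [hj]
      -- The index chosen by `critIndex` can differ from `k` only if `t` is a common endpoint of two
      -- intervals, and there both resonant terms vanish.
      rcases (lt_trichotomy i j) with hij | rfl | hij
      · exact absurd (hmem.1.trans_lt hj2) (not_lt.2 (critTime_antitone hρ hij))
      · push_cast; rfl
      · have e : t ≤ critTime (j + 1) ρ := hmem.2.trans (critTime_antitone hρ hij)
        push_cast
        rw [resLoss_eq_zero_of_le_critTime hρ _ e]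
        have e2 : critTime i ρ ≤ t := (critTime_antitone hρ hij).trans hj1
        rw [resLoss_eq_zero_of_critTime_le hρ _ e2]
    · have h0 : critTime 0 ρ ≤ t := by rwa [critTime_zero]
      have e2 : critTime i ρ ≤ t := (critTime_antitone hρ (Nat.zero_le i)).trans h0
      rw [resLoss_eq_zero_of_critTime_le hρ _ e2, wRpos, wNRpos, if_pos ht, if_pos ht]
      simp

end

theorem threshold_pos {δ : ℝ} (hδ : 0 < δ) : 0 < threshold δ := by
  rw [threshold]; positivity

theorem wK_neg (δ₀ : ℝ) {δ : ℝ} (hδ : 0 < δ) (k : ℤ) (t ρ : ℝ) : wK δ₀ δ (-k) t (-ρ) = wK δ₀ δ k t ρ := by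
  simp only [wK, abs_neg, neg_neg, Left.neg_pos_iff]
  split_ifs with h1 h2 h3 h3
  · rfl
  · linarith
  · rfl
  · rfl
  · have : ρ = 0 := by linarith
    subst this
    rw [abs_zero] at h1
    exact absurd (threshold_pos hδ).le h1

theorem one_le_kZero {δ : ℝ} (hδ : 0 < δ) (hδ1 : δ ≤ 1) {ρ : ℝ} (hρ : threshold δ < ρ) :
    1 ≤ kZero δ ρ := by
  rw [kZero, Nat.one_le_floor_iff, Real.one_le_sqrt]
  rw [threshold, inv_lt_iff_one_lt_mul₀ (by positivity)] at hρ
  have h7 : δ ^ 7 ≤ 1 := pow_le_one₀ hδ.le hδ1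
  have hρ0 : 0 < ρ := by
    by_contra h
    nlinarith [pow_pos hδ 10]
  have : 0 < δ ^ 3 * ρ := by positivity
  nlinarith

theorem wK_eq_exp_loss {δ : ℝ} (hδ : 0 < δ) (hδ1 : δ ≤ 1) (δ₀ : ℝ) (k : ℤ) (t : ℝ) {ρ : ℝ}
    (hρ : threshold δ < ρ) :
    wK δ₀ δ k t ρ = Real.exp (-loss δ₀ δ (kZero δ ρ) k t ρ) := by
  have h0 := (threshold_pos hδ).trans hρ
  rw [wK, abs_of_pos h0, if_neg (not_le.2 hρ), if_pos h0, wKpos_eq h0 _ _ (one_le_kZero hδ hδ1 hρ)]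

end GevreyWeights

namespace GevreyWeights

/-! ### Variation of the explicit formula in the frequency -/

/-- Smallness of `δ` in terms of `δ₀`. -/
structure IsSmall (δ₀ δ : ℝ) : Prop where
  pos₀ : 0 < δ₀
  pos : 0 < δ
  small : 10 ^ 4 * (1 + 2 * δ₀) ^ 2 * √δ ≤ 1

namespace IsSmall

variable {δ₀ δ : ℝ} (h : IsSmall δ₀ δ)
include h

theorem sqrt_pos : 0 < √δ := Real.sqrt_pos.2 h.pos

theorem sqrt_sq : √δ ^ 2 = δ := Real.sq_sqrt h.pos.le

theorem mul_sqrt_le : 10 ^ 4 * ((1 + 2 * δ₀) * √δ) ≤ 1 := by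
  have := h.small
  have := h.pos₀
  have := h.sqrt_pos
  have : (1 + 2 * δ₀) * √δ ≤ (1 + 2 * δ₀) ^ 2 * √δ := by
    apply mul_le_mul_of_nonneg_right _ h.sqrt_pos.le
    nlinarith
  linarith

theorem sqrt_le : 10 ^ 4 * √δ ≤ 1 := by
  have := h.mul_sqrt_le
  have := mul_pos h.pos₀ h.sqrt_pos
  nlinarith

theorem le_sqrt : 10 ^ 4 * δ ≤ √δ := by
  have := h.sqrt_le
  have := h.sqrt_pos
  nlinarith [h.sqrt_sq]

theorem le_one : δ ≤ 1 := by
  have := h.sqrt_le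
  have := h.le_sqrt
  linarith

theorem le_div : δ ≤ 1 / 10 ^ 8 := by
  have := h.sqrt_le
  have := h.le_sqrt
  norm_num
  linarith

end IsSmall

/-! One interval. -/

/-- The part of `[ρ, ρ']` in `[r, R]`. -/
noncomputable def overlap (r R ρ ρ' : ℝ) : ℝ := (min ρ' R - min ρ' r) - (min ρ R - min ρ r)

section overlap

variable {r R ρ ρ' : ℝ} (hr : r ≤ R) (hρ : ρ ≤ ρ')
include hr hρ

theorem overlap_nonneg : 0 ≤ overlap r R ρ ρ' := by
  rw [overlap]
  rcases min_cases ρ' R with h1 | h1 <;> rcases min_cases ρ' r with h2 | h2 <;>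
    rcases min_cases ρ R with h3 | h3 <;> rcases min_cases ρ r with h4 | h4 <;> linarith

theorem overlap_le_sub : overlap r R ρ ρ' ≤ ρ' - ρ := by
  rw [overlap]
  rcases min_cases ρ' R with h1 | h1 <;> rcases min_cases ρ' r with h2 | h2 <;>
    rcases min_cases ρ R with h3 | h3 <;> rcases min_cases ρ r with h4 | h4 <;> linarith

theorem overlap_pos (h : 0 < overlap r R ρ ρ') : ρ < R ∧ r < ρ' := by
  rw [overlap] at h
  rcases min_cases ρ' R with h1 | h1 <;> rcases min_cases ρ' r with h2 | h2 <;>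
    rcases min_cases ρ R with h3 | h3 <;> rcases min_cases ρ r with h4 | h4 <;>
      constructor <;> linarith

omit hr hρ in
theorem overlap_eq (h1 : ρ ≤ r) (h2 : R ≤ ρ') (hr : r ≤ R) : overlap r R ρ ρ' = R - r := by
  rw [overlap, min_eq_right h2, min_eq_right (hr.trans h2), min_eq_left h1,
    min_eq_left (h1.trans hr)]
  ring

end overlap

/-! ### Clamped distances from `t` to the critical time of one interval. -/

section cell

variable {c τ τ' r R t ρ ρ' : ℝ} (hτ' : 0 < τ') (hc' : τ' ≤ c) (hc : c ≤ τ) (hr : t = τ * r)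
  (hR : t = τ' * R) (ht : 0 ≤ t) (hρ : 0 < ρ) (hρρ : ρ ≤ ρ')
include hτ' hc' hc hr hR ht hρ hρρ

theorem cell_endpoints : 0 ≤ r ∧ r ≤ R ∧ c * r ≤ t ∧ t ≤ c * R := by
  have h1 : 0 ≤ r := by
    by_contra h
    nlinarith
  have h2 : 0 ≤ R := by
    by_contra h
    nlinarith
  refine ⟨h1, ?_, by nlinarith, by nlinarith⟩
  by_contra h
  nlinarith

/-- The clamped distance after the critical time grows for `ρ ≤ r`, where it equals `(τ-c)ρ`; it
then decreases with slope `-c` until it reaches zero at `t/c ≤ R`. All of its decrease thus takes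
place in `[r, R]`, at rate at most `c`. -/
theorem late_le : min (max t (c * ρ)) (τ * ρ) - c * ρ
    ≤ (min (max t (c * ρ')) (τ * ρ') - c * ρ') + c * overlap r R ρ ρ' := by
  obtain ⟨h1, h2, h3, h4⟩ := cell_endpoints hτ' hc' hc hr hR ht hρ hρρ
  have hov := overlap_nonneg h2 hρρ
  have hc0 : 0 < c := by linarith
  have hov' : 0 ≤ c * overlap r R ρ ρ' := by positivity
  have hu1 : min (max t (c * ρ)) (τ * ρ) ≤ max t (c * ρ) := min_le_left _ _
  have hu2 : min (max t (c * ρ)) (τ * ρ) ≤ τ * ρ := min_le_right _ _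
  have hcc : c * ρ ≤ c * ρ' := by gcongr
  have hu'0 : c * ρ' ≤ min (max t (c * ρ')) (τ * ρ') :=
    le_min (le_max_right _ _) (mul_le_mul_of_nonneg_right hc (by linarith))
  rcases le_total (max t (c * ρ')) (τ * ρ') with hm | hm
  swap
  · rw [min_eq_right hm]
    nlinarith
  have hrρ : r ≤ ρ' := by
    have : t ≤ τ * ρ' := (le_max_left _ _).trans hm
    nlinarith
  rcases le_total R ρ with hRρ | hRρ
  · have := hu1.trans_eq (max_eq_right (by nlinarith : t ≤ c * ρ))
    linarith
  have hu : min (max t (c * ρ)) (τ * ρ) - c * ρ ≤ max (t - c * max ρ r) 0 := by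
    rcases le_total ρ r with h | h
    · rw [max_eq_right h]
      exact le_max_of_le_left (by nlinarith)
    · rw [max_eq_left h]
      rcases max_cases t (c * ρ) with h' | h'
      · exact le_max_of_le_left (by linarith)
      · exact le_max_of_le_right (by linarith)
  have hu' : t - c * min ρ' R ≤ min (max t (c * ρ')) (τ * ρ') - c * ρ' := by
    rcases le_total ρ' R with h | h
    · rw [min_eq_left h, min_eq_left hm]
      linarith [le_max_left t (c * ρ')]
    · rw [min_eq_right h]
      linarith
  have hx : overlap r R ρ ρ' = min ρ' R - max ρ r := by
    rw [overlap, min_eq_right hrρ, min_eq_left hRρ]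
    linarith [min_add_max ρ r]
  rw [hx] at hov' ⊢
  rcases max_cases (t - c * max ρ r) 0 with h | h
  · linarith
  · have := mul_le_mul_of_nonneg_left (le_max_right ρ r) hc0.le
    have h5 : max (t - c * max ρ r) 0 ≤ 0 := by linarith
    linarith

/-- Divided by the frequency, the late distance is `min (max (t/ρ) c) τ - c`, which is
non-increasing in `ρ`. -/
theorem late_div_le : (min (max t (c * ρ')) (τ * ρ') - c * ρ') * ρ
    ≤ (min (max t (c * ρ)) (τ * ρ) - c * ρ) * ρ' := by
  have h0 : 0 ≤ ρ' := by linarith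
  rw [sub_mul, sub_mul, min_mul_of_nonneg _ _ hρ.le, min_mul_of_nonneg _ _ h0,
    max_mul_of_nonneg _ _ hρ.le, max_mul_of_nonneg _ _ h0]
  have e1 : c * ρ' * ρ = c * ρ * ρ' := by ring
  have e2 : τ * ρ' * ρ = τ * ρ * ρ' := by ring
  rw [e1, e2]
  gcongr

/-- The early distance is zero up to `ρ = t/c`, then has slope `c`, then slope `c - τ' ≥ 0`. -/
theorem early_mono : c * ρ - max (min t (c * ρ)) (τ' * ρ)
    ≤ c * ρ' - max (min t (c * ρ')) (τ' * ρ') := by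
  have hcc : c * ρ ≤ c * ρ' := by gcongr; linarith
  have h : max (min t (c * ρ')) (τ' * ρ') ≤ max (min t (c * ρ)) (τ' * ρ) + c * (ρ' - ρ) := by
    apply max_le
    · have := le_max_left (min t (c * ρ)) (τ' * ρ)
      rcases min_cases t (c * ρ) with h | h <;> rcases min_cases t (c * ρ') with h' | h' <;>
        nlinarith
    · have := le_max_right (min t (c * ρ)) (τ' * ρ)
      nlinarith
  linarith

/-- Divided by the frequency, the early distance is `c - max (min (t/ρ) c) τ'`. It increases only
for `ρ` between `t/c` and `R`, hence inside `[r, R]`, and there the undivided distance has slope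
`c`. -/
theorem early_le : (c * ρ' - max (min t (c * ρ')) (τ' * ρ')) * ρ
    ≤ ((c * ρ - max (min t (c * ρ)) (τ' * ρ)) + c * overlap r R ρ ρ') * ρ' := by
  obtain ⟨h1, h2, h3, h4⟩ := cell_endpoints hτ' hc' hc hr hR ht hρ hρρ
  have hov := overlap_nonneg h2 hρρ
  have hc0 : 0 < c := by linarith
  have hov' : 0 ≤ c * overlap r R ρ ρ' := by positivity
  have hρ' : 0 < ρ' := by linarith
  have hv0 : 0 ≤ c * ρ - max (min t (c * ρ)) (τ' * ρ) :=
    sub_nonneg.2 (max_le (min_le_right _ _) (mul_le_mul_of_nonneg_right hc' hρ.le))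
  have hv1 : c * ρ' - max (min t (c * ρ')) (τ' * ρ') ≤ c * ρ' - τ' * ρ' := by
    linarith [le_max_right (min t (c * ρ')) (τ' * ρ')]
  have hv2 : c * ρ' - max (min t (c * ρ')) (τ' * ρ') ≤ c * ρ' - min t (c * ρ') := by
    linarith [le_max_left (min t (c * ρ')) (τ' * ρ')]
  rcases le_total (c * ρ') t with htc | htc
  · have := hv2.trans_eq (by rw [min_eq_right htc, sub_self])
    have : 0 ≤ (c * ρ - max (min t (c * ρ)) (τ' * ρ) + c * overlap r R ρ ρ') * ρ' := by positivity
    nlinarith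
  replace hv2 := hv2.trans_eq (by rw [min_eq_left htc])
  have hrρ : r ≤ ρ' := by
    by_contra h
    nlinarith
  rcases le_total (min t (c * ρ)) (τ' * ρ) with hm | hm
  · rw [max_eq_right hm]
    nlinarith [mul_nonneg hov' hρ'.le]
  have hRρ : ρ ≤ R := by
    by_contra h
    have : τ' * ρ ≤ t := hm.trans (min_le_left _ _)
    nlinarith
  have hx : overlap r R ρ ρ' = min ρ' R - max ρ r := by
    rw [overlap, min_eq_right hrρ, min_eq_left hRρ]
    linarith [min_add_max ρ r]
  rw [max_eq_left hm] at hv0 ⊢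
  have hv : c * max ρ r - t ≤ c * ρ - min t (c * ρ) := by
    rcases le_total ρ r with h | h
    · rw [max_eq_right h]
      linarith [min_le_right t (c * ρ)]
    · rw [max_eq_left h]
      linarith [min_le_left t (c * ρ)]
  rcases le_total ρ' R with h | h
  · rw [min_eq_left h] at hx
    have : c * ρ' - max (min t (c * ρ')) (τ' * ρ') ≤ c * ρ - min t (c * ρ) + c * overlap r R ρ ρ' := by
      rw [hx]; nlinarith
    calc _ ≤ (c * ρ - min t (c * ρ) + c * overlap r R ρ ρ') * ρ := by gcongr
      _ ≤ _ := by gcongr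
  · rw [min_eq_right h] at hx
    have e : (c * R - t) ≤ c * ρ - min t (c * ρ) + c * overlap r R ρ ρ' := by
      rw [hx]; nlinarith
    have e2 : (c * ρ' - max (min t (c * ρ')) (τ' * ρ')) * R ≤ (c * R - t) * ρ' := by
      have : 0 ≤ R := by linarith
      calc _ ≤ (c * ρ' - τ' * ρ') * R := by gcongr
        _ = (c * R - τ' * R) * ρ' := by ring
        _ = _ := by rw [← hR]
    have hcc : c * ρ' - max (min t (c * ρ')) (τ' * ρ') ≥ 0 :=
      sub_nonneg.2 (max_le (min_le_right _ _) (mul_le_mul_of_nonneg_right hc' hρ'.le))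
    calc _ ≤ (c * ρ' - max (min t (c * ρ')) (τ' * ρ')) * R := by gcongr
      _ ≤ (c * R - t) * ρ' := e2
      _ ≤ _ := by gcongr

end cell

/-! ### Critical frequencies at a fixed time. -/

theorem critTime_eq_mul (i : ℕ) (ρ : ℝ) : critTime i ρ = critTime i 1 * ρ := by
  rcases i with _ | i
  · simp [critTime_zero]
  · rw [critTime_succ, critTime_succ]; ring

/-- The frequency `r_i` with `t = t_{i, r_i}`. -/
noncomputable def critFreq (t : ℝ) (i : ℕ) : ℝ := t / critTime i 1

theorem eq_mul_critFreq (t : ℝ) (i : ℕ) : t = critTime i 1 * critFreq t i := by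
  rw [critFreq, mul_div_cancel₀ _ (critTime_pos one_pos i).ne']

theorem critFreq_zero (t : ℝ) : critFreq t 0 = t / 2 := by simp [critFreq, critTime_zero]

theorem critFreq_succ (t : ℝ) (i : ℕ) :
    critFreq t (i + 1) = t * (2 * (i + 1) * (i + 2) / (2 * i + 3)) := by
  rw [critFreq, critTime_succ]
  have : (1 / ((i : ℝ) + 2) + 1 / (i + 1)) / 2 = (2 * i + 3) / (2 * (i + 1) * (i + 2)) := by
    field_simp; ring
  rw [this, div_div_eq_mul_div, mul_div_assoc]

theorem critFreq_succ_sub {t : ℝ} (ht : 0 ≤ t) (i : ℕ) :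
    t / 2 ≤ critFreq t (i + 1) - critFreq t i := by
  rcases i with _ | i
  · rw [critFreq_succ, critFreq_zero]; norm_num; linarith
  · rw [critFreq_succ, critFreq_succ]
    push_cast
    rw [← mul_sub]
    have : 2 * ((i : ℝ) + 1 + 1) * (i + 1 + 2) / (2 * (i + 1) + 3)
        - 2 * (i + 1) * (i + 2) / (2 * i + 3) - 1 / 2
      = (4 * i ^ 2 + 16 * i + 17) / (2 * (2 * (i + 1) + 3) * (2 * i + 3)) := by
      field_simp; ring
    have : 0 ≤ (4 * (i : ℝ) ^ 2 + 16 * i + 17) / (2 * (2 * (i + 1) + 3) * (2 * i + 3)) := by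
      positivity
    nlinarith

theorem critFreq_mono {t : ℝ} (ht : 0 ≤ t) : Monotone (critFreq t) :=
  monotone_nat_of_le_succ fun i => by linarith [critFreq_succ_sub ht i]

theorem critFreq_succ_le {t : ℝ} (ht : 0 ≤ t) (i : ℕ) : critFreq t (i + 1) ≤ 2 * t * (i + 1) := by
  rw [critFreq_succ]
  have : 2 * ((i : ℝ) + 1) * (i + 2) / (2 * i + 3) ≤ 2 * (i + 1) := by
    rw [div_le_iff₀ (by positivity)]
    nlinarith [(Nat.cast_nonneg i : (0 : ℝ) ≤ i)]
  nlinarith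

/-- The part of `[ρ, ρ']` in `[r_i, r_{i+1}]`. -/
noncomputable def cellOverlap (t : ℝ) (i : ℕ) (ρ ρ' : ℝ) : ℝ :=
  overlap (critFreq t i) (critFreq t (i + 1)) ρ ρ'

/-- For `a ≥ 1` one has `1 + δ²a(y+z) ≤ a(1+δ²y)(1+δ²z)`. This separates the effect of rescaling the
frequency (`a`) from that of moving inside a cell (`z`). -/
theorem logTerm_le_add {δ x y z a : ℝ} (hy : 0 ≤ y) (hz : 0 ≤ z) (hx : 0 ≤ x) (ha : 1 ≤ a)
    (h : x ≤ a * (y + z)) : logTerm δ x ≤ Real.log a + (logTerm δ y + logTerm δ z) := by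
  have h1 := one_le_logArg δ hy
  have h2 := one_le_logArg δ hz
  have h3 := one_le_logArg δ hx
  rw [logTerm, logTerm, logTerm, ← Real.log_mul (by linarith) (by linarith),
    ← Real.log_mul (by linarith) (by positivity)]
  apply Real.log_le_log (by linarith)
  have h4 : δ ^ 2 * x ≤ δ ^ 2 * (a * (y + z)) := by gcongr
  have h5 : 0 ≤ a * ((δ ^ 2 * y) * (δ ^ 2 * z)) := by positivity
  nlinarith

/-! ### Increments of the cell contributions and their sums. -/

section increments

variable {δ₀ t ρ ρ' : ℝ} (hδ₀ : 0 < δ₀) (δ : ℝ) (ht : 0 ≤ t) (hρ : 0 < ρ) (hρρ : ρ ≤ ρ')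
include hρ hρρ

theorem log_div_nonneg : 0 ≤ Real.log (ρ' / ρ) := Real.log_nonneg (by rwa [one_le_div hρ])

theorem log_div_le : Real.log (ρ' / ρ) ≤ (ρ' - ρ) / ρ := by
  have := Real.log_le_sub_one_of_pos (show 0 < ρ' / ρ from div_pos (by linarith) hρ)
  rwa [div_sub_one hρ.ne'] at this

include ht in
theorem cellOverlap_nonneg (i : ℕ) : 0 ≤ cellOverlap t i ρ ρ' :=
  overlap_nonneg (critFreq_mono ht (Nat.le_succ i)) hρρ

theorem logTerm_scale {a : ℝ} (ha : 0 ≤ a) : logTerm δ (a * ρ) ≤ logTerm δ (a * ρ') ∧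
    logTerm δ (a * ρ') ≤ Real.log (ρ' / ρ) + logTerm δ (a * ρ) := by
  refine ⟨logTerm_mono δ (by positivity) (by gcongr), ?_⟩
  have h0 : 0 < ρ' := by linarith
  have := logTerm_le_add (δ := δ) (x := a * ρ') (y := a * ρ) (z := 0) (a := ρ' / ρ) (by positivity)
    le_rfl (by positivity) (by rwa [one_le_div hρ]) (by rw [add_zero]; field_simp; rfl)
  rwa [logTerm_zero, add_zero] at this

include hδ₀ ht in
-- Inserting the four geometric facts on clamped distances into logarithms: the distances scale with
-- `ρ`, which costs `log (ρ'/ρ)`, and deviate from scaling only through the overlap with the cell.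
-- The factor `1 + 2δ₀` collects the exponent `δ₀` of the late half and `1 + δ₀` of the early half.
theorem cellLoss_sub_le (i : ℕ) : cellLoss δ₀ δ i t ρ ≤ cellLoss δ₀ δ i t ρ' ∧
    cellLoss δ₀ δ i t ρ' - cellLoss δ₀ δ i t ρ
      ≤ (1 + 2 * δ₀) * (Real.log (ρ' / ρ) + logTerm δ (cellOverlap t i ρ ρ' / (i + 1))) := by
  have h1 : ∀ ρ : ℝ, ρ / ((i : ℝ) + 1) = 1 / ((i : ℝ) + 1) * ρ := fun ρ => by ring
  rw [cellLoss, cellLoss, critTime_eq_mul i ρ, critTime_eq_mul (i + 1) ρ, critTime_eq_mul i ρ',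
    critTime_eq_mul (i + 1) ρ', h1 ρ, h1 ρ']
  have hρ' : 0 < ρ' := by linarith
  have e1 := (critTime_succ_lt_center one_pos i).le
  have e2 := (center_lt_critTime one_pos i).le
  have e3 := critTime_pos one_pos (i + 1)
  have e4 := eq_mul_critFreq t i
  have e5 := eq_mul_critFreq t (i + 1)
  have hx := cellOverlap_nonneg ht hρ hρρ i
  have hy : 1 / ((i : ℝ) + 1) * cellOverlap t i ρ ρ' = cellOverlap t i ρ ρ' / (i + 1) := by ring
  have f1 := late_le e3 e1 e2 e4 e5 ht hρ hρρ
  have f2 := late_div_le e3 e1 e2 e4 e5 ht hρ hρρ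
  have f3 := early_mono e3 e1 e2 e4 e5 ht hρ hρρ
  have f4 := early_le e3 e1 e2 e4 e5 ht hρ hρρ
  rw [← cellOverlap, hy] at f1 f4
  have hz : 0 ≤ cellOverlap t i ρ ρ' / (i + 1) := by positivity
  set x := cellOverlap t i ρ ρ' / (i + 1)
  set c := 1 / ((i : ℝ) + 1)
  set τ := critTime i 1
  set τ' := critTime (i + 1) 1
  rw [← sub_mul, ← sub_mul]
  have ha : 0 ≤ τ - c := by linarith
  obtain ⟨g1, g2⟩ := logTerm_scale δ hρ hρρ ha
  have hu : ∀ ρ : ℝ, 0 < ρ → 0 ≤ min (max t (c * ρ)) (τ * ρ) - c * ρ := fun ρ hρ =>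
    sub_nonneg.2 (le_min (le_max_right _ _) (mul_le_mul_of_nonneg_right e2 hρ.le))
  have hv : ∀ ρ : ℝ, 0 < ρ → 0 ≤ c * ρ - max (min t (c * ρ)) (τ' * ρ) := fun ρ hρ =>
    sub_nonneg.2 (max_le (min_le_right _ _) (mul_le_mul_of_nonneg_right e1 hρ.le))
  have hu0 := hu ρ hρ
  have hu1 := hu ρ' hρ'
  have hv0 := hv ρ hρ
  have hv1 := hv ρ' hρ'
  have hua : min (max t (c * ρ)) (τ * ρ) - c * ρ ≤ (τ - c) * ρ := by
    linarith [min_le_right (max t (c * ρ)) (τ * ρ)]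
  set u := min (max t (c * ρ)) (τ * ρ) - c * ρ
  set u' := min (max t (c * ρ')) (τ * ρ') - c * ρ'
  set v := c * ρ - max (min t (c * ρ)) (τ' * ρ)
  set v' := c * ρ' - max (min t (c * ρ')) (τ' * ρ')
  have g3 := logTerm_mono δ hv0 f3
  have g4 : logTerm δ v' ≤ Real.log (ρ' / ρ) + (logTerm δ v + logTerm δ x) := by
    apply logTerm_le_add hv0 hz hv1 (by rwa [one_le_div hρ])
    rw [div_mul_eq_mul_div, le_div_iff₀ hρ]
    linarith
  have g5 : logTerm δ u ≤ logTerm δ u' + logTerm δ x := by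
    have := logTerm_le_add (δ := δ) hu1 hz hu0 le_rfl (by rwa [one_mul])
    rwa [Real.log_one, zero_add] at this
  -- After exponentiation both sides are quadratic polynomials in `δ²`, and the coefficients are
  -- compared one by one. Both comparisons rest on the monotonicity of `u/ρ`; the linear one also
  -- uses `u ≤ (τ-c)ρ`.
  have g6 : logTerm δ u' + logTerm δ ((τ - c) * ρ) ≤ logTerm δ u + logTerm δ ((τ - c) * ρ') := by
    have a0 : 0 ≤ (τ - c) * ρ := by positivity
    have a1 : 0 ≤ (τ - c) * ρ' := by positivity
    have b1 := one_le_logArg δ hu0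
    have b2 := one_le_logArg δ hu1
    have b3 := one_le_logArg δ a0
    have b4 := one_le_logArg δ a1
    rw [logTerm, logTerm, logTerm, logTerm, ← Real.log_mul (by linarith) (by linarith),
      ← Real.log_mul (by linarith) (by linarith)]
    apply Real.log_le_log (by positivity)
    have k1 : u' + (τ - c) * ρ ≤ u + (τ - c) * ρ' := by
      rcases le_total u' u with h | h
      · nlinarith
      · have : (u' - u) * ρ ≤ ((τ - c) * (ρ' - ρ)) * ρ := by nlinarith
        have := le_of_mul_le_mul_right this hρ
        linarith only [this]
    have k2 : u' * ((τ - c) * ρ) ≤ u * ((τ - c) * ρ') := by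
      linarith only [mul_le_mul_of_nonneg_left f2 ha]
    have k3 : δ ^ 2 * (u' + (τ - c) * ρ) ≤ δ ^ 2 * (u + (τ - c) * ρ') := by gcongr
    have k4 : δ ^ 4 * (u' * ((τ - c) * ρ)) ≤ δ ^ 4 * (u * ((τ - c) * ρ')) := by gcongr
    linarith only [k3, k4]
  have m1 := mul_le_mul_of_nonneg_left (show logTerm δ ((τ - c) * ρ) - logTerm δ u
    ≤ logTerm δ ((τ - c) * ρ') - logTerm δ u' by linarith) hδ₀.le
  have m2 := mul_le_mul_of_nonneg_left g3 (show 0 ≤ 1 + δ₀ by linarith)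
  have m3 := mul_le_mul_of_nonneg_left (show (logTerm δ ((τ - c) * ρ') - logTerm δ u')
    - (logTerm δ ((τ - c) * ρ) - logTerm δ u) ≤ Real.log (ρ' / ρ) + logTerm δ x by linarith) hδ₀.le
  have m4 := mul_le_mul_of_nonneg_left (show logTerm δ v' - logTerm δ v
    ≤ Real.log (ρ' / ρ) + logTerm δ x by linarith) (show 0 ≤ 1 + δ₀ by linarith)
  constructor
  · linarith
  · linarith

include hδ₀ ht in
theorem cellSum_sub_le (n : ℕ) : cellSum δ₀ δ n t ρ ≤ cellSum δ₀ δ n t ρ' ∧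
    cellSum δ₀ δ n t ρ' - cellSum δ₀ δ n t ρ ≤ (1 + 2 * δ₀) * (n * Real.log (ρ' / ρ)
      + ∑ i ∈ Finset.range n, logTerm δ (cellOverlap t i ρ ρ' / (i + 1))) := by
  constructor
  · exact Finset.sum_le_sum fun i _ => (cellLoss_sub_le hδ₀ δ ht hρ hρρ i).1
  · rw [cellSum, cellSum, ← Finset.sum_sub_distrib]
    refine (Finset.sum_le_sum fun i _ => (cellLoss_sub_le hδ₀ δ ht hρ hρρ i).2).trans ?_
    rw [← Finset.mul_sum, Finset.sum_add_distrib]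
    simp

include hδ₀ in
theorem totalSum_sub_le (n : ℕ) : totalSum δ₀ δ n ρ ≤ totalSum δ₀ δ n ρ' ∧
    totalSum δ₀ δ n ρ' - totalSum δ₀ δ n ρ ≤ (1 + 2 * δ₀) * (n * Real.log (ρ' / ρ)) := by
  have hρ' : 0 < ρ' := by linarith
  have h := cellSum_sub_le hδ₀ δ le_rfl hρ hρρ n
  rw [cellSum_eq_totalSum hρ _ _ (critTime_pos hρ n).le,
    cellSum_eq_totalSum hρ' _ _ (critTime_pos hρ' n).le] at h
  have e : ∀ i : ℕ, cellOverlap 0 i ρ ρ' = 0 := fun i => by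
    simp [cellOverlap, overlap, critFreq]
  simpa [e, logTerm_zero] using h

include ht in
-- The cells `[r_i, r_{i+1}]` are consecutive, so the sum of the overlaps telescopes to the overlap
-- with `[r_0, r_n]`.
theorem sum_cellOverlap_le (n : ℕ) : ∑ i ∈ Finset.range n, cellOverlap t i ρ ρ' ≤ ρ' - ρ := by
  simp only [cellOverlap, overlap]
  rw [Finset.sum_sub_distrib, Finset.sum_range_sub (fun i => min ρ' (critFreq t i)),
    Finset.sum_range_sub (fun i => min ρ (critFreq t i))]
  exact overlap_le_sub (critFreq_mono ht (Nat.zero_le n)) hρρ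

include ht in
-- If the overlap is not empty then `ρ < r_{i+1} ≤ 2t(i+1)`, so that `1/(i+1) ≤ 2t/ρ`: the gain at
-- small times comes from the large index of the cells met.
theorem logTerm_cellOverlap_le (i : ℕ) : logTerm δ (cellOverlap t i ρ ρ' / (i + 1))
    ≤ δ ^ 2 * min 1 (2 * t / ρ) * cellOverlap t i ρ ρ' := by
  have hx := cellOverlap_nonneg ht hρ hρρ i
  rcases hx.eq_or_lt with h0 | h0
  · rw [← h0]; simp [logTerm]
  obtain ⟨h1, -⟩ := overlap_pos (critFreq_mono ht (Nat.le_succ i)) hρρ h0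
  have h2 := critFreq_succ_le ht i
  refine (log_one_add_le_self (by positivity)).trans ?_
  rw [mul_assoc]
  gcongr
  rw [div_le_iff₀ (by positivity), mul_comm (min _ _), mul_assoc]
  apply le_mul_of_one_le_right hx
  rw [min_mul_of_nonneg _ _ (by positivity)]
  apply le_min
  · linarith [(Nat.cast_nonneg i : (0 : ℝ) ≤ i)]
  · rw [div_mul_eq_mul_div, one_le_div hρ]
    linarith

theorem sum_indicator_le (ht : 0 ≤ t) (x : ℝ) (n : ℕ) :
    ∑ i ∈ Finset.range n, (if critFreq t i < x ∧ x < critFreq t (i + 1) then (1 : ℝ) else 0) ≤ 1 := by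
  rw [Finset.sum_boole]
  norm_cast
  rw [Finset.card_le_one]
  intro i hi j hj
  rw [Finset.mem_filter] at hi hj
  by_contra hne
  rcases lt_or_gt_of_ne hne with h | h
  · have := critFreq_mono ht (Nat.succ_le_of_lt h)
    exact absurd (hi.2.2.trans_le this) (not_lt.2 hj.2.1.le)
  · have := critFreq_mono ht (Nat.succ_le_of_lt h)
    exact absurd (hj.2.2.trans_le this) (not_lt.2 hi.2.1.le)

include ht in
-- A cell that contains an endpoint of `[ρ, ρ']` is charged `δ√(ρ'-ρ)`, and each endpoint lies in at
-- most one cell. Any other cell that is met is covered completely; its width `x` is at least `t/2`,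
-- hence `ρ ≤ 4x(i+1)`, and `√(x/(i+1))` is bounded by the summable quantity `2x/√ρ`.
theorem logTerm_cellOverlap_le_sqrt (hδ : 0 ≤ δ) (i : ℕ) :
    logTerm δ (cellOverlap t i ρ ρ' / (i + 1)) ≤ δ * (2 / √ρ * cellOverlap t i ρ ρ')
      + δ * √(ρ' - ρ) * ((if critFreq t i < ρ ∧ ρ < critFreq t (i + 1) then 1 else 0)
        + (if critFreq t i < ρ' ∧ ρ' < critFreq t (i + 1) then 1 else 0)) := by
  have hx := cellOverlap_nonneg ht hρ hρρ i
  have hm := critFreq_mono ht (Nat.le_succ i)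
  have hj : (1 : ℝ) ≤ (i : ℝ) + 1 := by linarith [(Nat.cast_nonneg i : (0 : ℝ) ≤ i)]
  have hi1 : (0 : ℝ) ≤ if critFreq t i < ρ ∧ ρ < critFreq t (i + 1) then 1 else 0 := by
    split_ifs <;> norm_num
  have hi2 : (0 : ℝ) ≤ if critFreq t i < ρ' ∧ ρ' < critFreq t (i + 1) then 1 else 0 := by
    split_ifs <;> norm_num
  have hs : logTerm δ (cellOverlap t i ρ ρ' / (i + 1)) ≤ δ * √(cellOverlap t i ρ ρ' / (i + 1)) := by
    refine (log_one_add_le_sqrt (by positivity)).trans ?_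
    rw [Real.sqrt_mul (by positivity), Real.sqrt_sq hδ]
  refine hs.trans ?_
  rw [mul_assoc δ, ← mul_add]
  apply mul_le_mul_of_nonneg_left _ hδ
  have hle : √(cellOverlap t i ρ ρ' / (i + 1)) ≤ √(ρ' - ρ) := by
    apply Real.sqrt_le_sqrt
    exact (div_le_self hx hj).trans (overlap_le_sub hm hρρ)
  have hp : 0 ≤ 2 / √ρ * cellOverlap t i ρ ρ' := by positivity
  have hq := Real.sqrt_nonneg (ρ' - ρ)
  by_cases c1 : critFreq t i < ρ ∧ ρ < critFreq t (i + 1)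
  · rw [if_pos c1]
    nlinarith
  by_cases c2 : critFreq t i < ρ' ∧ ρ' < critFreq t (i + 1)
  · rw [if_pos c2]
    nlinarith
  rw [if_neg c1, if_neg c2, add_zero, mul_zero, add_zero]
  rcases hx.eq_or_lt with h0 | h0
  · rw [← h0]; simp
  obtain ⟨h1, h2⟩ := overlap_pos hm hρρ h0
  have h3 : ρ ≤ critFreq t i := not_lt.1 fun h => c1 ⟨h, h1⟩
  have h4 : critFreq t (i + 1) ≤ ρ' := not_lt.1 fun h => c2 ⟨h2, h⟩
  have h5 := critFreq_succ_sub ht i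
  rw [← overlap_eq h3 h4 hm, ← cellOverlap] at h5
  have h6 := critFreq_succ_le ht i
  apply Real.sqrt_le_iff.2 ⟨hp, ?_⟩
  rw [mul_pow, div_pow, Real.sq_sqrt hρ.le, div_mul_eq_mul_div, div_le_div_iff₀ (by positivity) hρ]
  have : ρ ≤ 2 * (2 * cellOverlap t i ρ ρ') * (i + 1) := by nlinarith
  nlinarith

include ht in
theorem sum_logTerm_cellOverlap_le (n : ℕ) :
    ∑ i ∈ Finset.range n, logTerm δ (cellOverlap t i ρ ρ' / (i + 1))
      ≤ δ ^ 2 * min 1 (2 * t / ρ) * (ρ' - ρ) := by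
  refine (Finset.sum_le_sum fun i _ => logTerm_cellOverlap_le δ ht hρ hρρ i).trans ?_
  rw [← Finset.mul_sum]
  exact mul_le_mul_of_nonneg_left (sum_cellOverlap_le ht hρ hρρ n) (by positivity)

include ht in
theorem sum_logTerm_cellOverlap_le_sqrt (hδ : 0 ≤ δ) (n : ℕ) :
    ∑ i ∈ Finset.range n, logTerm δ (cellOverlap t i ρ ρ' / (i + 1))
      ≤ 2 * δ * ((ρ' - ρ) / √ρ + √(ρ' - ρ)) := by
  refine (Finset.sum_le_sum fun i _ => logTerm_cellOverlap_le_sqrt δ ht hρ hρρ hδ i).trans ?_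
  rw [Finset.sum_add_distrib, ← Finset.mul_sum, ← Finset.mul_sum, ← Finset.mul_sum,
    Finset.sum_add_distrib]
  have h1 := sum_cellOverlap_le ht hρ hρρ n
  have h2 := sum_indicator_le hρ hρρ ht ρ n
  have h3 := sum_indicator_le hρ hρρ ht ρ' n
  have h4 : 2 / √ρ * ∑ i ∈ Finset.range n, cellOverlap t i ρ ρ' ≤ 2 / √ρ * (ρ' - ρ) := by gcongr
  have h5 : 0 ≤ δ * √(ρ' - ρ) := by positivity
  have h6 : 2 / √ρ * (ρ' - ρ) = 2 * ((ρ' - ρ) / √ρ) := by ring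
  nlinarith

end increments

end GevreyWeights

namespace GevreyWeights

/-! ### Bounds for the explicit formula -/

theorem sum_sqrt_div_le {a : ℝ} (ha : 0 ≤ a) (n : ℕ) :
    ∑ i ∈ Finset.range n, √(a / (i + 1)) ≤ 2 * √(a * n) := by
  induction n with
  | zero => simp
  | succ n ih =>
    rw [Finset.sum_range_succ]
    refine (add_le_add_left ih _).trans ?_
    push_cast
    have h1 : (0 : ℝ) < (n : ℝ) + 1 := by positivity
    rw [Real.sqrt_mul ha, Real.sqrt_mul ha, Real.sqrt_div ha]
    have h2 := Real.sq_sqrt h1.le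
    have h3 := Real.sq_sqrt (Nat.cast_nonneg n : (0 : ℝ) ≤ n)
    have h4 := Real.sqrt_pos.2 h1
    have h5 : 2 * √(n : ℝ) + 1 / √((n : ℝ) + 1) ≤ 2 * √((n : ℝ) + 1) := by
      rw [← le_sub_iff_add_le', div_le_iff₀ h4]
      nlinarith [sq_nonneg (√(n : ℝ) - √((n : ℝ) + 1))]
    calc _ = √a * (2 * √(n : ℝ) + 1 / √((n : ℝ) + 1)) := by ring
      _ ≤ √a * (2 * √((n : ℝ) + 1)) := by gcongr
      _ = _ := by ring

theorem sqrt_cube_mul {δ : ℝ} (hδ : 0 ≤ δ) (ρ : ℝ) : √(δ ^ 3 * ρ) = δ * √δ * √ρ := by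
  rw [Real.sqrt_mul (by positivity), show δ ^ 3 = δ ^ 2 * δ by ring, Real.sqrt_mul (by positivity),
    Real.sqrt_sq hδ]

theorem logTerm_eq_of_sq {δ y : ℝ} (hδ : 0 < δ) (hy : 0 ≤ y) :
    logTerm δ y ≤ δ * √y := by
  refine (log_one_add_le_sqrt (by positivity)).trans ?_
  rw [Real.sqrt_mul (by positivity), Real.sqrt_sq hδ.le]

section

variable {δ₀ ρ : ℝ} (hδ₀ : 0 < δ₀) (δ : ℝ) (hρ : 0 < ρ)
include hδ₀ hρ

theorem cellTotal_nonneg (i : ℕ) : 0 ≤ cellTotal δ₀ δ i ρ := by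
  have h1 := logTerm_nonneg δ (sub_nonneg.2 (center_lt_critTime hρ i).le)
  have h2 := logTerm_nonneg δ (sub_nonneg.2 (critTime_succ_lt_center hρ i).le)
  rw [cellTotal]
  positivity

theorem cellTotal_le (i : ℕ) :
    cellTotal δ₀ δ i ρ ≤ (1 + 2 * δ₀) * logTerm δ (ρ / (i + 1) ^ 2) := by
  have h1 : critTime i ρ - ρ / (i + 1) ≤ ρ / (i + 1) ^ 2 := by
    rcases i with _ | i
    · rw [critTime_zero]; norm_num; linarith
    · rw [critTime_succ]
      push_cast
      have : ρ / (i + 1 + 1 : ℝ) ^ 2 - ((ρ / (i + 2 : ℝ) + ρ / (i + 1)) / 2 - ρ / (i + 1 + 1))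
        = ρ * i / (2 * (i + 1) * (i + 2) ^ 2) := by field_simp; ring
      have : 0 ≤ ρ * i / (2 * (i + 1) * (i + 2) ^ 2) := by positivity
      linarith
  have h2 : ρ / (i + 1) - critTime (i + 1) ρ ≤ ρ / (i + 1) ^ 2 := by
    rw [critTime_succ]
    have : ρ / (i + 1 : ℝ) ^ 2 - (ρ / (i + 1) - (ρ / (i + 2 : ℝ) + ρ / (i + 1)) / 2)
      = ρ * (i + 3) / (2 * (i + 2) * (i + 1) ^ 2) := by field_simp; ring
    have : 0 ≤ ρ * (i + 3) / (2 * (i + 2) * (i + 1) ^ 2) := by positivity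
    linarith
  have h3 := logTerm_mono δ (sub_nonneg.2 (center_lt_critTime hρ i).le) h1
  have h4 := logTerm_mono δ (sub_nonneg.2 (critTime_succ_lt_center hρ i).le) h2
  rw [cellTotal]
  nlinarith

theorem cellLoss_nonneg (i : ℕ) (t : ℝ) : 0 ≤ cellLoss δ₀ δ i t ρ := by
  have h1 := (center_lt_critTime hρ i).le
  have h2 := (critTime_succ_lt_center hρ i).le
  have h3 : 0 ≤ min (max t (ρ / (i + 1))) (critTime i ρ) - ρ / (i + 1) :=
    sub_nonneg.2 (le_min (le_max_right _ _) h1)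
  have h4 := logTerm_mono δ h3 (sub_le_sub_right (min_le_right _ _) _)
  have h5 := logTerm_nonneg δ (sub_nonneg.2 (max_le (min_le_right t (ρ / (i + 1))) h2))
  rw [cellLoss]
  have := mul_nonneg hδ₀.le (sub_nonneg.2 h4)
  positivity

theorem cellLoss_le_cellTotal (i : ℕ) (t : ℝ) : cellLoss δ₀ δ i t ρ ≤ cellTotal δ₀ δ i ρ := by
  have h1 := (center_lt_critTime hρ i).le
  have h2 := (critTime_succ_lt_center hρ i).le
  have h3 : 0 ≤ min (max t (ρ / (i + 1))) (critTime i ρ) - ρ / (i + 1) :=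
    sub_nonneg.2 (le_min (le_max_right _ _) h1)
  have h4 := logTerm_nonneg δ h3
  have h5 := logTerm_mono δ (sub_nonneg.2 (max_le (min_le_right t (ρ / (i + 1))) h2))
    (sub_le_sub_left (le_max_right _ _) _)
  rw [cellLoss, cellTotal]
  apply add_le_add
  · apply mul_le_mul_of_nonneg_left _ hδ₀.le
    linarith
  · apply mul_le_mul_of_nonneg_left h5
    linarith

theorem totalSum_nonneg (n : ℕ) : 0 ≤ totalSum δ₀ δ n ρ :=
  Finset.sum_nonneg fun i _ => cellTotal_nonneg hδ₀ δ hρ i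

theorem cellSum_nonneg (n : ℕ) (t : ℝ) : 0 ≤ cellSum δ₀ δ n t ρ :=
  Finset.sum_nonneg fun i _ => cellLoss_nonneg hδ₀ δ hρ i t

theorem cellSum_le_totalSum (n : ℕ) (t : ℝ) : cellSum δ₀ δ n t ρ ≤ totalSum δ₀ δ n ρ :=
  Finset.sum_le_sum fun i _ => cellLoss_le_cellTotal hδ₀ δ hρ i t

end

theorem resLoss_nonneg (δ k t ρ : ℝ) : 0 ≤ resLoss δ k t ρ := le_max_left _ _

theorem resLoss_le (δ k t : ℝ) {ρ : ℝ} (hρ : 0 ≤ ρ) :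
    resLoss δ k t ρ ≤ logTerm δ (ρ / (8 * k ^ 2)) := by
  have h1 : 0 ≤ ρ / (8 * k ^ 2) := by positivity
  apply max_le (logTerm_nonneg δ h1)
  linarith [logTerm_nonneg δ (abs_nonneg (t - ρ / k))]

/-- The fraction of the time before `t_{n,ρ}` that is left at time `t`. -/
noncomputable def lowFrac (n : ℕ) (t ρ : ℝ) : ℝ := max 0 (1 - t / critTime n ρ)

theorem lowFrac_nonneg (n : ℕ) (t ρ : ℝ) : 0 ≤ lowFrac n t ρ := le_max_left _ _

theorem lowFrac_le_one (n : ℕ) {t ρ : ℝ} (ht : 0 ≤ t) (hρ : 0 < ρ) : lowFrac n t ρ ≤ 1 :=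
  max_le zero_le_one (sub_le_self _ (div_nonneg ht (critTime_pos hρ n).le))

theorem abs_max_sub_le (a b : ℝ) : |max 0 a - max 0 b| ≤ |a - b| := by
  rcases max_cases 0 a with h | h <;> rcases max_cases 0 b with h' | h' <;>
    rw [h.1, h'.1] <;> rw [abs_le] <;> rcases abs_cases (a - b) with g | g <;>
    constructor <;> linarith

/-- A clamped linear fraction varies at most by the relative variation of its denominator. -/
theorem abs_max_one_sub_div_le {t T T' : ℝ} (ht : 0 ≤ t) (hT : 0 < T) (hTT : T ≤ T') :
    |max 0 (1 - t / T') - max 0 (1 - t / T)| ≤ 1 - T / T' := by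
  have hT' : 0 < T' := by linarith
  have h1 : t / T' ≤ t / T := by gcongr
  have h2 : max 0 (1 - t / T) ≤ max 0 (1 - t / T') := max_le_max le_rfl (by linarith)
  have h3 : T / T' ≤ 1 := by rwa [div_le_one hT']
  rw [abs_of_nonneg (by linarith)]
  rcases le_total T t with h | h
  · have h4 : T / T' ≤ t / T' := by gcongr
    have : max 0 (1 - t / T') ≤ 1 - T / T' := max_le (by linarith) (by linarith)
    linarith [le_max_left 0 (1 - t / T)]
  · have h4 : t / T ≤ 1 := by rwa [div_le_one hT]
    rw [max_eq_right (by linarith), max_eq_right (by linarith)]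
    have h5 : t / T' = t / T * (T / T') := by field_simp
    have h6 : 0 ≤ t / T := by positivity
    rw [h5]
    nlinarith

section small

variable {δ₀ δ : ℝ} (h : IsSmall δ₀ δ)
include h

theorem threshold_lt.one_le {ρ : ℝ} (hθ : threshold δ < ρ) : 0 < ρ ∧ 1 ≤ δ * √ρ := by
  have hδ := h.pos
  have h0 := (threshold_pos hδ).trans hθ
  refine ⟨h0, ?_⟩
  rw [threshold, inv_lt_iff_one_lt_mul₀ (by positivity)] at hθ
  have h8 : δ ^ 8 ≤ 1 := pow_le_one₀ hδ.le h.le_one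
  have h2 : 1 ≤ (δ * √ρ) ^ 2 := by
    rw [mul_pow, Real.sq_sqrt h0.le]
    have : 0 < δ ^ 2 * ρ := by positivity
    nlinarith
  nlinarith [show 0 ≤ δ * √ρ by positivity]

/-- With `log (1+x) ≤ 2x^{1/4}` the sum is bounded by a multiple of `√(δ√ρ · n)`. Since `n ≲
δ^{3/2}√ρ` this is `O(δ^{1/4}) δ√ρ`, and the extra power of `δ` beats the constants. Hence `w_NR` at
`t_{n,ρ}` is not yet below its final value `e^{-δ√ρ}`, and `lowLoss` is nonnegative. The factor `2`
in the bound for `n` leaves room for the number of intervals of a neighbouring frequency. -/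
theorem totalSum_le {ρ : ℝ} (hρ : 0 < ρ) {n : ℕ} (hn : (n : ℝ) ≤ 2 * √(δ ^ 3 * ρ)) :
    totalSum δ₀ δ n ρ ≤ δ * √ρ := by
  have hδ := h.pos
  have hδ₀ := h.pos₀
  have hs := h.sqrt_pos
  have hr := Real.sqrt_pos.2 hρ
  have h1 : totalSum δ₀ δ n ρ ≤ (1 + 2 * δ₀) * (2 * (2 * √(δ * √ρ * n))) := by
    refine (Finset.sum_le_sum fun i _ => cellTotal_le hδ₀ δ hρ i).trans ?_
    rw [← Finset.mul_sum]
    apply mul_le_mul_of_nonneg_left _ (by positivity)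
    refine le_trans (Finset.sum_le_sum (g := fun i : ℕ => 2 * √(δ * √ρ / (i + 1))) fun i _ => ?_) ?_
    · refine (log_one_add_le_sqrt_sqrt (by positivity)).trans_eq ?_
      congr 2
      rw [← mul_div_assoc, Real.sqrt_div (by positivity), Real.sqrt_sq (by positivity),
        Real.sqrt_mul (by positivity), Real.sqrt_sq hδ.le]
    · rw [← Finset.mul_sum]
      exact mul_le_mul_of_nonneg_left (sum_sqrt_div_le (by positivity) n) zero_le_two
  rw [sqrt_cube_mul hδ.le] at hn
  refine h1.trans ?_
  have h2 : √(δ * √ρ * n) ≤ √(2 * √δ) * (δ * √ρ) := by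
    apply Real.sqrt_le_iff.2 ⟨by positivity, ?_⟩
    rw [mul_pow, Real.sq_sqrt (by positivity)]
    have : δ * √ρ * n ≤ δ * √ρ * (2 * (δ * √δ * √ρ)) := by gcongr
    linarith
  have h3 : (1 + 2 * δ₀) * 4 * √(2 * √δ) ≤ 1 := by
    have h4 : ((1 + 2 * δ₀) * 4 * √(2 * √δ)) ^ 2 ≤ 1 := by
      rw [mul_pow, Real.sq_sqrt (by positivity)]
      have := h.small
      have : 0 < (1 + 2 * δ₀) ^ 2 * √δ := by positivity
      nlinarith
    nlinarith [show 0 ≤ (1 + 2 * δ₀) * 4 * √(2 * √δ) by positivity]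
  have h5 : 0 ≤ δ * √ρ := by positivity
  calc _ = (1 + 2 * δ₀) * 4 * √(δ * √ρ * n) := by ring
    _ ≤ (1 + 2 * δ₀) * 4 * (√(2 * √δ) * (δ * √ρ)) := by gcongr
    _ = ((1 + 2 * δ₀) * 4 * √(2 * √δ)) * (δ * √ρ) := by ring
    _ ≤ _ := mul_le_of_le_one_left h5 h3

theorem lowLoss_nonneg {ρ : ℝ} (hρ : 0 < ρ) {n : ℕ} (hn : (n : ℝ) ≤ 2 * √(δ ^ 3 * ρ)) (t : ℝ) :
    0 ≤ lowLoss δ₀ δ n t ρ :=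
  mul_nonneg (lowFrac_nonneg n t ρ) (sub_nonneg.2 (totalSum_le h hρ hn))

theorem loss_nonneg {ρ : ℝ} (hρ : 0 < ρ) {n : ℕ} (hn : (n : ℝ) ≤ 2 * √(δ ^ 3 * ρ)) (k : ℤ)
    (t : ℝ) : 0 ≤ loss δ₀ δ n k t ρ := by
  have h1 := lowLoss_nonneg h hρ hn t
  have h2 := cellSum_nonneg h.pos₀ δ hρ n t
  rw [loss]
  split_ifs
  · have := resLoss_nonneg δ k t ρ
    positivity
  · positivity

theorem loss_le {ρ : ℝ} (hρ : 0 < ρ) {n : ℕ} (hn : (n : ℝ) ≤ 2 * √(δ ^ 3 * ρ)) (k : ℤ)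
    {t : ℝ} (ht : 0 ≤ t) : loss δ₀ δ n k t ρ ≤ 2 * δ * √ρ := by
  have h1 := totalSum_le h hρ hn
  have h2 := cellSum_le_totalSum h.pos₀ δ hρ n t
  have h3 : lowLoss δ₀ δ n t ρ ≤ δ * √ρ - totalSum δ₀ δ n ρ :=
    mul_le_of_le_one_left (by linarith) (lowFrac_le_one n ht hρ)
  rw [loss]
  have h4 : (if 1 ≤ k ∧ k ≤ (n : ℤ) then resLoss δ k t ρ else 0) ≤ δ * √ρ := by
    have := h.pos
    split_ifs with hk
    · refine (resLoss_le δ k t hρ.le).trans ((logTerm_eq_of_sq h.pos (by positivity)).trans ?_)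
      have hk1 : (1 : ℝ) ≤ k := by exact_mod_cast hk.1
      gcongr
      apply div_le_self hρ.le
      nlinarith
    · positivity
  linarith

/-! Variation in the frequency for a fixed number of intervals. -/

section frozen

variable {ρ ρ' t : ℝ} (hθ : threshold δ < ρ) (hρρ : ρ ≤ ρ') (hρ' : ρ' ≤ 2 * ρ) (ht : 0 ≤ t)
include hθ hρρ hρ' ht

theorem log_div_le_of_threshold : Real.log (ρ' / ρ) ≤ δ * ((ρ' - ρ) / √ρ) := by
  obtain ⟨h0, h1⟩ := threshold_lt.one_le h hθ
  have hr := Real.sqrt_pos.2 h0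
  refine (log_div_le h0 hρρ).trans ?_
  rw [← mul_div_assoc, div_le_div_iff₀ h0 hr]
  have h2 := Real.sq_sqrt h0.le
  have h3 : 0 ≤ (ρ' - ρ) * √ρ := mul_nonneg (by linarith) hr.le
  calc _ ≤ (ρ' - ρ) * √ρ * (δ * √ρ) := le_mul_of_one_le_right h3 h1
    _ = δ * (ρ' - ρ) * (√ρ) ^ 2 := by ring
    _ = _ := by rw [h2]

theorem mul_log_div_le {n : ℕ} (hn : (n : ℝ) ≤ 2 * √(δ ^ 3 * ρ)) :
    (1 + 2 * δ₀) * (n * Real.log (ρ' / ρ)) ≤ δ * ((ρ' - ρ) / √ρ) := by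
  obtain ⟨h0, h1⟩ := threshold_lt.one_le h hθ
  have hδ := h.pos
  have hδ₀ := h.pos₀
  have hr := Real.sqrt_pos.2 h0
  rw [sqrt_cube_mul hδ.le] at hn
  have h4 : 0 ≤ (ρ' - ρ) / √ρ := div_nonneg (by linarith) hr.le
  have h3 : (n : ℝ) * Real.log (ρ' / ρ) ≤ 2 * (δ * √δ * √ρ) * ((ρ' - ρ) / ρ) := by
    have := log_div_le h0 hρρ
    have := log_div_nonneg h0 hρρ
    gcongr
  have h5 : (ρ' - ρ) / ρ * √ρ = (ρ' - ρ) / √ρ := by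
    rw [div_mul_eq_mul_div, div_eq_div_iff h0.ne' hr.ne', mul_assoc, Real.mul_self_sqrt h0.le]
  have hs := h.sqrt_pos
  calc _ ≤ (1 + 2 * δ₀) * (2 * (δ * √δ * √ρ) * ((ρ' - ρ) / ρ)) := by gcongr
    _ = (2 * ((1 + 2 * δ₀) * √δ)) * (δ * ((ρ' - ρ) / ρ * √ρ)) := by ring
    _ = (2 * ((1 + 2 * δ₀) * √δ)) * (δ * ((ρ' - ρ) / √ρ)) := by rw [h5]
    _ ≤ _ := mul_le_of_le_one_left (by positivity) (by linarith [h.mul_sqrt_le])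

/-- Product rule: the fraction of the remaining time varies by at most `(ρ'-ρ)/ρ` and multiplies a
quantity of size at most `2δ√ρ`; that quantity varies by at most `2δ(ρ'-ρ)/√ρ`. -/
theorem abs_lowLoss_sub_le {n : ℕ} (hn : (n : ℝ) ≤ 2 * √(δ ^ 3 * ρ)) :
    |lowLoss δ₀ δ n t ρ' - lowLoss δ₀ δ n t ρ| ≤ 4 * δ * ((ρ' - ρ) / √ρ) := by
  obtain ⟨h0, h1⟩ := threshold_lt.one_le h hθ
  have h0' : 0 < ρ' := by linarith
  have hδ := h.pos
  have hr := Real.sqrt_pos.2 h0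
  have hrr := Real.sqrt_le_sqrt hρρ
  have h2 := Real.sq_sqrt h0.le
  have h4 : 0 ≤ (ρ' - ρ) / √ρ := div_nonneg (by linarith) hr.le
  have hn' : (n : ℝ) ≤ 2 * √(δ ^ 3 * ρ') := hn.trans (by gcongr)
  have e0 : lowFrac n t ρ' - lowFrac n t ρ = lowFrac n t ρ' - lowFrac n t ρ := rfl
  have hT : critTime n ρ ≤ critTime n ρ' := by
    rw [critTime_eq_mul n ρ, critTime_eq_mul n ρ']
    exact mul_le_mul_of_nonneg_left hρρ (critTime_pos one_pos n).le
  have e1 : |lowFrac n t ρ' - lowFrac n t ρ| ≤ (ρ' - ρ) / ρ := by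
    refine (abs_max_one_sub_div_le ht (critTime_pos h0 n) hT).trans ?_
    rw [critTime_eq_mul n ρ, critTime_eq_mul n ρ', mul_div_mul_left _ _ (critTime_pos one_pos n).ne']
    rw [one_sub_div h0'.ne']
    have : 0 ≤ ρ' - ρ := by linarith
    gcongr
  have w0 := totalSum_le h h0' hn'
  have w1 := totalSum_nonneg h.pos₀ δ h0' n
  have w2 := totalSum_sub_le h.pos₀ δ h0 hρρ n
  have w3 := mul_log_div_le h hθ hρρ hρ' ht hn
  have hs : √ρ' - √ρ ≤ (ρ' - ρ) / √ρ := by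
    have := abs_sqrt_sub_le_div h0'.le h0
    rw [abs_of_nonneg (by linarith), abs_of_nonneg (by linarith)] at this
    exact this
  have hs2 : √ρ' ≤ 2 * √ρ := by
    rw [Real.sqrt_le_left (by positivity), mul_pow, h2]
    linarith
  have e2 : |(δ * √ρ' - totalSum δ₀ δ n ρ') - (δ * √ρ - totalSum δ₀ δ n ρ)|
      ≤ 2 * (δ * ((ρ' - ρ) / √ρ)) := by
    have a1 : δ * (√ρ' - √ρ) ≤ δ * ((ρ' - ρ) / √ρ) := by gcongr
    have a2 : 0 ≤ δ * (√ρ' - √ρ) := mul_nonneg hδ.le (by linarith)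
    rw [abs_le]
    constructor <;> linarith
  have h5 : (ρ' - ρ) / ρ * √ρ = (ρ' - ρ) / √ρ := by
    rw [div_mul_eq_mul_div, div_eq_div_iff h0.ne' hr.ne', mul_assoc, Real.mul_self_sqrt h0.le]
  have hZ : |δ * √ρ' - totalSum δ₀ δ n ρ'| ≤ δ * (2 * √ρ) := by
    rw [abs_of_nonneg (by linarith)]
    have : δ * √ρ' ≤ δ * (2 * √ρ) := by gcongr
    linarith
  have e3 : lowLoss δ₀ δ n t ρ' - lowLoss δ₀ δ n t ρ
      = (lowFrac n t ρ' - lowFrac n t ρ) * (δ * √ρ' - totalSum δ₀ δ n ρ')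
        + lowFrac n t ρ * ((δ * √ρ' - totalSum δ₀ δ n ρ') - (δ * √ρ - totalSum δ₀ δ n ρ)) := by
    simp only [lowLoss, lowFrac]; ring
  rw [e3]
  refine (abs_add_le _ _).trans ?_
  rw [abs_mul, abs_mul, abs_of_nonneg (lowFrac_nonneg n t ρ)]
  have f0 : 0 ≤ (ρ' - ρ) / ρ := div_nonneg (by linarith) h0.le
  have f1 := mul_le_mul e1 hZ (abs_nonneg _) f0
  have f2 := mul_le_of_le_one_left (abs_nonneg _) (lowFrac_le_one n ht h0)
    |>.trans e2
  have f3 : (ρ' - ρ) / ρ * (δ * (2 * √ρ)) = 2 * (δ * ((ρ' - ρ) / ρ * √ρ)) := by ring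
  rw [f3, h5] at f1
  linarith

theorem abs_resLoss_sub_le_logTerm {k : ℝ} (hk : 1 ≤ k) :
    |resLoss δ k t ρ' - resLoss δ k t ρ| ≤ Real.log (ρ' / ρ) + logTerm δ ((ρ' - ρ) / k) := by
  obtain ⟨h0, h1⟩ := threshold_lt.one_le h hθ
  refine (abs_max_sub_le _ _).trans ?_
  have e : ∀ ρ : ℝ, ρ / (8 * k ^ 2) = 1 / (8 * k ^ 2) * ρ := fun ρ => by ring
  obtain ⟨g1, g2⟩ := logTerm_scale δ h0 hρρ (show 0 ≤ 1 / (8 * k ^ 2) by positivity)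
  rw [← e, ← e] at g1 g2
  have hx : 0 ≤ (ρ' - ρ) / k := div_nonneg (by linarith) (by linarith)
  have f : ∀ a b : ℝ, |a - b| ≤ (ρ' - ρ) / k →
      logTerm δ |a| ≤ logTerm δ |b| + logTerm δ ((ρ' - ρ) / k) := by
    intro a b hab
    have := logTerm_le_add (δ := δ) (a := 1) (abs_nonneg b) hx (abs_nonneg a) le_rfl (by
      have := abs_sub_abs_le_abs_sub a b
      linarith)
    rwa [Real.log_one, zero_add] at this
  have e2 : |(t - ρ / k) - (t - ρ' / k)| = (ρ' - ρ) / k := by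
    rw [show (t - ρ / k) - (t - ρ' / k) = (ρ' - ρ) / k by ring, abs_of_nonneg hx]
  have f1 := f (t - ρ / k) (t - ρ' / k) e2.le
  have f2 := f (t - ρ' / k) (t - ρ / k) (by rw [abs_sub_comm, e2])
  rw [abs_le]
  constructor <;> linarith

theorem abs_resLoss_sub_le {k : ℝ} (hk : 1 ≤ k) :
    |resLoss δ k t ρ' - resLoss δ k t ρ|
      ≤ δ * ((ρ' - ρ) / √ρ) + δ ^ 2 * min 1 (2 * t / ρ) * (ρ' - ρ) ∧
    |resLoss δ k t ρ' - resLoss δ k t ρ| ≤ δ * ((ρ' - ρ) / √ρ) + δ * √(ρ' - ρ) := by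
  obtain ⟨h0, h1⟩ := threshold_lt.one_le h hθ
  have hδ := h.pos
  have h0' : 0 < ρ' := by linarith
  have hk0 : 0 < k := by linarith
  have hd : 0 ≤ ρ' - ρ := by linarith
  have g1 := abs_resLoss_sub_le_logTerm h hθ hρρ hρ' ht hk
  have g2 := log_div_le_of_threshold h hθ hρρ hρ' ht
  constructor
  -- A nonzero resonant term forces `t` to be comparable to `σ/k`; as for the cells, the factor
  -- `1/k` is then at most `2t/ρ`.
  · have hpos : ∀ σ : ℝ, ρ ≤ σ → resLoss δ k t σ ≠ 0 → 1 / k ≤ 2 * t / ρ := by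
      intro σ hσ hne
      have hσ0 : 0 < σ := by linarith
      have h2 : |t - σ / k| < σ / (8 * k ^ 2) := by
        by_contra hcon
        exact hne (resLoss_eq_zero_of_le hσ0 _ (not_lt.1 hcon))
      have h3 : σ / (8 * k ^ 2) ≤ σ / (8 * k) := by
        gcongr
        nlinarith
      have h4 := (abs_lt.1 h2).1
      have h5 : σ / (8 * k) = σ / k / 8 := by rw [div_div, mul_comm]
      have h6 : ρ / k ≤ σ / k := by gcongr
      rw [div_le_div_iff₀ hk0 h0, one_mul]
      have h7 : ρ / k ≤ 2 * t := by
        have : 0 < σ / k := by positivity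
        linarith
      rwa [div_le_iff₀ hk0] at h7
    by_cases hz : resLoss δ k t ρ' = 0 ∧ resLoss δ k t ρ = 0
    · rw [hz.1, hz.2, sub_self, abs_zero]
      positivity
    · have h2 : 1 / k ≤ 2 * t / ρ := by
        rcases not_and_or.1 hz with hz | hz
        · exact hpos ρ' hρρ hz
        · exact hpos ρ le_rfl hz
      have h3 : 1 / k ≤ 1 := by rwa [div_le_one hk0]
      have h4 : logTerm δ ((ρ' - ρ) / k) ≤ δ ^ 2 * min 1 (2 * t / ρ) * (ρ' - ρ) := by
        refine (log_one_add_le_self (by positivity)).trans ?_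
        rw [mul_assoc, mul_comm (min _ _), div_eq_mul_one_div]
        gcongr
        exact le_min h3 h2
      linarith
  · have h4 : logTerm δ ((ρ' - ρ) / k) ≤ δ * √(ρ' - ρ) := by
      refine (logTerm_eq_of_sq hδ (by positivity)).trans ?_
      gcongr
      exact div_le_self hd hk
    linarith

/-- The linear modulus serves when the frequencies are close or the time is small compared with the
frequency. The Hölder modulus, with a constant much smaller than `√δ`, serves for all distances. The
`6` adds up one unit from the scaling of the cells, four from the low times and one from the
resonant term. -/
theorem abs_loss_sub_le {n : ℕ} (hn : (n : ℝ) ≤ 2 * √(δ ^ 3 * ρ)) (k : ℤ) :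
    |loss δ₀ δ n k t ρ' - loss δ₀ δ n k t ρ|
      ≤ δ * (min 1 (2 * t / ρ) * (ρ' - ρ) + 6 * ((ρ' - ρ) / √ρ)) ∧
    |loss δ₀ δ n k t ρ' - loss δ₀ δ n k t ρ| ≤ √δ / 100 * √(ρ' - ρ) := by
  obtain ⟨h0, h1⟩ := threshold_lt.one_le h hθ
  have hδ := h.pos
  have hδ₀ := h.pos₀
  have hd : 0 ≤ ρ' - ρ := by linarith
  have hr := Real.sqrt_pos.2 h0
  have hQ : 0 ≤ (ρ' - ρ) / √ρ := by positivity
  have a1 := cellSum_sub_le hδ₀ δ ht h0 hρρ n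
  have a2 := sum_logTerm_cellOverlap_le δ ht h0 hρρ n
  have a3 := sum_logTerm_cellOverlap_le_sqrt δ ht h0 hρρ hδ.le n
  have a4 := mul_log_div_le h hθ hρρ hρ' ht hn
  have a5 := abs_lowLoss_sub_le h hθ hρρ hρ' ht hn
  have a6 : ∀ B : ℝ, 0 ≤ B → (∀ k : ℝ, 1 ≤ k → |resLoss δ k t ρ' - resLoss δ k t ρ| ≤ B) →
      |(if 1 ≤ k ∧ k ≤ (n : ℤ) then resLoss δ k t ρ' else 0)
        - (if 1 ≤ k ∧ k ≤ (n : ℤ) then resLoss δ k t ρ else 0)| ≤ B := by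
    intro B hB hk
    split_ifs with hc
    · exact hk k (by exact_mod_cast hc.1)
    · simpa using hB
  have hm : 0 ≤ min 1 (2 * t / ρ) * (ρ' - ρ) := by positivity
  have b1 := a6 _ (by positivity) fun k hk => (abs_resLoss_sub_le h hθ hρρ hρ' ht hk).1
  have b2 := a6 _ (by positivity) fun k hk => (abs_resLoss_sub_le h hθ hρρ hρ' ht hk).2
  have e : loss δ₀ δ n k t ρ' - loss δ₀ δ n k t ρ = (cellSum δ₀ δ n t ρ' - cellSum δ₀ δ n t ρ)
      + (lowLoss δ₀ δ n t ρ' - lowLoss δ₀ δ n t ρ)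
      + ((if 1 ≤ k ∧ k ≤ (n : ℤ) then resLoss δ k t ρ' else 0)
        - (if 1 ≤ k ∧ k ≤ (n : ℤ) then resLoss δ k t ρ else 0)) := by
    simp only [loss]; ring
  have a0 : |cellSum δ₀ δ n t ρ' - cellSum δ₀ δ n t ρ| = cellSum δ₀ δ n t ρ' - cellSum δ₀ δ n t ρ :=
    abs_of_nonneg (by linarith [a1.1])
  have c0 : (1 + 2 * δ₀) * δ ≤ √δ / 10 ^ 4 := by
    have := h.mul_sqrt_le
    have hs := h.sqrt_pos
    have : (1 + 2 * δ₀) * √δ * √δ ≤ 1 / 10 ^ 4 * √δ := by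
      apply mul_le_mul_of_nonneg_right _ hs.le
      linarith
    rw [mul_assoc, Real.mul_self_sqrt hδ.le] at this
    linarith
  constructor
  · rw [e]
    refine (abs_add_three _ _ _).trans ?_
    rw [a0]
    have d1 := mul_le_mul_of_nonneg_left a2 (show 0 ≤ 1 + 2 * δ₀ by linarith)
    have d2 : (1 + 2 * δ₀) * δ ≤ 1 / 10 ^ 4 := by
      have := h.sqrt_le
      linarith
    have d3 : (1 + 2 * δ₀) * (δ ^ 2 * min 1 (2 * t / ρ) * (ρ' - ρ))
        ≤ δ * (min 1 (2 * t / ρ) * (ρ' - ρ)) / 10 ^ 4 := by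
      have : (1 + 2 * δ₀) * δ * (δ * (min 1 (2 * t / ρ) * (ρ' - ρ)))
        ≤ 1 / 10 ^ 4 * (δ * (min 1 (2 * t / ρ) * (ρ' - ρ))) := by gcongr
      linarith
    have d4 : δ ^ 2 * min 1 (2 * t / ρ) * (ρ' - ρ)
        ≤ δ * (min 1 (2 * t / ρ) * (ρ' - ρ)) / 10 ^ 4 := by
      have d5 : δ ≤ 1 / 10 ^ 4 := by linarith [h.le_div]
      have : δ * (δ * (min 1 (2 * t / ρ) * (ρ' - ρ)))
        ≤ 1 / 10 ^ 4 * (δ * (min 1 (2 * t / ρ) * (ρ' - ρ))) := by gcongr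
      linarith
    have d6 : 0 ≤ δ * (min 1 (2 * t / ρ) * (ρ' - ρ)) := by positivity
    linarith [a1.2]
  · rw [e]
    refine (abs_add_three _ _ _).trans ?_
    rw [a0]
    have hQ2 : (ρ' - ρ) / √ρ ≤ √(ρ' - ρ) := by
      rw [div_le_iff₀ hr]
      calc ρ' - ρ = √(ρ' - ρ) * √(ρ' - ρ) := (Real.mul_self_sqrt hd).symm
        _ ≤ _ := by
          gcongr
          linarith
    have d1 := mul_le_mul_of_nonneg_left a3 (show 0 ≤ 1 + 2 * δ₀ by linarith)
    have d2 : (1 + 2 * δ₀) * (2 * δ * ((ρ' - ρ) / √ρ + √(ρ' - ρ))) ≤ 4 * (√δ / 10 ^ 4) * √(ρ' - ρ) := by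
      calc _ ≤ (1 + 2 * δ₀) * (2 * δ * (√(ρ' - ρ) + √(ρ' - ρ))) := by gcongr
        _ = 4 * ((1 + 2 * δ₀) * δ) * √(ρ' - ρ) := by ring
        _ ≤ _ := by gcongr
    have d3 : δ * ((ρ' - ρ) / √ρ) ≤ √δ / 10 ^ 4 * √(ρ' - ρ) := by
      have := h.le_sqrt
      gcongr
      linarith
    have d4 : δ * √(ρ' - ρ) ≤ √δ / 10 ^ 4 * √(ρ' - ρ) := by
      have := h.le_sqrt
      gcongr
      linarith
    have d5 : 0 ≤ √δ * √(ρ' - ρ) := by positivity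
    linarith [a1.2]

end frozen

/-! Variation in the number of intervals. -/

/-- For `n` comparable to `√(δ³ρ)` the next interval carries a logarithm of size at most `δ√ρ/n ≲
δ^{-1/2}`. Moving the transition time changes the fraction of remaining time by at most `2/n`, which
multiplied by `δ√ρ` is again `O(δ^{-1/2})`. Smallness of `δ` turns the total into a small multiple
of `1/δ`. -/
theorem abs_loss_succ_sub_le {ρ t : ℝ} (hρ : 0 < ρ) (ht : 0 ≤ t) {n : ℕ}
    (hn : √(δ ^ 3 * ρ) ≤ 2 * n) (hn' : (n : ℝ) + 1 ≤ 2 * √(δ ^ 3 * ρ)) (k : ℤ) :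
    |loss δ₀ δ (n + 1) k t ρ - loss δ₀ δ n k t ρ| ≤ 1 / (1000 * δ) := by
  have hδ := h.pos
  have hδ₀ := h.pos₀
  have hs := h.sqrt_pos
  have hr := Real.sqrt_pos.2 hρ
  have hκ := sqrt_cube_mul hδ.le ρ
  have hκ0 : 0 < √(δ ^ 3 * ρ) := Real.sqrt_pos.2 (by positivity)
  have hκ2 := Real.sq_sqrt (show 0 ≤ δ ^ 3 * ρ by positivity)
  have hn0 : (0 : ℝ) < n := by linarith
  have hm1 : 1 ≤ n := by exact_mod_cast hn0
  set κ := √(δ ^ 3 * ρ)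
  have l1 : logTerm δ (ρ / ((n : ℝ) + 1) ^ 2) ≤ 2 / √δ := by
    refine (logTerm_eq_of_sq hδ (by positivity)).trans ?_
    have : √(ρ / ((n : ℝ) + 1) ^ 2) = √ρ / (n + 1) := by
      rw [Real.sqrt_div hρ.le, Real.sqrt_sq (by positivity)]
    rw [this, ← mul_div_assoc, div_le_div_iff₀ (by positivity) hs]
    linarith
  have w1 : totalSum δ₀ δ (n + 1) ρ - totalSum δ₀ δ n ρ = cellTotal δ₀ δ n ρ := by
    rw [totalSum, Finset.sum_range_succ, ← totalSum]; ring
  have w2 := cellTotal_nonneg hδ₀ δ hρ n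
  have w3 : cellTotal δ₀ δ n ρ ≤ (1 + 2 * δ₀) * (2 / √δ) :=
    (cellTotal_le hδ₀ δ hρ n).trans (by gcongr)
  have c1 : cellSum δ₀ δ (n + 1) t ρ - cellSum δ₀ δ n t ρ = cellLoss δ₀ δ n t ρ := by
    rw [cellSum, Finset.sum_range_succ, ← cellSum]; ring
  have c2 := cellLoss_nonneg hδ₀ δ hρ n t
  have c3 := cellLoss_le_cellTotal hδ₀ δ hρ n t
  have w4 := totalSum_le h hρ (n := n + 1) (by push_cast; exact hn')
  have w5 := totalSum_nonneg hδ₀ δ hρ (n + 1)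
  have f1 : |lowFrac n t ρ - lowFrac (n + 1) t ρ| ≤ 2 / n := by
    refine (abs_max_one_sub_div_le ht (critTime_pos hρ (n + 1))
      (critTime_antitone hρ (Nat.le_succ n))).trans ?_
    have g1 := (center_lt_critTime hρ (n + 1)).le
    obtain ⟨m, rfl⟩ : ∃ m, n = m + 1 := ⟨n - 1, by omega⟩
    have g2 := (critTime_succ_lt_center hρ m).le
    have g3 : ρ / (((m + 1 + 1 : ℕ) : ℝ) + 1) / (ρ / (m + 1)) ≤ critTime (m + 1 + 1) ρ / critTime (m + 1) ρ := by
      have := critTime_pos hρ (m + 1)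
      have := critTime_pos hρ (m + 1 + 1)
      gcongr
    have g4 : ρ / (((m + 1 + 1 : ℕ) : ℝ) + 1) / (ρ / (m + 1)) = 1 - 2 / ((m : ℝ) + 3) := by
      push_cast; field_simp; ring
    have g5 : 2 / ((m : ℝ) + 3) ≤ 2 / ((m + 1 : ℕ) : ℝ) := by
      push_cast
      gcongr
      norm_num
    linarith
  have f2 : |lowLoss δ₀ δ (n + 1) t ρ - lowLoss δ₀ δ n t ρ|
      ≤ 4 / √δ + (1 + 2 * δ₀) * (2 / √δ) := by
    have e : lowLoss δ₀ δ (n + 1) t ρ - lowLoss δ₀ δ n t ρ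
        = (lowFrac (n + 1) t ρ - lowFrac n t ρ) * (δ * √ρ - totalSum δ₀ δ (n + 1) ρ)
          + lowFrac n t ρ * (-(totalSum δ₀ δ (n + 1) ρ - totalSum δ₀ δ n ρ)) := by
      simp only [lowLoss, lowFrac]; ring
    rw [e]
    refine (abs_add_le _ _).trans (add_le_add ?_ ?_)
    · rw [abs_mul, abs_sub_comm, abs_of_nonneg (sub_nonneg.2 w4)]
      calc _ ≤ 2 / (n : ℝ) * (δ * √ρ) := by
            gcongr
            linarith
        _ ≤ 4 / √δ := by
          rw [div_mul_eq_mul_div, div_le_div_iff₀ hn0 hs]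
          linarith
    · rw [abs_mul, abs_neg, w1, abs_of_nonneg w2, abs_of_nonneg (lowFrac_nonneg n t ρ)]
      exact (mul_le_of_le_one_left w2 (lowFrac_le_one n ht hρ)).trans w3
  have f3 : |(if 1 ≤ k ∧ k ≤ ((n + 1 : ℕ) : ℤ) then resLoss δ k t ρ else 0)
      - (if 1 ≤ k ∧ k ≤ (n : ℤ) then resLoss δ k t ρ else 0)| ≤ 2 / √δ := by
    by_cases hk : k = n + 1
    · subst hk
      rw [if_pos (by constructor <;> push_cast <;> omega), if_neg (by omega), sub_zero,
        abs_of_nonneg (resLoss_nonneg _ _ _ _)]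
      refine (resLoss_le _ _ _ hρ.le).trans (le_trans (logTerm_mono δ (by positivity) ?_) l1)
      push_cast
      gcongr
      nlinarith [sq_nonneg ((n : ℝ) + 1)]
    · have : (1 ≤ k ∧ k ≤ ((n + 1 : ℕ) : ℤ)) ↔ (1 ≤ k ∧ k ≤ (n : ℤ)) := by
        push_cast
        omega
      rw [if_congr this rfl rfl, sub_self, abs_zero]
      positivity
  have e : loss δ₀ δ (n + 1) k t ρ - loss δ₀ δ n k t ρ
      = (cellSum δ₀ δ (n + 1) t ρ - cellSum δ₀ δ n t ρ)
        + (lowLoss δ₀ δ (n + 1) t ρ - lowLoss δ₀ δ n t ρ)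
        + ((if 1 ≤ k ∧ k ≤ ((n + 1 : ℕ) : ℤ) then resLoss δ k t ρ else 0)
          - (if 1 ≤ k ∧ k ≤ (n : ℤ) then resLoss δ k t ρ else 0)) := by
    simp only [loss]; ring
  rw [e]
  refine (abs_add_three _ _ _).trans ?_
  rw [c1, abs_of_nonneg c2]
  have z1 : (1 + 2 * δ₀) * (2 / √δ) + (4 / √δ + (1 + 2 * δ₀) * (2 / √δ)) + 2 / √δ
      ≤ 10 * (1 + 2 * δ₀) / √δ := by
    have : 10 * (1 + 2 * δ₀) / √δ - ((1 + 2 * δ₀) * (2 / √δ) + (4 / √δ + (1 + 2 * δ₀) * (2 / √δ)) + 2 / √δ)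
      = 12 * δ₀ / √δ := by ring
    have : 0 ≤ 12 * δ₀ / √δ := by positivity
    linarith
  have z2 : 10 * (1 + 2 * δ₀) / √δ ≤ 1 / (1000 * δ) := by
    rw [div_le_div_iff₀ hs (by positivity)]
    have := h.mul_sqrt_le
    have e2 := h.sqrt_sq
    have : 10 ^ 4 * ((1 + 2 * δ₀) * √δ) * √δ ≤ 1 * √δ := by gcongr
    nlinarith
  linarith

theorem abs_loss_sub_le_of_le {ρ t : ℝ} (hρ : 0 < ρ) (ht : 0 ≤ t) {m n : ℕ} (hmn : m ≤ n)
    (hm : √(δ ^ 3 * ρ) ≤ 2 * m) (hn : (n : ℝ) ≤ 2 * √(δ ^ 3 * ρ)) (k : ℤ) :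
    |loss δ₀ δ n k t ρ - loss δ₀ δ m k t ρ| ≤ ((n : ℝ) - m) * (1 / (1000 * δ)) := by
  induction n, hmn using Nat.le_induction with
  | base => simp
  | succ n hmn ih =>
    push_cast at hn ⊢
    have h1 := ih (by linarith)
    have hmn' : (m : ℝ) ≤ n := by exact_mod_cast hmn
    have h2 := abs_loss_succ_sub_le h hρ ht (n := n) (by linarith) hn k
    calc _ = |(loss δ₀ δ (n + 1) k t ρ - loss δ₀ δ n k t ρ)
          + (loss δ₀ δ n k t ρ - loss δ₀ δ m k t ρ)| := by congr 1; ring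
      _ ≤ _ := (abs_add_le _ _).trans (add_le_add h2 h1)
      _ = _ := by ring

theorem abs_loss_sub_le_mul {ρ t : ℝ} (hρ : 0 < ρ) (ht : 0 ≤ t) {m n : ℕ}
    (hm : √(δ ^ 3 * ρ) ≤ 2 * m) (hn : (n : ℝ) ≤ 2 * √(δ ^ 3 * ρ))
    (hm' : (m : ℝ) ≤ 2 * √(δ ^ 3 * ρ)) (hn' : √(δ ^ 3 * ρ) ≤ 2 * n) (k : ℤ) :
    |loss δ₀ δ n k t ρ - loss δ₀ δ m k t ρ| ≤ |(n : ℝ) - m| * (1 / (1000 * δ)) := by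
  rcases le_total m n with hmn | hmn
  · rw [abs_of_nonneg (a := (n : ℝ) - m) (by simpa using hmn)]
    exact abs_loss_sub_le_of_le h hρ ht hmn hm hn k
  · rw [abs_sub_comm, abs_sub_comm (n : ℝ), abs_of_nonneg (a := (m : ℝ) - n) (by simpa using hmn)]
    exact abs_loss_sub_le_of_le h hρ ht hmn hn' hm' k

omit h in
-- At a time after `t_{m,ρ}` the intervals of index larger than `m` contribute nothing. This is what
-- removes the jumps of the floor `k₀` at late times.
theorem loss_eq_of_critTime_le {ρ t : ℝ} (hρ : 0 < ρ) {m n : ℕ} (hmn : m ≤ n)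
    (hm : critTime m ρ ≤ t) (k : ℤ) : loss δ₀ δ n k t ρ = loss δ₀ δ m k t ρ := by
  rw [loss, loss, cellSum_eq_of_le hρ _ _ hmn hm, lowLoss_eq_zero hρ _ _ hm,
    lowLoss_eq_zero hρ _ _ ((critTime_antitone hρ hmn).trans hm)]
  congr 1
  by_cases hk : 1 ≤ k ∧ k ≤ (m : ℤ)
  · rw [if_pos hk, if_pos ⟨hk.1, by omega⟩]
  · rw [if_neg hk]
    split_ifs with hk'
    · obtain ⟨i, rfl⟩ : ∃ i : ℕ, k = i + 1 := ⟨(k - 1).toNat, by omega⟩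
      have : m ≤ i := by omega
      push_cast
      exact resLoss_eq_zero_of_critTime_le hρ _ ((critTime_antitone hρ this).trans hm)
    · rfl

end small

end GevreyWeights

namespace GevreyWeights

/-! ### Comparison of the values of `w_k` at two frequencies -/

section small

variable {δ₀ δ : ℝ} (h : IsSmall δ₀ δ)
include h

theorem kZero_bounds {ρ : ℝ} (hθ : threshold δ < ρ) :
    (kZero δ ρ : ℝ) ≤ √(δ ^ 3 * ρ) ∧ √(δ ^ 3 * ρ) < kZero δ ρ + 1 ∧ 100 ≤ √(δ ^ 3 * ρ) := by
  refine ⟨Nat.floor_le (Real.sqrt_nonneg _), Nat.lt_floor_add_one _, ?_⟩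
  obtain ⟨h0, h1⟩ := threshold_lt.one_le h hθ
  have hδ := h.pos
  apply Real.le_sqrt_of_sq_le
  rw [threshold, inv_lt_iff_one_lt_mul₀ (by positivity)] at hθ
  have h7 : δ ^ 7 ≤ (1 / 10 ^ 8) ^ 7 := pow_le_pow_left₀ hδ.le h.le_div 7
  have : 1 < δ ^ 3 * ρ * (1 / 10 ^ 8) ^ 7 := by
    calc 1 < ρ * δ ^ 10 := hθ
      _ = δ ^ 3 * ρ * δ ^ 7 := by ring
      _ ≤ _ := by gcongr
  norm_num at this ⊢
  linarith

theorem kZero_le_two_mul {ρ : ℝ} (hθ : threshold δ < ρ) :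
    (kZero δ ρ : ℝ) ≤ 2 * √(δ ^ 3 * ρ) := by
  obtain ⟨h1, h2, h3⟩ := kZero_bounds h hθ
  linarith

theorem critTime_kZero_le {ρ σ : ℝ} (hθ : threshold δ < ρ) (hσ : 0 < σ) :
    critTime (kZero δ ρ) σ ≤ 2 * (σ / (δ * √δ * √ρ)) := by
  obtain ⟨h1, h2, h3⟩ := kZero_bounds h hθ
  obtain ⟨m, hm⟩ : ∃ m, kZero δ ρ = m + 1 :=
    ⟨_, (Nat.succ_pred_eq_of_pos (one_le_kZero h.pos h.le_one hθ)).symm⟩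
  rw [hm] at h1 h2 ⊢
  push_cast at h1 h2
  rw [← sqrt_cube_mul h.pos.le]
  refine (critTime_succ_lt_center hσ m).le.trans ?_
  rw [mul_div, div_le_div_iff₀ (by positivity) (by linarith)]
  nlinarith

theorem wK_pos (k : ℤ) (t ρ : ℝ) : 0 < wK δ₀ δ k t ρ := by
  rcases le_or_gt |ρ| (threshold δ) with hρ | hρ
  · rw [wK, if_pos hρ]; exact one_pos
  · rcases lt_abs.1 hρ with hρ | hρ
    · rw [wK_eq_exp_loss h.pos h.le_one _ _ _ hρ]; exact Real.exp_pos _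
    · rw [← wK_neg _ h.pos, wK_eq_exp_loss h.pos h.le_one _ _ _ hρ]; exact Real.exp_pos _

theorem wK_le_one (k : ℤ) (t ρ : ℝ) : wK δ₀ δ k t ρ ≤ 1 := by
  have key : ∀ k : ℤ, ∀ ρ : ℝ, threshold δ < ρ → wK δ₀ δ k t ρ ≤ 1 := by
    intro k ρ hρ
    rw [wK_eq_exp_loss h.pos h.le_one _ _ _ hρ]
    apply Real.exp_le_one_iff.2
    have := loss_nonneg h (threshold_lt.one_le h hρ).1 (kZero_le_two_mul h hρ) k t
    linarith
  rcases le_or_gt |ρ| (threshold δ) with hρ | hρ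
  · rw [wK, if_pos hρ]
  · rcases lt_abs.1 hρ with hρ | hρ
    · exact key k ρ hρ
    · rw [← wK_neg _ h.pos]; exact key _ _ hρ

theorem exp_le_wK (k : ℤ) {t : ℝ} (ht : 0 ≤ t) (ρ : ℝ) :
    Real.exp (-(2 * δ * √|ρ|)) ≤ wK δ₀ δ k t ρ := by
  have key : ∀ k : ℤ, ∀ ρ : ℝ, threshold δ < ρ → Real.exp (-(2 * δ * √ρ)) ≤ wK δ₀ δ k t ρ := by
    intro k ρ hρ
    rw [wK_eq_exp_loss h.pos h.le_one _ _ _ hρ]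
    apply Real.exp_le_exp.2
    have := loss_le h (threshold_lt.one_le h hρ).1 (kZero_le_two_mul h hρ) k ht
    linarith
  have h0 := threshold_pos h.pos
  rcases le_or_gt |ρ| (threshold δ) with hρ | hρ
  · rw [wK, if_pos hρ, Real.exp_le_one_iff]
    have := h.pos
    have : 0 ≤ 2 * δ * √|ρ| := by positivity
    linarith
  · rcases lt_abs.1 hρ with hρ | hρ
    · rw [abs_of_pos (h0.trans hρ)]; exact key k ρ hρ
    · rw [← wK_neg _ h.pos, ← abs_neg, abs_of_pos (h0.trans hρ)]; exact key _ _ hρ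

theorem wK_le_of_loss {k : ℤ} {t ρ ρ' B : ℝ} (hθ : threshold δ < ρ) (hθ' : threshold δ < ρ')
    (hB : |loss δ₀ δ (kZero δ ρ') k t ρ' - loss δ₀ δ (kZero δ ρ) k t ρ| ≤ B) :
    wK δ₀ δ k t ρ' ≤ wK δ₀ δ k t ρ * Real.exp B := by
  rw [wK_eq_exp_loss h.pos h.le_one _ _ _ hθ, wK_eq_exp_loss h.pos h.le_one _ _ _ hθ',
    ← Real.exp_add]
  apply Real.exp_le_exp.2
  linarith [(abs_le.1 hB).1]

/-- Passage from a frozen number of intervals to the true one. The floors differ by at most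
`δ√δ(√ρ'-√ρ) + 1`, where the `1` is the rounding error, and each unit costs `1/(1000δ)`. -/
theorem loss_frozen_aux {t ρ ρ' : ℝ} (hθ : threshold δ < ρ) (hρρ : ρ ≤ ρ') (hρ' : ρ' ≤ 2 * ρ)
    (ht : 0 ≤ t) (k : ℤ) {B : ℝ} (hB : |loss δ₀ δ (kZero δ ρ) k t ρ' - loss δ₀ δ (kZero δ ρ) k t ρ| ≤ B) :
    |loss δ₀ δ (kZero δ ρ') k t ρ' - loss δ₀ δ (kZero δ ρ) k t ρ|
      ≤ B + (δ * √δ * (√ρ' - √ρ) + 1) * (1 / (1000 * δ)) := by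
  have hδ := h.pos
  obtain ⟨h0, -⟩ := threshold_lt.one_le h hθ
  have h0' : 0 < ρ' := by linarith
  obtain ⟨a1, a2, a3⟩ := kZero_bounds h hθ
  obtain ⟨b1, b2, b3⟩ := kZero_bounds h (hθ.trans_le hρρ)
  have c1 : √(δ ^ 3 * ρ) ≤ √(δ ^ 3 * ρ') := by gcongr
  have c2 : √(δ ^ 3 * ρ') ≤ 3 / 2 * √(δ ^ 3 * ρ) := by
    rw [Real.sqrt_le_left (by positivity), mul_pow, Real.sq_sqrt (by positivity)]
    have : 0 < δ ^ 3 * ρ := by positivity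
    have : δ ^ 3 * ρ' ≤ δ ^ 3 * (2 * ρ) := by gcongr
    linarith
  have h2 := abs_loss_sub_le_mul h h0' ht (m := kZero δ ρ) (n := kZero δ ρ') (by linarith)
    (by linarith) (by linarith) (by linarith) k
  have h3 : |(kZero δ ρ' : ℝ) - kZero δ ρ| ≤ δ * √δ * (√ρ' - √ρ) + 1 := by
    rw [mul_sub, ← sqrt_cube_mul hδ.le, ← sqrt_cube_mul hδ.le, abs_le]
    constructor <;> linarith
  calc _ = |(loss δ₀ δ (kZero δ ρ') k t ρ' - loss δ₀ δ (kZero δ ρ) k t ρ')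
        + (loss δ₀ δ (kZero δ ρ) k t ρ' - loss δ₀ δ (kZero δ ρ) k t ρ)| := by congr 1; ring
    _ ≤ _ := abs_add_le _ _
    _ ≤ |(kZero δ ρ' : ℝ) - kZero δ ρ| * (1 / (1000 * δ)) + B := add_le_add h2 hB
    _ ≤ (δ * √δ * (√ρ' - √ρ) + 1) * (1 / (1000 * δ)) + B := by gcongr
    _ = _ := by ring

/-- The Hölder bound. -/
theorem abs_loss_sub_le_holder {t ρ ρ' : ℝ} (hθ : threshold δ < ρ) (hρρ : ρ ≤ ρ')
    (hρ' : ρ' ≤ 2 * ρ) (ht : 0 ≤ t) (k : ℤ) :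
    |loss δ₀ δ (kZero δ ρ') k t ρ' - loss δ₀ δ (kZero δ ρ) k t ρ|
      ≤ √δ / 20 * √(ρ' - ρ) + 1 / (1000 * δ) := by
  have hδ := h.pos
  have hs := h.sqrt_pos
  obtain ⟨h0, -⟩ := threshold_lt.one_le h hθ
  refine (loss_frozen_aux h hθ hρρ hρ' ht k
    (abs_loss_sub_le h hθ hρρ hρ' ht (kZero_le_two_mul h hθ) k).2).trans ?_
  have h1 : √ρ' - √ρ ≤ √(ρ' - ρ) := by
    have := abs_sqrt_sub_le_sqrt (h0.le.trans hρρ) h0.le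
    rw [abs_of_nonneg (sub_nonneg.2 hρρ)] at this
    exact (le_abs_self _).trans this
  have h2 : (δ * √δ * (√ρ' - √ρ) + 1) * (1 / (1000 * δ))
      ≤ (δ * √δ * √(ρ' - ρ) + 1) * (1 / (1000 * δ)) := by gcongr
  have h3 : (δ * √δ * √(ρ' - ρ) + 1) * (1 / (1000 * δ)) = √δ / 1000 * √(ρ' - ρ) + 1 / (1000 * δ) := by
    field_simp
  have h4 : 0 ≤ √δ * √(ρ' - ρ) := by positivity
  linarith

/-- If `|ρ| ≤ 4|ρ-ρ'|`, the crude lower bound `e^{-2δ√|ρ|}` is enough because `δ` is much smaller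
than `√δ`; for `|ρ|` up to twice the threshold it costs only a constant. In the remaining case both
frequencies are comparable, have the same sign and exceed the threshold, and the Hölder bound
applies after a reflection. -/
theorem wK_le_mul_exp_sqrt : ∃ C : ℝ, 1 ≤ C ∧ ∀ (k : ℤ) (t : ℝ), 0 ≤ t → ∀ ρ ρ' : ℝ,
    wK δ₀ δ k t ρ' ≤ C * (wK δ₀ δ k t ρ * Real.exp (√δ / 20 * √|ρ - ρ'|)) := by
  have hδ := h.pos
  have hs := h.sqrt_pos
  have hθ0 := threshold_pos hδ
  set C₁ := 2 * δ * √(2 * threshold δ)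
  set C₂ := 1 / (1000 * δ)
  have hC₁ : 0 ≤ C₁ := by positivity
  have hC₂ : 0 ≤ C₂ := by positivity
  refine ⟨Real.exp (C₁ + C₂), Real.one_le_exp (by positivity), ?_⟩
  have main : ∀ (k : ℤ) (t : ℝ), 0 ≤ t → ∀ ρ ρ' : ℝ, 4 * |ρ - ρ'| ≤ ρ → 2 * threshold δ ≤ ρ →
      wK δ₀ δ k t ρ' ≤ Real.exp (C₁ + C₂) * (wK δ₀ δ k t ρ * Real.exp (√δ / 20 * √|ρ - ρ'|)) := by
    intro k t ht ρ ρ' h1 h2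
    have h3 := abs_le.1 (show |ρ - ρ'| ≤ ρ / 4 by linarith)
    have h4 : |loss δ₀ δ (kZero δ ρ') k t ρ' - loss δ₀ δ (kZero δ ρ) k t ρ|
        ≤ √δ / 20 * √|ρ - ρ'| + C₂ := by
      rcases le_total ρ ρ' with hle | hle
      · have := abs_loss_sub_le_holder h (by linarith) hle (by linarith) ht k
        rwa [abs_sub_comm ρ, abs_of_nonneg (sub_nonneg.2 hle)]
      · have := abs_loss_sub_le_holder h (by linarith) hle (by linarith) ht k
        rwa [abs_of_nonneg (sub_nonneg.2 hle), abs_sub_comm]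
    refine (wK_le_of_loss h (by linarith) (by linarith) h4).trans ?_
    rw [Real.exp_add, mul_comm (Real.exp (C₁ + C₂)), mul_assoc]
    have := (wK_pos h k t ρ).le
    gcongr
    linarith
  intro k t ht ρ ρ'
  have hw := wK_le_one h k t ρ'
  rcases le_or_gt |ρ| (4 * |ρ - ρ'|) with h1 | h1
  · have h2 := exp_le_wK h k ht ρ
    have h3 : √|ρ| ≤ 2 * √|ρ - ρ'| := by
      rw [Real.sqrt_le_left (by positivity), mul_pow, Real.sq_sqrt (abs_nonneg _)]
      linarith
    have h4 : 1 ≤ Real.exp (-(2 * δ * √|ρ|)) * Real.exp (√δ / 20 * √|ρ - ρ'|) := by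
      rw [← Real.exp_add]
      apply Real.one_le_exp
      have := h.le_sqrt
      have h5 : 2 * δ * √|ρ| ≤ 2 * (√δ / 10 ^ 4) * (2 * √|ρ - ρ'|) := by
        gcongr
        linarith
      have : 0 ≤ √δ * √|ρ - ρ'| := by positivity
      linarith
    calc _ ≤ 1 * 1 := by linarith
      _ ≤ Real.exp (C₁ + C₂) * (Real.exp (-(2 * δ * √|ρ|)) * Real.exp (√δ / 20 * √|ρ - ρ'|)) := by
        gcongr
        exact Real.one_le_exp (by positivity)
      _ ≤ _ := by gcongr
  rcases le_or_gt |ρ| (2 * threshold δ) with h2 | h2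
  · have h3 := exp_le_wK h k ht ρ
    calc _ ≤ 1 := hw
      _ ≤ Real.exp (C₁ + C₂) * (Real.exp (-(2 * δ * √|ρ|)) * Real.exp (√δ / 20 * √|ρ - ρ'|)) := by
        rw [← Real.exp_add, ← Real.exp_add]
        apply Real.one_le_exp
        have : 2 * δ * √|ρ| ≤ C₁ :=
          mul_le_mul_of_nonneg_left (Real.sqrt_le_sqrt h2) (by positivity)
        have : 0 ≤ √δ / 20 * √|ρ - ρ'| := by positivity
        linarith
      _ ≤ _ := by gcongr
  rcases le_total 0 ρ with hρ | hρ
  · rw [abs_of_nonneg hρ] at h1 h2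
    exact main k t ht ρ ρ' h1.le h2.le
  · rw [abs_of_nonpos hρ] at h1 h2
    have e : |-ρ - -ρ'| = |ρ - ρ'| := by rw [← abs_neg]; congr 1; ring
    have := main (-k) t ht (-ρ) (-ρ') (by rw [e]; exact h1.le) h2.le
    rwa [wK_neg _ hδ, wK_neg _ hδ, e] at this

/-- Frequencies in a window in which the phase of the weights changes by a bounded amount. -/
theorem wK_le_window {σ t ρ ρ' N : ℝ} (hθ : threshold δ < σ) (hσ : σ ≤ ρ) (hσ' : σ ≤ ρ')
    (h2 : ρ ≤ 2 * ρ') (h2' : ρ' ≤ 2 * ρ) (ht : 0 ≤ t) (k : ℤ)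
    (hN : 2 * t / σ * |ρ - ρ'| ≤ N) (hN' : |ρ - ρ'| ≤ N * √σ) :
    wK δ₀ δ k t ρ' ≤ wK δ₀ δ k t ρ * Real.exp (8 * N + 1 / δ) := by
  have hδ := h.pos
  have hs := h.sqrt_pos
  have hσ0 := (threshold_lt.one_le h hθ).1
  have hN0 : 0 ≤ N := le_trans (by positivity) hN
  have key : ∀ ρ ρ' : ℝ, σ ≤ ρ → ρ ≤ ρ' → ρ' ≤ 2 * ρ → 2 * t / σ * (ρ' - ρ) ≤ N →
      ρ' - ρ ≤ N * √σ → |loss δ₀ δ (kZero δ ρ') k t ρ' - loss δ₀ δ (kZero δ ρ) k t ρ|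
        ≤ 8 * N + 1 / δ := by
    intro ρ ρ' hσ hρρ h2 hN hN'
    have h0 : 0 < ρ := by linarith
    have hr := Real.sqrt_pos.2 h0
    have hd : 0 ≤ ρ' - ρ := by linarith
    refine (loss_frozen_aux h (hθ.trans_le hσ) hρρ h2 ht k
      (abs_loss_sub_le h (hθ.trans_le hσ) hρρ h2 ht (kZero_le_two_mul h (hθ.trans_le hσ)) k).1).trans ?_
    have a1 : min 1 (2 * t / ρ) * (ρ' - ρ) ≤ N := by
      refine le_trans ?_ hN
      gcongr
      exact (min_le_right _ _).trans (by gcongr)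
    have a2 : (ρ' - ρ) / √ρ ≤ N := by
      rw [div_le_iff₀ hr]
      exact hN'.trans (by gcongr)
    have a3 : √ρ' - √ρ ≤ N := by
      have := abs_sqrt_sub_le_div (h0.le.trans hρρ) h0
      rw [abs_of_nonneg hd] at this
      exact (le_abs_self _).trans (this.trans a2)
    have a4 : (δ * √δ * (√ρ' - √ρ) + 1) * (1 / (1000 * δ)) ≤ (δ * 1 * N + 1) * (1 / (1000 * δ)) := by
      have := h.sqrt_le
      have : 0 ≤ √ρ' - √ρ := sub_nonneg.2 (Real.sqrt_le_sqrt hρρ)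
      gcongr
      linarith
    have a5 : (δ * 1 * N + 1) * (1 / (1000 * δ)) = N / 1000 + 1 / δ / 1000 := by field_simp
    have a6 : δ * (min 1 (2 * t / ρ) * (ρ' - ρ) + 6 * ((ρ' - ρ) / √ρ)) ≤ 1 * (N + 6 * N) := by
      have := h.le_one
      gcongr
    have a7 : 0 ≤ 1 / δ := by positivity
    linarith
  apply wK_le_of_loss h (hθ.trans_le hσ) (hθ.trans_le hσ')
  rcases le_total ρ ρ' with hle | hle
  · rw [abs_sub_comm, abs_of_nonneg (sub_nonneg.2 hle)] at hN hN'
    exact key ρ ρ' hσ hle h2' hN hN'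
  · rw [abs_of_nonneg (sub_nonneg.2 hle)] at hN hN'
    rw [abs_sub_comm]
    exact key ρ' ρ hσ' hle h2 hN hN'

/-- After the last critical time the weights vary slowly. -/
theorem wK_le_late {σ t ρ ρ' : ℝ} (hθ : threshold δ < σ) (hσ : σ ≤ ρ) (hσ' : σ ≤ ρ')
    (h2 : ρ ≤ 2 * σ) (h2' : ρ' ≤ 2 * σ) (ht : 4 * √σ / (δ * √δ) ≤ t) (k : ℤ) {X : ℝ}
    (hX : min (δ * (|ρ - ρ'| + 6 * (|ρ - ρ'| / √σ))) (√δ / 100 * √|ρ - ρ'|) ≤ X) :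
    wK δ₀ δ k t ρ' ≤ wK δ₀ δ k t ρ * Real.exp X := by
  have hδ := h.pos
  have hs := h.sqrt_pos
  have hσ0 := (threshold_lt.one_le h hθ).1
  have ht0 : 0 ≤ t := le_trans (by positivity) ht
  have key : ∀ ρ ρ' : ℝ, σ ≤ ρ → ρ ≤ ρ' → ρ' ≤ 2 * σ →
      |loss δ₀ δ (kZero δ ρ') k t ρ' - loss δ₀ δ (kZero δ ρ) k t ρ|
        ≤ min (δ * ((ρ' - ρ) + 6 * ((ρ' - ρ) / √σ))) (√δ / 100 * √(ρ' - ρ)) := by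
    intro ρ ρ' hσ hρρ h2
    have h0 : 0 < ρ := by linarith
    have h0' : 0 < ρ' := by linarith
    have hd : 0 ≤ ρ' - ρ := by linarith
    have hr := Real.sqrt_pos.2 hσ0
    have hk : kZero δ ρ ≤ kZero δ ρ' := Nat.floor_le_floor (by gcongr)
    -- The time is already late for the smaller of the two numbers of intervals, so the exponent at
    -- `ρ'` may be computed with the number belonging to `ρ`.
    have hc : critTime (kZero δ ρ) ρ' ≤ t := by
      refine (critTime_kZero_le h (hθ.trans_le hσ) h0').trans (le_trans ?_ ht)
      rw [mul_div, div_le_div_iff₀ (by positivity) (by positivity)]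
      have e1 : σ = √σ * √σ := (Real.mul_self_sqrt hσ0.le).symm
      have e2 : √σ ≤ √ρ := Real.sqrt_le_sqrt hσ
      have e3 : 2 * ρ' ≤ 4 * √σ * √ρ := by
        have : √σ * √σ ≤ √σ * √ρ := by gcongr
        linarith
      calc 2 * ρ' * (δ * √δ) ≤ 4 * √σ * √ρ * (δ * √δ) := by gcongr
        _ = _ := by ring
    rw [loss_eq_of_critTime_le h0' hk hc]
    have := abs_loss_sub_le h (hθ.trans_le hσ) hρρ (by linarith) ht0
      (kZero_le_two_mul h (hθ.trans_le hσ)) k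
    refine le_min (this.1.trans ?_) this.2
    have f1 : min 1 (2 * t / ρ) * (ρ' - ρ) ≤ 1 * (ρ' - ρ) := by
      gcongr
      exact min_le_left _ _
    gcongr
    linarith
  apply wK_le_of_loss h (hθ.trans_le hσ) (hθ.trans_le hσ')
  refine le_trans ?_ hX
  rcases le_total ρ ρ' with hle | hle
  · rw [abs_sub_comm ρ, abs_of_nonneg (sub_nonneg.2 hle)]
    exact key ρ ρ' hσ hle h2'
  · rw [abs_of_nonneg (sub_nonneg.2 hle), abs_sub_comm]
    exact key ρ' ρ hσ' hle h2

end small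

end GevreyWeights

namespace GevreyWeights

/-! ### The weight `μ^#` -/

/-- The distance from `t` to the critical times `ρ / l`, `l ≥ 1`. -/
noncomputable def critDist (t ρ : ℝ) : ℝ := ⨅ i : ℕ, |t - ρ / ((i : ℝ) + 1)|

theorem critDist_le (t ρ : ℝ) (i : ℕ) : critDist t ρ ≤ |t - ρ / ((i : ℝ) + 1)| :=
  ciInf_le ⟨0, by rintro _ ⟨i, rfl⟩; exact abs_nonneg _⟩ i

theorem critDist_nonneg (t ρ : ℝ) : 0 ≤ critDist t ρ := le_ciInf fun _ => abs_nonneg _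

theorem abs_sub_div_le (t ρ ρ' : ℝ) (i : ℕ) :
    |t - ρ' / ((i : ℝ) + 1)| ≤ |t - ρ / ((i : ℝ) + 1)| + |ρ - ρ'| * (1 / ((i : ℝ) + 1)) := by
  have e : t - ρ' / ((i : ℝ) + 1) = (t - ρ / ((i : ℝ) + 1)) + (ρ - ρ') * (1 / ((i : ℝ) + 1)) := by ring
  rw [e]
  refine (abs_add_le _ _).trans_eq ?_
  rw [abs_mul (ρ - ρ'), abs_of_pos (a := 1 / ((i : ℝ) + 1)) (by positivity)]

theorem critDist_le_add (t ρ ρ' : ℝ) : critDist t ρ' ≤ critDist t ρ + |ρ - ρ'| := by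
  rw [← sub_le_iff_le_add]
  refine le_ciInf fun i => ?_
  rw [sub_le_iff_le_add]
  refine (critDist_le t ρ' i).trans ((abs_sub_div_le t ρ ρ' i).trans ?_)
  gcongr
  apply mul_le_of_le_one_right (abs_nonneg _)
  rw [div_le_one (by positivity)]
  linarith [(Nat.cast_nonneg i : (0 : ℝ) ≤ i)]

/-- For `t > 0` the critical time `ρ/(⌊ρ/t⌋+1)` lies below `t` by at most the local spacing `t²/ρ`.
For `t = 0` the infimum is only approached, by critical times tending to zero. -/
theorem critDist_le_sq_div {t ρ : ℝ} (ht : 0 ≤ t) (hρ : 0 < ρ) : critDist t ρ ≤ t ^ 2 / ρ := by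
  rcases ht.eq_or_lt with rfl | ht
  · have h : Filter.Tendsto (fun i : ℕ => ρ / ((i : ℝ) + 1)) Filter.atTop (nhds 0) :=
      Filter.Tendsto.div_atTop tendsto_const_nhds
        (Filter.tendsto_atTop_add_const_right _ _ tendsto_natCast_atTop_atTop)
    refine (ge_of_tendsto' h fun i => (critDist_le 0 ρ i).trans_eq ?_).trans (by simp)
    rw [zero_sub, abs_neg, abs_of_pos (by positivity)]
  · refine (critDist_le t ρ ⌊ρ / t⌋₊).trans ?_
    have h1 := Nat.lt_floor_add_one (ρ / t)
    have h2 := Nat.floor_le (show 0 ≤ ρ / t by positivity)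
    set i : ℝ := (⌊ρ / t⌋₊ : ℝ)
    have hi : 0 < i + 1 := lt_of_le_of_lt (by positivity) h1
    have h3 : ρ / (i + 1) ≤ t := by
      rw [div_le_iff₀ hi]
      rw [div_lt_iff₀ ht] at h1
      linarith
    have h4 : ρ / (ρ / t + 1) ≤ ρ / (i + 1) := by gcongr
    have h5 : ρ / (ρ / t + 1) = t - t ^ 2 / (ρ + t) := by field_simp; ring
    have h6 : t ^ 2 / (ρ + t) ≤ t ^ 2 / ρ := by
      gcongr
      linarith
    rw [abs_of_nonneg (by linarith)]
    linarith

section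

variable {ρ : ℝ} (hρ : 0 < ρ)
include hρ

/-- Apart from `2ρ`, the endpoints of the intervals are the midpoints between consecutive critical
times, so `ρ/(i+1)` is the closest one. This replaces the choice of an index in `μ^#` by a Lipschitz
function of the frequency. -/
theorem critDist_eq {t : ℝ} {i : ℕ} (h1 : critTime (i + 1) ρ ≤ t) (h2 : t ≤ critTime i ρ) :
    critDist t ρ = |t - ρ / ((i : ℝ) + 1)| := by
  apply le_antisymm (critDist_le t ρ i)
  refine le_ciInf fun j => ?_
  rw [critTime_succ] at h1
  have e : ρ / ((i : ℝ) + 2) < ρ / (i + 1) := by gcongr; norm_num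
  rcases lt_trichotomy i j with hij | rfl | hij
  · have hij' : (i : ℝ) + 1 ≤ j := by exact_mod_cast hij
    have h3 : ρ / ((j : ℝ) + 1) ≤ ρ / (i + 2) := by
      apply div_le_div_of_nonneg_left hρ.le (by positivity) (by linarith)
    refine le_trans ?_ (le_abs_self _)
    rw [abs_le]
    constructor <;> linarith
  · rfl
  · obtain ⟨m, rfl⟩ : ∃ m, i = m + 1 := ⟨i - 1, by omega⟩
    have hij' : (j : ℝ) ≤ m := by exact_mod_cast Nat.lt_succ_iff.1 hij
    rw [critTime_succ] at h2
    push_cast at h1 h2 e ⊢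
    rw [add_assoc (m : ℝ), one_add_one_eq_two] at *
    have h3 : ρ / ((m : ℝ) + 1) ≤ ρ / (j + 1) := by gcongr
    refine le_trans ?_ (neg_le_abs _)
    have h4 : ρ / ((m : ℝ) + 2) < ρ / (m + 1) := by gcongr; norm_num
    rw [abs_le]
    constructor <;> linarith

omit hρ in
theorem critIndex_spec_le {n : ℕ} (hn : 1 ≤ n) {t : ℝ} (h : critTime n ρ ≤ t) (ht : t ≤ 2 * ρ) :
    ∃ i : ℕ, critIndex t ρ = i + 1 ∧ critTime (i + 1) ρ ≤ t ∧ t ≤ critTime i ρ := by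
  have hmem : n ∈ {l : ℕ | 1 ≤ l ∧ critTime l ρ ≤ t} := ⟨hn, h⟩
  have h1 := Nat.sInf_mem ⟨n, hmem⟩
  rw [← critIndex] at h1
  obtain ⟨i, hi⟩ : ∃ i, critIndex t ρ = i + 1 := ⟨_, (Nat.succ_pred_eq_of_pos h1.1).symm⟩
  refine ⟨i, hi, hi ▸ h1.2, ?_⟩
  rcases Nat.eq_zero_or_pos i with rfl | h0
  · rwa [critTime_zero]
  · by_contra hcon
    have : critIndex t ρ ≤ i := Nat.sInf_le ⟨h0, (not_le.1 hcon).le⟩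
    omega

theorem one_div_le_of_critTime_le {t : ℝ} {i : ℕ} (h : critTime (i + 1) ρ ≤ t) :
    1 / ((i : ℝ) + 1) ≤ 2 * t / ρ := by
  have h1 := center_lt_critTime hρ (i + 1)
  push_cast at h1
  rw [div_lt_iff₀ (by positivity)] at h1
  rw [div_le_div_iff₀ (by positivity) hρ]
  have : 0 < critTime (i + 1) ρ := critTime_pos hρ _
  nlinarith [(Nat.cast_nonneg i : (0 : ℝ) ≤ i)]

end

theorem muSharp_abs (δ t ρ : ℝ) : muSharp δ t |ρ| = muSharp δ t ρ := by
  rw [muSharp, muSharp, abs_abs]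

theorem muSharp_neg (δ t ρ : ℝ) : muSharp δ t (-ρ) = muSharp δ t ρ := by
  rw [muSharp, muSharp, abs_neg]

theorem muSharp_of_le {δ t ρ : ℝ} (h : |ρ| ≤ threshold δ) : muSharp δ t ρ = 0 := by
  rw [muSharp, muSharpPos, if_pos h]

theorem muSharp_nonneg (δ t ρ : ℝ) : 0 ≤ muSharp δ t ρ := by
  rw [muSharp, muSharpPos]
  split_ifs <;> positivity

theorem muSharp_le (δ t ρ : ℝ) : muSharp δ t ρ ≤ δ ^ 2 := by
  rw [muSharp, muSharpPos]
  split_ifs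
  · positivity
  · rfl
  · apply div_le_self (by positivity)
    exact one_le_logArg δ (abs_nonneg _)
  · positivity

section small

variable {δ₀ δ : ℝ} (h : IsSmall δ₀ δ)
include h

theorem muSharp_le_one (t ρ : ℝ) : muSharp δ t ρ ≤ 1 :=
  (muSharp_le δ t ρ).trans (pow_le_one₀ h.pos.le h.le_one)

section threshold

variable {ρ : ℝ} (hθ : threshold δ < ρ)
include hθ

theorem muSharp_low {t : ℝ} (ht : t < critTime (kZero δ ρ) ρ) : muSharp δ t ρ = δ ^ 2 := by
  rw [muSharp, abs_of_pos ((threshold_pos h.pos).trans hθ), muSharpPos, if_neg (not_le.2 hθ),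
    if_pos ht]

theorem muSharp_late {t : ℝ} (ht : 2 * ρ < t) : muSharp δ t ρ = 0 := by
  have h0 := (threshold_pos h.pos).trans hθ
  have : critTime (kZero δ ρ) ρ ≤ t := by
    have := critTime_antitone h0 (Nat.zero_le (kZero δ ρ))
    simp only [critTime_zero] at this
    linarith
  rw [muSharp, abs_of_pos h0, muSharpPos, if_neg (not_le.2 hθ), if_neg (not_lt.2 this),
    if_neg (not_le.2 ht)]

theorem muSharp_mid {t : ℝ} (ht : critTime (kZero δ ρ) ρ ≤ t) (ht' : t ≤ 2 * ρ) :
    muSharp δ t ρ = δ ^ 2 / (1 + δ ^ 2 * critDist t ρ) ∧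
    ∃ i : ℕ, critDist t ρ = |t - ρ / ((i : ℝ) + 1)| ∧ 1 / ((i : ℝ) + 1) ≤ 2 * t / ρ := by
  have h0 := (threshold_pos h.pos).trans hθ
  obtain ⟨i, hi, h1, h2⟩ := critIndex_spec_le (one_le_kZero h.pos h.le_one hθ) ht ht'
  have h3 := critDist_eq h0 h1 h2
  refine ⟨?_, i, h3, one_div_le_of_critTime_le h0 h1⟩
  rw [muSharp, abs_of_pos h0, muSharpPos, if_neg (not_le.2 hθ), if_neg (not_lt.2 ht),
    if_pos ht', hi, h3]
  push_cast
  rfl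

theorem le_muSharp {t : ℝ} (ht' : t ≤ 2 * ρ) :
    δ ^ 2 / (1 + δ ^ 2 * critDist t ρ) ≤ muSharp δ t ρ := by
  rcases lt_or_ge t (critTime (kZero δ ρ) ρ) with ht | ht
  · rw [muSharp_low h hθ ht]
    apply div_le_self (by positivity)
    exact one_le_logArg δ (critDist_nonneg _ _)
  · exact (muSharp_mid h hθ ht ht').1.ge

/-- Before the transition time the critical times have spacing `O(δ^{-3})`. Thus `δ²/(1+δ²
critDist)` is comparable to the constant value `δ²` taken by `μ^#` there, up to a factor of order
`1/δ`. -/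
theorem sq_div_le_of_low {t : ℝ} (ht0 : 0 ≤ t) (ht : t < critTime (kZero δ ρ) ρ) :
    t ^ 2 / ρ ≤ 4 / δ ^ 3 := by
  have h0 := (threshold_pos h.pos).trans hθ
  have hδ := h.pos
  have h1 := ht.le.trans (critTime_kZero_le h hθ h0)
  rw [div_le_div_iff₀ h0 (by positivity)]
  have h2 : t ^ 2 ≤ (2 * (ρ / (δ * √δ * √ρ))) ^ 2 := by gcongr
  have h3 : (2 * (ρ / (δ * √δ * √ρ))) ^ 2 = 4 * ρ / δ ^ 3 := by
    rw [mul_pow, div_pow, mul_pow, mul_pow, h.sqrt_sq, Real.sq_sqrt h0.le]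
    field_simp
    norm_num
  rw [h3, le_div_iff₀ (by positivity)] at h2
  exact h2

end threshold

theorem muSharp_le_of_critDist {t ρ ρ' A : ℝ} (hθ' : threshold δ < ρ')
    (ht' : t ≤ 2 * ρ') (hA : muSharp δ t ρ * (1 + δ ^ 2 * critDist t ρ') ≤ A * δ ^ 2) :
    muSharp δ t ρ ≤ A * muSharp δ t ρ' := by
  have h1 := one_le_logArg δ (critDist_nonneg t ρ')
  have h2 := le_muSharp h hθ' ht'
  have hδ := h.pos
  have hA0 : 0 ≤ A := by
    have : 0 ≤ A * δ ^ 2 := le_trans (mul_nonneg (muSharp_nonneg _ _ _) (by linarith)) hA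
    exact nonneg_of_mul_nonneg_left this (by positivity)
  refine le_trans ?_ (mul_le_mul_of_nonneg_left h2 hA0)
  rw [← mul_div_assoc, le_div_iff₀ (by linarith)]
  exact hA

/-- The index of the critical time closest to `t` at the frequency `ρ` is used as a competitor at
`ρ'`. It moves by `|ρ-ρ'|/(i+1)`, which is at most `N` because `1/(i+1) ≤ 2t/ρ`. -/
theorem muSharp_le_window {t ρ ρ' N : ℝ} (ht : 0 ≤ t) (hθ : threshold δ < ρ)
    (hθ' : threshold δ < ρ') (ht' : t ≤ 2 * ρ') (hρ : ρ ≤ 2 * ρ')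
    (hN : 2 * t / ρ * |ρ - ρ'| ≤ N) :
    muSharp δ t ρ ≤ (1 + 8 / δ + N) * muSharp δ t ρ' := by
  have h0 := (threshold_pos h.pos).trans hθ
  have h0' := (threshold_pos h.pos).trans hθ'
  have hδ := h.pos
  have hN0 : 0 ≤ N := le_trans (by positivity) hN
  apply muSharp_le_of_critDist h hθ' ht'
  rcases lt_or_ge t (critTime (kZero δ ρ) ρ) with hlow | hlow
  · rw [muSharp_low h hθ hlow, mul_comm]
    refine mul_le_mul_of_nonneg_right ?_ (by positivity)
    have h1 := sq_div_le_of_low h hθ ht hlow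
    have h2 := critDist_le_sq_div ht h0'
    have h3 : t ^ 2 / ρ' ≤ 8 / δ ^ 3 := by
      rw [div_le_div_iff₀ h0 (by positivity)] at h1
      rw [div_le_div_iff₀ h0' (by positivity)]
      linarith
    have h4 : δ ^ 2 * critDist t ρ' ≤ δ ^ 2 * (8 / δ ^ 3) := by
      gcongr
      linarith
    have h5 : δ ^ 2 * (8 / δ ^ 3) = 8 / δ := by field_simp
    linarith
  · rcases le_or_gt t (2 * ρ) with hle | hlt
    · obtain ⟨e, i, hi, hi'⟩ := muSharp_mid h hθ hlow hle
      have h1 := one_le_logArg δ (critDist_nonneg t ρ)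
      rw [e, div_mul_eq_mul_div, div_le_iff₀ (by linarith), mul_comm, mul_right_comm]
      refine mul_le_mul_of_nonneg_right ?_ (by positivity)
      have h2 : critDist t ρ' ≤ critDist t ρ + N := by
        refine (critDist_le t ρ' i).trans ((abs_sub_div_le t ρ ρ' i).trans ?_)
        rw [hi]
        gcongr
        refine le_trans ?_ hN
        rw [mul_comm]
        gcongr
      have h3 : δ ^ 2 ≤ 1 := pow_le_one₀ hδ.le h.le_one
      have h4 : δ ^ 2 * critDist t ρ' ≤ δ ^ 2 * critDist t ρ + δ ^ 2 * N := by
        rw [← mul_add]; gcongr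
      have h5 : δ ^ 2 * N ≤ N := mul_le_of_le_one_left hN0 h3
      have h6 : 0 ≤ 8 / δ := by positivity
      nlinarith
    · rw [muSharp_late h hθ hlt, zero_mul]
      positivity

theorem muSharp_le_of_far {t ρ : ℝ} (hθ : threshold δ < ρ) (hlow : critTime (kZero δ ρ) ρ ≤ t)
    (hρt : ρ < t) : muSharp δ t ρ ≤ 1 / (t - ρ) := by
  have h0 := (threshold_pos h.pos).trans hθ
  have hd : 0 < t - ρ := by linarith
  rcases le_or_gt t (2 * ρ) with hle | hlt
  · obtain ⟨e, i, hi, -⟩ := muSharp_mid h hθ hlow hle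
    rw [e, hi]
    have h2 : t - ρ ≤ |t - ρ / ((i : ℝ) + 1)| := by
      refine le_trans ?_ (le_abs_self _)
      have : ρ / ((i : ℝ) + 1) ≤ ρ := div_le_self h0.le (by linarith [(Nat.cast_nonneg i : (0 : ℝ) ≤ i)])
      linarith
    have hδ2 : 0 < δ ^ 2 := pow_pos h.pos 2
    rw [div_le_div_iff₀ (by positivity) hd]
    nlinarith
  · rw [muSharp_late h hθ hlt]
    positivity

/-- Away from the low times `μ^#` varies slowly. -/
theorem muSharp_le_late {t ρ ρ' : ℝ} (hθ : threshold δ < ρ) (hθ' : threshold δ < ρ')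
    (hρ : |ρ - ρ'| ≤ ρ / 8) (ht : 2 * (ρ / (δ * √δ * √ρ)) ≤ t) :
    muSharp δ t ρ ≤ (1 + δ ^ 2 * |ρ - ρ'|) * muSharp δ t ρ' + 2 / ρ := by
  have h0 := (threshold_pos h.pos).trans hθ
  have hlow := (critTime_kZero_le h hθ h0).trans ht
  have hR : 0 ≤ 2 / ρ := by positivity
  rcases le_or_gt t (2 * ρ) with hle | hlt
  · rcases le_or_gt t (2 * ρ') with hle' | hlt'
    · suffices muSharp δ t ρ ≤ (1 + δ ^ 2 * |ρ - ρ'|) * muSharp δ t ρ' by linarith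
      apply muSharp_le_of_critDist h hθ' hle'
      have h1 := one_le_logArg δ (critDist_nonneg t ρ)
      rw [(muSharp_mid h hθ hlow hle).1, div_mul_eq_mul_div, div_le_iff₀ (by linarith),
        mul_comm (δ ^ 2), mul_right_comm]
      gcongr
      have h2 := mul_le_mul_of_nonneg_left (critDist_le_add t ρ ρ') (sq_nonneg δ)
      have h3 : 0 ≤ δ ^ 2 * |ρ - ρ'| := by positivity
      nlinarith
    -- Here `μ^#` vanishes at `ρ'` but perhaps not at `ρ`. As `t > 2ρ'`, however, `t` is far above
    -- every critical time of `ρ`, and `μ^#(t, ρ)` goes into the error `2/ρ`.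
    · have h1 := abs_le.1 hρ
      have h2 := muSharp_le_of_far h hθ hlow (by linarith)
      have h3 : 1 / (t - ρ) ≤ 2 / ρ := by
        rw [div_le_div_iff₀ (by linarith) h0]
        linarith
      have h4 : 0 ≤ (1 + δ ^ 2 * |ρ - ρ'|) * muSharp δ t ρ' :=
        mul_nonneg (by positivity) (muSharp_nonneg _ _ _)
      linarith
  · rw [muSharp_late h hθ hlt]
    have h4 : 0 ≤ (1 + δ ^ 2 * |ρ - ρ'|) * muSharp δ t ρ' :=
      mul_nonneg (by positivity) (muSharp_nonneg _ _ _)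
    linarith

end small

/-! Powers of `⟨t⟩`. -/

section power

variable {σ₀ : ℝ} (hσ₀ : 0 < σ₀) (hσ₀' : σ₀ ≤ 1 / 100) (t : ℝ)
include hσ₀ hσ₀'

theorem bracket_rpow_pos : 0 < bracket t ^ (1 + σ₀) := Real.rpow_pos_of_pos (bracket_pos t) _

theorem bracket_rpow_le : bracket t ^ (1 + σ₀) ≤ bracket t * √(√(bracket t)) := by
  have h := bracket_pos t
  have h1 := one_le_bracket t
  calc _ ≤ bracket t ^ (1 + 1 / 4 : ℝ) := Real.rpow_le_rpow_of_exponent_le h1 (by linarith)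
    _ = _ := by
      rw [Real.rpow_add h, Real.rpow_one, Real.sqrt_eq_rpow, Real.sqrt_eq_rpow, ← Real.rpow_mul h.le]
      norm_num

theorem bracket_rpow_le_sqrt : bracket t ^ (1 + σ₀) ≤ bracket t * √(bracket t) := by
  refine (bracket_rpow_le hσ₀ hσ₀' t).trans ?_
  have h := bracket_pos t
  gcongr
  rw [Real.sqrt_le_left h.le]
  nlinarith [one_le_bracket t]

theorem bracket_rpow_le_sq : bracket t ^ (1 + σ₀) ≤ bracket t ^ 2 := by
  refine (bracket_rpow_le_sqrt hσ₀ hσ₀' t).trans ?_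
  have h := bracket_pos t
  rw [sq]
  gcongr
  rw [Real.sqrt_le_left h.le]
  nlinarith [one_le_bracket t]

end power

/-! ### Polynomial comparison of `μ^#` at arbitrary frequencies. -/

theorem muSharp_le_near {δ₀ δ : ℝ} (h : IsSmall δ₀ δ) {t ρ ρ' : ℝ} (ht : 0 ≤ t)
    (hθ : threshold δ < ρ) (hθ' : threshold δ < ρ') (hle : t ≤ 2 * ρ) (hle' : t ≤ 2 * ρ') :
    muSharp δ t ρ ≤ (1 + 4 / δ) * (1 + |ρ - ρ'|) * muSharp δ t ρ' := by
  have hδ := h.pos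
  have h0 := (threshold_pos hδ).trans hθ
  have hΔ := abs_nonneg (ρ - ρ')
  apply muSharp_le_of_critDist h hθ' hle'
  have hd := critDist_le_add t ρ ρ'
  set Δ := |ρ - ρ'|
  have hδ2 : δ ^ 2 ≤ 1 := pow_le_one₀ hδ.le h.le_one
  have h4 : δ ^ 2 * critDist t ρ' ≤ δ ^ 2 * critDist t ρ + δ ^ 2 * Δ := by
    rw [← mul_add]; gcongr
  have h5 : δ ^ 2 * Δ ≤ Δ := mul_le_of_le_one_left hΔ hδ2
  have h8 : 0 ≤ 4 / δ := by positivity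
  rcases lt_or_ge t (critTime (kZero δ ρ) ρ) with hlow | hlow
  · rw [muSharp_low h hθ hlow, mul_comm]
    refine mul_le_mul_of_nonneg_right ?_ (by positivity)
    have h2 := (critDist_le_sq_div ht h0).trans (sq_div_le_of_low h hθ ht hlow)
    have h6 : δ ^ 2 * critDist t ρ ≤ δ ^ 2 * (4 / δ ^ 3) := by gcongr
    have h7 : δ ^ 2 * (4 / δ ^ 3) = 4 / δ := by field_simp
    nlinarith
  · have h9 := one_le_logArg δ (critDist_nonneg t ρ)
    rw [(muSharp_mid h hθ hlow hle).1, div_mul_eq_mul_div, div_le_iff₀ (by linarith), mul_comm,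
      mul_right_comm]
    refine mul_le_mul_of_nonneg_right ?_ (by positivity)
    have h10 : 1 + δ ^ 2 * critDist t ρ' ≤ (1 + Δ) * (1 + δ ^ 2 * critDist t ρ) := by nlinarith
    refine h10.trans (mul_le_mul_of_nonneg_right ?_ (by linarith))
    nlinarith

/-- Between the cutoffs `2ρ' < t ≤ 2ρ` the value at `ρ'` is zero, so another term has to help. When
`t` dominates `|ρ-ρ'|`, all critical times of `ρ` are at distance at least `t/3` from `t`, and `1/t
≲ √⟨ρ'⟩/⟨t⟩^{1+σ₀}` because `t` and `ρ'` are comparable. -/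
theorem muSharp_le_gap {δ₀ δ : ℝ} (h : IsSmall δ₀ δ) {σ₀ : ℝ} (hσ₀ : 0 < σ₀)
    (hσ₀' : σ₀ ≤ 1 / 100) {t ρ ρ' : ℝ} (hθ : threshold δ < ρ) (hθ' : threshold δ < ρ')
    (hle : t ≤ 2 * ρ) (hlt' : 2 * ρ' < t) (ht8 : 8 * |ρ - ρ'| < t) :
    muSharp δ t ρ ≤ 18 * (√(bracket ρ') / bracket t ^ (1 + σ₀)) := by
  have hδ := h.pos
  have hθ0 := threshold_pos hδ
  have hΔ1 := abs_le.1 (le_refl |ρ - ρ'|)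
  have ht : 0 ≤ t := by linarith
  have hρ' : 0 ≤ ρ' := by linarith
  have hB := bracket_rpow_pos hσ₀ hσ₀' t
  have hbt : bracket t ≤ 1 + t := by simpa [abs_of_nonneg ht] using bracket_le t
  have hbt0 := bracket_pos t
  set Δ := |ρ - ρ'|
  have h0 : 0 < ρ := by linarith
  have ht0 : 0 < t := by linarith
  have hlow : critTime (kZero δ ρ) ρ ≤ t := by
    have h1 := critTime_antitone h0 (one_le_kZero hδ h.le_one hθ)
    have h2 := critTime_succ_lt_center h0 0
    simp only [zero_add] at h1 h2
    norm_num at h2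
    linarith
  have h1 := muSharp_le_of_far h hθ hlow (by linarith)
  have h2 : 1 / (t - ρ) ≤ 3 / t := by
    rw [div_le_div_iff₀ (by linarith) ht0]
    linarith
  have hth : 1 ≤ threshold δ := by
    rw [threshold, one_le_inv₀ (by positivity)]
    exact pow_le_one₀ hδ.le h.le_one
  have h3 : bracket t ≤ 2 * t := by linarith
  have h4 : √(bracket t) ≤ 3 * √(bracket ρ') := by
    rw [Real.sqrt_le_left (by positivity), mul_pow, Real.sq_sqrt (bracket_pos _).le]
    have := abs_le_bracket ρ'
    rw [abs_of_nonneg hρ'] at this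
    linarith
  have h5 : 1 / (6 * t) ≤ √(bracket ρ') / bracket t ^ (1 + σ₀) := by
    rw [div_le_div_iff₀ (by positivity) hB, one_mul]
    refine (bracket_rpow_le_sqrt hσ₀ hσ₀' t).trans ?_
    calc bracket t * √(bracket t) ≤ 2 * t * (3 * √(bracket ρ')) := by gcongr
      _ = _ := by ring
  have h6 : 3 / t = 18 * (1 / (6 * t)) := by field_simp; norm_num
  linarith

theorem muSharp_le_mul {δ₀ δ : ℝ} (h : IsSmall δ₀ δ) {σ₀ : ℝ} (hσ₀ : 0 < σ₀)
    (hσ₀' : σ₀ ≤ 1 / 100) : ∃ C : ℝ, 1 ≤ C ∧ ∀ t : ℝ, 0 ≤ t → ∀ ρ ρ' : ℝ,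
      muSharp δ t ρ ≤ C * (1 + |ρ - ρ'|) ^ 2
        * (muSharp δ t ρ' + √(bracket ρ') / bracket t ^ (1 + σ₀)) := by
  have hδ := h.pos
  have hθ0 := threshold_pos hδ
  set C := 100 * (1 + threshold δ) ^ 2 + (1 + 4 / δ)
  have hC1 : 100 * (1 + threshold δ) ^ 2 ≤ C := by
    have : 0 ≤ 4 / δ := by positivity
    linarith
  have hC2 : 1 + 4 / δ ≤ C := by
    have : 0 ≤ 100 * (1 + threshold δ) ^ 2 := by positivity
    linarith
  have hC0 : 0 < C := lt_of_lt_of_le (by positivity) hC2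
  refine ⟨C, by nlinarith, ?_⟩
  have main : ∀ t : ℝ, 0 ≤ t → ∀ ρ ρ' : ℝ, 0 ≤ ρ → 0 ≤ ρ' →
      muSharp δ t ρ ≤ C * (1 + |ρ - ρ'|) ^ 2
        * (muSharp δ t ρ' + √(bracket ρ') / bracket t ^ (1 + σ₀)) := by
    intro t ht ρ ρ' hρ hρ'
    have hB := bracket_rpow_pos hσ₀ hσ₀' t
    have hm' := muSharp_nonneg δ t ρ'
    have hsq : 1 ≤ √(bracket ρ') := by rw [Real.one_le_sqrt]; exact one_le_bracket _
    have hA : 0 ≤ √(bracket ρ') / bracket t ^ (1 + σ₀) := by positivity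
    have hΔ := abs_nonneg (ρ - ρ')
    set Δ := |ρ - ρ'| with hΔdef
    -- When `⟨t⟩` is controlled by `1 + |ρ-ρ'|`, the decay term alone dominates, in view of `μ^# ≤
    -- 1` and `⟨t⟩^{1+σ₀} ≤ ⟨t⟩²`.
    have easy : bracket t ^ 2 ≤ C * (1 + Δ) ^ 2 → muSharp δ t ρ ≤ C * (1 + Δ) ^ 2
        * (muSharp δ t ρ' + √(bracket ρ') / bracket t ^ (1 + σ₀)) := by
      intro hle
      have h1 := bracket_rpow_le_sq hσ₀ hσ₀' t
      calc muSharp δ t ρ ≤ 1 := muSharp_le_one h t ρ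
        _ ≤ C * (1 + Δ) ^ 2 * (√(bracket ρ') / bracket t ^ (1 + σ₀)) := by
          rw [← mul_div_assoc, one_le_div hB]
          nlinarith
        _ ≤ _ := by
          gcongr
          linarith
    have hbt : bracket t ≤ 1 + t := by simpa [abs_of_nonneg ht] using bracket_le t
    have hbt0 := bracket_pos t
    have easy' : t ≤ 2 * threshold δ + 8 * Δ → bracket t ^ 2 ≤ C * (1 + Δ) ^ 2 := by
      intro hle
      have h1 : bracket t ≤ 10 * (1 + threshold δ) * (1 + Δ) := by nlinarith
      calc bracket t ^ 2 ≤ (10 * (1 + threshold δ) * (1 + Δ)) ^ 2 := by gcongr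
        _ = 100 * (1 + threshold δ) ^ 2 * (1 + Δ) ^ 2 := by ring
        _ ≤ _ := by gcongr
    have hpos : 0 ≤ C * (1 + Δ) ^ 2
        * (muSharp δ t ρ' + √(bracket ρ') / bracket t ^ (1 + σ₀)) := by positivity
    rcases le_or_gt ρ (threshold δ) with hθ | hθ
    · rw [muSharp_of_le (by rwa [abs_of_nonneg hρ])]
      exact hpos
    rcases lt_or_ge (2 * ρ) t with hlt | hle
    · rw [muSharp_late h hθ hlt]
      exact hpos
    have hΔ1 := abs_le.1 hΔdef.ge
    rcases le_or_gt ρ' (threshold δ) with hθ' | hθ'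
    · exact easy (easy' (by linarith))
    rcases lt_or_ge (2 * ρ') t with hlt' | hle'
    · rcases le_or_gt t (8 * Δ) with ht8 | ht8
      · exact easy (easy' (by linarith))
      · have h1 := muSharp_le_gap h hσ₀ hσ₀' hθ hθ' hle hlt' ht8
        have h7 : 18 ≤ C * (1 + Δ) ^ 2 := by
          have : 1 ≤ (1 + Δ) ^ 2 := by nlinarith
          have : 18 ≤ C := by nlinarith
          nlinarith
        calc muSharp δ t ρ ≤ 18 * (√(bracket ρ') / bracket t ^ (1 + σ₀)) := h1
          _ ≤ _ := mul_le_mul h7 (by linarith) hA (by linarith)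
    · have h1 := muSharp_le_near h ht hθ hθ' hle hle'
      rw [← hΔdef] at h1
      refine h1.trans ?_
      have h2 : 1 + Δ ≤ (1 + Δ) ^ 2 := by nlinarith
      calc _ ≤ C * (1 + Δ) ^ 2 * muSharp δ t ρ' :=
            mul_le_mul_of_nonneg_right (mul_le_mul hC2 h2 (by linarith) hC0.le) hm'
        _ ≤ _ := mul_le_mul_of_nonneg_left (by linarith) (by positivity)
  intro t ht ρ ρ'
  have h1 := main t ht |ρ| |ρ'| (abs_nonneg _) (abs_nonneg _)
  rw [muSharp_abs, muSharp_abs] at h1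
  have h2 : bracket |ρ'| = bracket ρ' := by simp [bracket]
  rw [h2] at h1
  refine h1.trans ?_
  have hB := bracket_rpow_pos hσ₀ hσ₀' t
  have hm' := muSharp_nonneg δ t ρ'
  have := abs_abs_sub_abs_le_abs_sub ρ ρ'
  gcongr

end GevreyWeights

namespace GevreyWeights

open MeasureTheory

/-! ### Averages -/

/-- Measurable functions with values in `[0, 1]`. -/
structure IsWeight (f : ℝ → ℝ) : Prop where
  measurable : Measurable f
  nonneg : ∀ x, 0 ≤ f x
  le_one : ∀ x, f x ≤ 1

namespace IsCutoff

variable {φ : ℝ → ℝ} (hφ : IsCutoff φ)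
include hφ

theorem continuous : Continuous φ := hφ.smooth.continuous

theorem nonneg (x : ℝ) : 0 ≤ φ x := (hφ.mem_Icc x).1

theorem eq_zero {x : ℝ} (hx : 8 / 5 < |x|) : φ x = 0 := by
  by_contra h
  have := hφ.support_subset h
  rw [Set.mem_Icc, ← abs_le] at this
  linarith

theorem hasCompactSupport : HasCompactSupport φ :=
  HasCompactSupport.of_support_subset_isCompact isCompact_Icc hφ.support_subset

theorem integrable : Integrable φ := hφ.continuous.integrable_of_hasCompactSupport hφ.hasCompactSupport

theorem one_le_integral : 1 ≤ ∫ x, φ x := by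
  have h1 : ∫ x in Set.Icc (-(5 / 4) : ℝ) (5 / 4), φ x ≤ ∫ x, φ x :=
    setIntegral_le_integral hφ.integrable (Filter.Eventually.of_forall hφ.nonneg)
  have h2 : ∫ x in Set.Icc (-(5 / 4) : ℝ) (5 / 4), φ x = 5 / 2 := by
    rw [setIntegral_congr_fun measurableSet_Icc fun x hx => hφ.eq_one x hx]
    simp
    norm_num
  linarith

theorem integral_pos : 0 < ∫ x, φ x := one_pos.trans_le hφ.one_le_integral

theorem integrable_mul {f : ℝ → ℝ} (hf : IsWeight f) {g : ℝ → ℝ} (hg : Measurable g) :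
    Integrable fun y => f (g y) * φ y :=
  hφ.integrable.bdd_mul (c := 1) (hf.measurable.comp hg).aestronglyMeasurable
    (Filter.Eventually.of_forall fun x => by
      rw [Real.norm_of_nonneg (hf.nonneg _)]; exact hf.le_one _)

theorem exists_lipschitz : ∃ K : ℝ, 0 ≤ K ∧ ∀ x y, |φ x - φ y| ≤ K * |x - y| := by
  obtain ⟨K, hK⟩ := hφ.smooth.lipschitzWith_of_hasCompactSupport hφ.hasCompactSupport (by simp)
  exact ⟨K, K.2, fun x y => by simpa [Real.dist_eq] using hK.dist_le_mul x y⟩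

end IsCutoff

section average

variable {φ : ℝ → ℝ} (hφ : IsCutoff φ) {δ' t : ℝ} (hδ' : 0 < δ') (ht : 0 ≤ t)
include hφ hδ' ht

/-- The substitution `ρ = ξ - L y` fixes the kernel and its normalization independently of the
center. A pointwise inequality between corresponding points then passes to averages with different
centers and lengths. -/
theorem average_eq (ξ : ℝ) (f : ℝ → ℝ) :
    average φ δ' t ξ f = (∫ y, f (ξ - avgLength δ' t ξ * y) * φ y) / ∫ x, φ x := by
  have hL := one_pos.trans_le (one_le_avgLength hδ' ht ξ)
  have hd := hφ.integral_pos
  rw [average]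
  set L := avgLength δ' t ξ
  set d := ∫ x, φ x
  rw [← integral_sub_left_eq_self _ volume ξ]
  have e : ∀ ρ, f (ξ - ρ) * (1 / (d * L)) * φ ((ξ - (ξ - ρ)) / L)
      = (fun y => 1 / (d * L) * (f (ξ - L * y) * φ y)) (ρ / L) := by
    intro ρ
    simp only [sub_sub_cancel, mul_div_cancel₀ _ hL.ne']
    ring
  refine (integral_congr_ae (Filter.Eventually.of_forall e)).trans
    ((Measure.integral_comp_div (fun y => 1 / (d * L) * (f (ξ - L * y) * φ y)) L).trans ?_)
  rw [integral_const_mul, abs_of_pos hL, smul_eq_mul]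
  field_simp

theorem average_le {ξ η : ℝ} {f g : ℝ → ℝ} (hf : IsWeight f) (hg : IsWeight g) {A e : ℝ}
    (h : ∀ y, |y| ≤ 8 / 5 → f (ξ - avgLength δ' t ξ * y) ≤ A * g (η - avgLength δ' t η * y) + e) :
    average φ δ' t ξ f ≤ A * average φ δ' t η g + e := by
  have hd := hφ.integral_pos
  rw [average_eq hφ hδ' ht, average_eq hφ hδ' ht, div_le_iff₀ hd, add_mul, mul_assoc,
    div_mul_cancel₀ _ hd.ne', ← integral_const_mul, ← integral_const_mul, ← integral_add]
  · apply integral_mono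
    · exact hφ.integrable_mul hf (by fun_prop)
    · exact ((hφ.integrable_mul hg (by fun_prop)).const_mul A).add (hφ.integrable.const_mul e)
    · intro y
      simp only
      rcases le_or_gt |y| (8 / 5) with hy | hy
      · have := mul_le_mul_of_nonneg_right (h y hy) (hφ.nonneg y)
        linarith
      · rw [hφ.eq_zero hy]; simp
  · exact (hφ.integrable_mul hg (by fun_prop)).const_mul A
  · exact hφ.integrable.const_mul e

theorem average_const (ξ c : ℝ) : average φ δ' t ξ (fun _ => c) = c := by
  rw [average_eq hφ hδ' ht, integral_const_mul, mul_div_cancel_right₀ _ hφ.integral_pos.ne']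

theorem average_nonneg (ξ : ℝ) {f : ℝ → ℝ} (hf : IsWeight f) : 0 ≤ average φ δ' t ξ f := by
  rw [average_eq hφ hδ' ht]
  exact div_nonneg (integral_nonneg fun y => mul_nonneg (hf.nonneg _) (hφ.nonneg y))
    hφ.integral_pos.le

theorem average_le_const {ξ : ℝ} {f : ℝ → ℝ} (hf : IsWeight f) {e : ℝ}
    (h : ∀ ρ, |ρ - ξ| ≤ 8 / 5 * avgLength δ' t ξ → f ρ ≤ e) : average φ δ' t ξ f ≤ e := by
  have hL := one_pos.trans_le (one_le_avgLength hδ' ht ξ)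
  have := average_le hφ hδ' ht (ξ := ξ) (η := ξ) (A := 0) (e := e) hf hf (fun y hy => by
    rw [zero_mul, zero_add]
    apply h
    rw [sub_sub_cancel_left, abs_neg, abs_mul, abs_of_pos hL, mul_comm]
    gcongr)
  simpa using this

theorem const_le_average {ξ : ℝ} {f : ℝ → ℝ} (hf : IsWeight f) {c : ℝ} (hc0 : 0 ≤ c) (hc1 : c ≤ 1)
    (h : ∀ ρ, |ρ - ξ| ≤ 8 / 5 * avgLength δ' t ξ → c ≤ f ρ) : c ≤ average φ δ' t ξ f := by
  have hL := one_pos.trans_le (one_le_avgLength hδ' ht ξ)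
  have := average_le hφ hδ' ht (ξ := ξ) (η := ξ) (f := fun _ => c) (A := 1) (e := 0)
    ⟨measurable_const, fun _ => hc0, fun _ => hc1⟩ hf (fun y hy => by
    rw [one_mul, add_zero]
    apply h
    rw [sub_sub_cancel_left, abs_neg, abs_mul, abs_of_pos hL, mul_comm]
    gcongr)
  rw [average_const hφ hδ' ht] at this
  simpa using this

theorem average_neg (ξ : ℝ) (f : ℝ → ℝ) :
    average φ δ' t (-ξ) (fun ρ => f (-ρ)) = average φ δ' t ξ f := by
  have hL : avgLength δ' t (-ξ) = avgLength δ' t ξ := by simp only [avgLength, bracket_neg]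
  rw [average_eq hφ hδ' ht, average_eq hφ hδ' ht, hL]
  congr 1
  rw [← integral_neg_eq_self]
  congr 1
  ext y
  rw [hφ.even]
  congr 2
  ring

/-- Corresponding points of the two averages. -/
theorem abs_sub_le_of_avgLength (hδ'1 : δ' ≤ 1 / 2) (ξ η : ℝ) {y : ℝ} (hy : |y| ≤ 8 / 5) :
    |(ξ - avgLength δ' t ξ * y) - (η - avgLength δ' t η * y)| ≤ 2 * |ξ - η| := by
  have h1 := abs_avgLength_sub_le hδ' ht ξ η
  have e : (ξ - avgLength δ' t ξ * y) - (η - avgLength δ' t η * y)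
      = (ξ - η) + -((avgLength δ' t ξ - avgLength δ' t η) * y) := by ring
  rw [e]
  refine (abs_add_le _ _).trans ?_
  rw [abs_neg, abs_mul]
  have h2 : |avgLength δ' t ξ - avgLength δ' t η| * |y| ≤ (1 / 2 * |ξ - η|) * (8 / 5) := by
    gcongr
    exact h1.trans (by gcongr)
  linarith [abs_nonneg (ξ - η)]

end average

/-- The dependence of an average on its center, by differentiation of the kernel. -/
theorem exists_abs_average_sub_le {φ : ℝ → ℝ} (hφ : IsCutoff φ) : ∃ K : ℝ, 0 ≤ K ∧
    ∀ δ' t : ℝ, 0 < δ' → δ' ≤ 1 / 2 → 0 ≤ t → ∀ (f : ℝ → ℝ), IsWeight f → ∀ ξ η S : ℝ,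
      |ξ - η| ≤ avgLength δ' t ξ → (∀ ρ, |ρ - ξ| ≤ 6 * avgLength δ' t ξ → f ρ ≤ S) →
      |average φ δ' t ξ f - average φ δ' t η f| ≤ K * (|ξ - η| / avgLength δ' t ξ) * S := by
  obtain ⟨K, hK0, hK⟩ := hφ.exists_lipschitz
  -- `14 K` bounds the effect of the changed argument of the cutoff, `2` that of the changed factor
  -- `1/L`, and `12` comes from the length `12 L` of an interval containing both supports.
  refine ⟨(14 * K + 2) * 12, by positivity, ?_⟩
  intro δ' t hδ' hδ'1 ht f hf ξ η S hξη hS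
  have hL := one_pos.trans_le (one_le_avgLength hδ' ht ξ)
  have hL' := one_pos.trans_le (one_le_avgLength hδ' ht η)
  have hLL := abs_avgLength_sub_le hδ' ht ξ η
  have hd := hφ.one_le_integral
  have hi : ∀ ζ, Integrable fun ρ => f ρ * (1 / ((∫ x : ℝ, φ x) * avgLength δ' t ζ))
      * φ ((ζ - ρ) / avgLength δ' t ζ) := by
    intro ζ
    have hL := one_pos.trans_le (one_le_avgLength hδ' ht ζ)
    have h1 : Integrable fun ρ => φ ((ζ - ρ) / avgLength δ' t ζ) :=
      (hφ.integrable.comp_div hL.ne').comp_sub_left ζ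
    exact h1.bdd_mul (c := 1 / ((∫ x : ℝ, φ x) * avgLength δ' t ζ))
      (hf.measurable.mul_const _).aestronglyMeasurable
      (Filter.Eventually.of_forall fun x => by
        have : 0 < 1 / ((∫ x : ℝ, φ x) * avgLength δ' t ζ) := by positivity
        rw [Real.norm_of_nonneg (mul_nonneg (hf.nonneg _) this.le)]
        exact mul_le_of_le_one_left this.le (hf.le_one _))
  rw [average, average, ← integral_sub (hi ξ) (hi η)]
  set L := avgLength δ' t ξ
  set L' := avgLength δ' t η
  set d := ∫ x, φ x
  set Δ := |ξ - η|
  have hΔ : 0 ≤ Δ := abs_nonneg _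
  have hLL1 : |L - L'| ≤ Δ := hLL.trans (mul_le_of_le_one_left hΔ (by linarith))
  have hLL2 := abs_le.1 (hLL.trans (by gcongr : δ' * Δ ≤ 1 / 2 * L))
  have hS0 : 0 ≤ S := (hf.nonneg ξ).trans (hS ξ (by simp; positivity))
  set c := S * ((14 * K + 2) * (Δ / L ^ 2))
  have hc : 0 ≤ c := by positivity
  have hbound : ∀ ρ, ‖f ρ * (1 / (d * L)) * φ ((ξ - ρ) / L) - f ρ * (1 / (d * L')) * φ ((η - ρ) / L')‖
      ≤ (Set.Icc (ξ - 6 * L) (ξ + 6 * L)).indicator (fun _ => c) ρ := by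
    intro ρ
    by_cases hρ : ρ ∈ Set.Icc (ξ - 6 * L) (ξ + 6 * L)
    · rw [Set.indicator_of_mem hρ]
      have hρ' : |ρ - ξ| ≤ 6 * L := by
        rw [abs_le]; constructor <;> linarith [hρ.1, hρ.2]
      have e : f ρ * (1 / (d * L)) * φ ((ξ - ρ) / L) - f ρ * (1 / (d * L')) * φ ((η - ρ) / L')
          = f ρ * ((1 / d) * ((φ ((ξ - ρ) / L) - φ ((η - ρ) / L')) / L
            + φ ((η - ρ) / L') * (1 / L - 1 / L'))) := by
        field_simp; ring
      rw [e, Real.norm_eq_abs, abs_mul, abs_mul, abs_of_nonneg (hf.nonneg ρ)]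
      have a1 : |(ξ - ρ) / L - (η - ρ) / L'| ≤ 14 * (Δ / L) := by
        have e1 : (ξ - ρ) / L - (η - ρ) / L' = ((ξ - ρ) * (L' - L) + L * (ξ - η)) / (L * L') := by
          field_simp; ring
        rw [e1, abs_div, abs_of_pos (mul_pos hL hL'), div_le_iff₀ (by positivity)]
        have b1 : |(ξ - ρ) * (L' - L) + L * (ξ - η)| ≤ 6 * L * Δ + L * Δ := by
          refine (abs_add_le _ _).trans (add_le_add ?_ ?_)
          · rw [abs_mul, abs_sub_comm ξ, abs_sub_comm L']
            gcongr
          · rw [abs_mul, abs_of_pos hL]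
        have b2 : 14 * (Δ / L) * (L * L') = 14 * Δ * L' := by field_simp
        rw [b2]
        nlinarith
      have a2 : |(φ ((ξ - ρ) / L) - φ ((η - ρ) / L')) / L| ≤ 14 * K * (Δ / L ^ 2) := by
        rw [abs_div, abs_of_pos hL, div_le_iff₀ hL]
        refine (hK _ _).trans ?_
        have : 14 * K * (Δ / L ^ 2) * L = K * (14 * (Δ / L)) := by field_simp
        rw [this]
        gcongr
      have a3 : |φ ((η - ρ) / L') * (1 / L - 1 / L')| ≤ 2 * (Δ / L ^ 2) := by
        rw [abs_mul, abs_of_nonneg (hφ.nonneg _)]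
        refine (mul_le_of_le_one_left (abs_nonneg _) (hφ.mem_Icc _).2).trans ?_
        have e1 : 1 / L - 1 / L' = (L' - L) / (L * L') := by field_simp
        rw [e1, abs_div, abs_of_pos (mul_pos hL hL'), div_le_iff₀ (by positivity), abs_sub_comm]
        have e2 : 2 * (Δ / L ^ 2) * (L * L') = Δ * (2 * L' / L) := by field_simp
        rw [e2]
        refine hLL1.trans (le_mul_of_one_le_right hΔ ?_)
        rw [one_le_div hL]
        linarith
      have a4 : |1 / d| ≤ 1 := by
        rw [abs_of_pos (by positivity), div_le_one (by linarith)]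
        exact hd
      have a5 := (abs_add_le _ _).trans (add_le_add a2 a3)
      calc _ ≤ S * (1 * (14 * K * (Δ / L ^ 2) + 2 * (Δ / L ^ 2))) := by
            gcongr
            exact hS ρ hρ'
        _ = c := by simp only [c]; ring
    · rw [Set.indicator_of_notMem hρ]
      have hρ' : 6 * L < |ρ - ξ| := by
        by_contra hcon
        have := abs_le.1 (not_lt.1 hcon)
        exact hρ ⟨by linarith, by linarith⟩
      have z1 : φ ((ξ - ρ) / L) = 0 := by
        apply hφ.eq_zero
        rw [abs_div, abs_of_pos hL, lt_div_iff₀ hL, abs_sub_comm]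
        linarith
      have z2 : φ ((η - ρ) / L') = 0 := by
        apply hφ.eq_zero
        rw [abs_div, abs_of_pos hL', lt_div_iff₀ hL']
        have h1 : |ρ - ξ| ≤ |η - ρ| + Δ := by
          rw [abs_sub_comm ρ]
          calc |ξ - ρ| = |(η - ρ) + (ξ - η)| := by congr 1; ring
            _ ≤ _ := abs_add_le _ _
        linarith
      rw [z1, z2]; simp
  refine (norm_integral_le_of_norm_le ?_ (Filter.Eventually.of_forall hbound)).trans ?_
  · exact (integrable_indicator_iff measurableSet_Icc).2 (integrableOn_const (by simp))
  · rw [integral_indicator_const _ measurableSet_Icc, Measure.real, Real.volume_Icc,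
      ENNReal.toReal_ofReal (by linarith), smul_eq_mul]
    apply le_of_eq
    simp only [c]
    field_simp
    ring

/-! Measurability. -/

theorem continuous_critTime (i : ℕ) : Continuous (critTime i) := by
  have : critTime i = fun ρ => critTime i 1 * ρ := funext fun ρ => critTime_eq_mul i ρ
  rw [this]
  fun_prop

theorem measurable_logTerm (δ : ℝ) : Measurable (logTerm δ) := by
  unfold logTerm
  fun_prop

theorem measurable_cellLoss (δ₀ δ : ℝ) (i : ℕ) (t : ℝ) :
    Measurable fun ρ => cellLoss δ₀ δ i t ρ := by
  have hl := measurable_logTerm δ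
  obtain ⟨a, ha⟩ : ∃ a, ∀ ρ, critTime i ρ = a * ρ := ⟨_, critTime_eq_mul i⟩
  obtain ⟨b, hb⟩ : ∃ b, ∀ ρ, critTime (i + 1) ρ = b * ρ := ⟨_, critTime_eq_mul (i + 1)⟩
  simp only [cellLoss, ha, hb]
  refine (((hl.comp ?_).sub (hl.comp ?_)).const_mul _).add ((hl.comp ?_).const_mul _)
  all_goals fun_prop

theorem measurable_loss (δ₀ δ : ℝ) (n : ℕ) (k : ℤ) (t : ℝ) :
    Measurable fun ρ => loss δ₀ δ n k t ρ := by
  have hl := measurable_logTerm δ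
  have h1 : Measurable fun ρ => cellSum δ₀ δ n t ρ :=
    Finset.measurable_sum _ fun i _ => measurable_cellLoss δ₀ δ i t
  have h2 : Measurable fun ρ => totalSum δ₀ δ n ρ := by
    refine Finset.measurable_sum _ fun i _ => ?_
    obtain ⟨a, ha⟩ : ∃ a, ∀ ρ, critTime i ρ = a * ρ := ⟨_, critTime_eq_mul i⟩
    obtain ⟨b, hb⟩ : ∃ b, ∀ ρ, critTime (i + 1) ρ = b * ρ := ⟨_, critTime_eq_mul (i + 1)⟩
    change Measurable fun ρ => cellTotal δ₀ δ i ρ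
    simp only [cellTotal, ha, hb]
    refine ((hl.comp ?_).const_mul _).add ((hl.comp ?_).const_mul _)
    all_goals fun_prop
  have h3 : Measurable fun ρ => lowLoss δ₀ δ n t ρ := by
    obtain ⟨a, ha⟩ : ∃ a, ∀ ρ, critTime n ρ = a * ρ := ⟨_, critTime_eq_mul n⟩
    simp only [lowLoss, ha]
    exact Measurable.mul (by fun_prop) (by fun_prop)
  have h4 : Measurable fun ρ => resLoss δ k t ρ := by
    unfold resLoss
    exact measurable_const.max ((hl.comp (by fun_prop)).sub (hl.comp (by fun_prop)))
  unfold loss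
  split_ifs
  · exact (h1.add h3).add h4
  · exact (h1.add h3).add measurable_const

theorem measurable_kZero (δ : ℝ) : Measurable (kZero δ) := by
  unfold kZero
  exact Nat.measurable_floor.comp (by fun_prop)

theorem isWeight_wK {δ₀ δ : ℝ} (h : IsSmall δ₀ δ) (k : ℤ) (t : ℝ) : IsWeight (wK δ₀ δ k t) := by
  refine ⟨?_, fun ρ => (wK_pos h k t ρ).le, wK_le_one h k t⟩
  have h1 : ∀ k : ℤ, Measurable fun ρ => Real.exp (-loss δ₀ δ (kZero δ ρ) k t ρ) := by
    intro k
    -- For frozen `n` the formula is measurable in `ρ`. Since `n` runs through a countable set, it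
    -- is jointly measurable, and the floor can be substituted.
    have h2 : Measurable fun p : ℝ × ℕ => loss δ₀ δ p.2 k t p.1 :=
      measurable_from_prod_countable_left fun n => measurable_loss δ₀ δ n k t
    have h3 : Measurable fun ρ => loss δ₀ δ (kZero δ ρ) k t ρ :=
      Measurable.comp (f := fun ρ => (ρ, kZero δ ρ)) h2 (measurable_id.prodMk (measurable_kZero δ))
    exact h3.neg.exp
  have e : wK δ₀ δ k t = fun ρ => if |ρ| ≤ threshold δ then 1 else if 0 < ρ then
      Real.exp (-loss δ₀ δ (kZero δ ρ) k t ρ) else Real.exp (-loss δ₀ δ (kZero δ (-ρ)) (-k) t (-ρ)) := by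
    ext ρ
    split_ifs with c1 c2
    · rw [wK, if_pos c1]
    · rw [wK_eq_exp_loss h.pos h.le_one]
      rwa [abs_of_pos c2, not_le] at c1
    · rw [← wK_neg _ h.pos, wK_eq_exp_loss h.pos h.le_one]
      rwa [abs_of_nonpos (not_lt.1 c2), not_le] at c1
  rw [e]
  refine Measurable.ite (measurableSet_le (by fun_prop) (by fun_prop)) measurable_const ?_
  exact Measurable.ite (measurableSet_lt (by fun_prop) (by fun_prop)) (h1 k)
    ((h1 (-k)).comp measurable_neg)

theorem isWeight_muSharp {δ₀ δ : ℝ} (h : IsSmall δ₀ δ) (t : ℝ) : IsWeight (muSharp δ t) := by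
  refine ⟨?_, muSharp_nonneg δ t, muSharp_le_one h t⟩
  have h1 : Measurable (critDist t) := by
    refine (LipschitzWith.of_le_add fun x y => ?_).continuous.measurable
    rw [Real.dist_eq, abs_sub_comm]
    exact critDist_le_add t y x
  have h2 : Measurable fun ρ => critTime (kZero δ |ρ|) |ρ| := by
    have h2 : Measurable fun p : ℝ × ℕ => critTime p.2 p.1 :=
      measurable_from_prod_countable_left fun n => (continuous_critTime n).measurable
    exact h2.comp (measurable_norm.prodMk ((measurable_kZero δ).comp measurable_norm))
  have h3 : Measurable fun ρ => critDist t |ρ| := h1.comp measurable_norm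
  have e : muSharp δ t = fun ρ => if |ρ| ≤ threshold δ then 0 else
      if t < critTime (kZero δ |ρ|) |ρ| then δ ^ 2 else
      if t ≤ 2 * |ρ| then δ ^ 2 / (1 + δ ^ 2 * critDist t |ρ|) else 0 := by
    ext ρ
    split_ifs with c1 c2 c3
    · rw [muSharp_of_le c1]
    · rw [← muSharp_abs, muSharp_low h (not_le.1 c1) c2]
    · rw [← muSharp_abs, (muSharp_mid h (not_le.1 c1) (not_lt.1 c2) c3).1]
    · rw [← muSharp_abs, muSharp_late h (not_le.1 c1) (not_le.1 c3)]
  rw [e]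
  refine Measurable.ite (measurableSet_le (by fun_prop) (by fun_prop)) measurable_const ?_
  refine Measurable.ite (measurableSet_lt (by fun_prop) h2) measurable_const ?_
  exact Measurable.ite (measurableSet_le (by fun_prop) (by fun_prop)) (by fun_prop)
    measurable_const

end GevreyWeights

namespace GevreyWeights

/-! ### Global bounds for `b_k`, `μ^*` and `μ_k` -/

/-- The first term of `μ_k(t, ξ)`. -/
noncomputable def decayTerm (σ₀ : ℝ) (k : ℤ) (t ξ : ℝ) : ℝ :=
  √(pairBracket k ξ) / bracket t ^ (1 + σ₀)

/-- The quotient of the exponential weights in `k` and `ξ`, times `b_k(t, ξ)`. -/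
noncomputable def gain (φ : ℝ → ℝ) (δ₀ δ δ' : ℝ) (k : ℤ) (t ξ : ℝ) : ℝ :=
  Real.exp (√δ * (√|(k : ℝ)| - √(bracket ξ))) * bK φ δ₀ δ δ' k t ξ

/-- The second term of `μ_k(t, ξ)`. -/
noncomputable def mainTerm (φ : ℝ → ℝ) (δ₀ δ δ' : ℝ) (k : ℤ) (t ξ : ℝ) : ℝ :=
  muStar φ δ δ' t ξ / (1 + gain φ δ₀ δ δ' k t ξ)

theorem muK_eq (φ : ℝ → ℝ) (σ₀ δ₀ δ δ' : ℝ) (k : ℤ) (t ξ : ℝ) :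
    muK φ σ₀ δ₀ δ δ' k t ξ = decayTerm σ₀ k t ξ + mainTerm φ δ₀ δ δ' k t ξ := rfl

theorem abs_sqrt_bracket_sub_le (ξ η : ℝ) :
    |√(bracket ξ) - √(bracket η)| ≤ √|ξ - η| ∧ |√(bracket ξ) - √(bracket η)| ≤ |ξ - η| := by
  have h1 := abs_bracket_sub_le ξ η
  constructor
  · exact (abs_sqrt_sub_le_sqrt (bracket_pos ξ).le (bracket_pos η).le).trans (Real.sqrt_le_sqrt h1)
  · refine (abs_sqrt_sub_le_div (bracket_pos ξ).le (bracket_pos η)).trans (le_trans ?_ h1)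
    apply div_le_self (abs_nonneg _)
    rw [Real.one_le_sqrt]
    exact one_le_bracket η

section

variable {φ : ℝ → ℝ} {σ₀ δ₀ δ δ' t : ℝ} (hφ : IsCutoff φ) (h : IsSmall δ₀ δ) (hδ' : 0 < δ')
  (hδ'1 : δ' ≤ 1 / 2) (ht : 0 ≤ t)

section decay

variable (hσ₀ : 0 < σ₀) (hσ₀' : σ₀ ≤ 1 / 100)
include hσ₀ hσ₀'

theorem decayTerm_pos (k : ℤ) (t ξ : ℝ) : 0 < decayTerm σ₀ k t ξ :=
  div_pos (Real.sqrt_pos.2 (pairBracket_pos k ξ)) (bracket_rpow_pos hσ₀ hσ₀' t)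

theorem decayTerm_le (k : ℤ) (t ξ η : ℝ) :
    decayTerm σ₀ k t ξ ≤ (1 + |ξ - η|) * decayTerm σ₀ k t η := by
  rw [decayTerm, decayTerm, ← mul_div_assoc]
  have hB := bracket_rpow_pos hσ₀ hσ₀' t
  have h1 := (abs_le.1 (abs_pairBracket_sub_le k ξ η)).2
  have h2 := one_le_pairBracket k η
  have h3 := abs_nonneg (ξ - η)
  gcongr
  rw [Real.sqrt_le_left (by positivity), mul_pow, Real.sq_sqrt (by linarith)]
  nlinarith [mul_nonneg h3 (show 0 ≤ pairBracket k η by linarith), sq_nonneg (|ξ - η|)]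

theorem abs_decayTerm_sub_le (k : ℤ) (t ξ η : ℝ) :
    |decayTerm σ₀ k t ξ - decayTerm σ₀ k t η| ≤ |ξ - η| / pairBracket k η * decayTerm σ₀ k t η := by
  have hB := bracket_rpow_pos hσ₀ hσ₀' t
  have hp := pairBracket_pos k η
  rw [decayTerm, decayTerm, ← sub_div, abs_div, abs_of_pos hB, ← mul_div_assoc]
  gcongr
  refine (abs_sqrt_sub_le_div (pairBracket_pos k ξ).le hp).trans ?_
  have := abs_pairBracket_sub_le k ξ η
  rw [div_mul_eq_mul_div, div_le_div_iff₀ (Real.sqrt_pos.2 hp) hp, mul_assoc,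
    Real.mul_self_sqrt hp.le]
  gcongr

theorem le_decayTerm (k : ℤ) (t ξ : ℝ) :
    √(bracket ξ) / bracket t ^ (1 + σ₀) ≤ decayTerm σ₀ k t ξ := by
  have hB := bracket_rpow_pos hσ₀ hσ₀' t
  rw [decayTerm]
  gcongr
  exact bracket_le_pairBracket k ξ

end decay

section window

include hδ' hδ'1 ht

theorem avgLength_le_bracket (ξ : ℝ) : avgLength δ' t ξ ≤ 1 + √(bracket ξ) / 2 := by
  refine (avgLength_le hδ' ht ξ).trans ?_
  have := Real.sqrt_nonneg (bracket ξ)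
  nlinarith

theorem abs_le_of_window {ξ ρ : ℝ} (hρ : |ρ - ξ| ≤ 8 / 5 * avgLength δ' t ξ) :
    |ρ| ≤ 4 * bracket ξ := by
  have h1 := avgLength_le_bracket hδ' hδ'1 ht ξ
  have h2 := one_le_bracket ξ
  have h3 : √(bracket ξ) ≤ bracket ξ := by
    rw [Real.sqrt_le_left (by linarith)]
    nlinarith
  have h4 := abs_le_bracket ξ
  have h5 : |ρ| ≤ |ρ - ξ| + |ξ| := by
    calc |ρ| = |(ρ - ξ) + ξ| := by congr 1; ring
      _ ≤ _ := abs_add_le _ _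
  linarith

end window

include hφ h hδ' ht

theorem muStar_nonneg (ξ : ℝ) : 0 ≤ muStar φ δ δ' t ξ :=
  average_nonneg hφ hδ' ht ξ (isWeight_muSharp h t)

theorem muStar_le_one (ξ : ℝ) : muStar φ δ δ' t ξ ≤ 1 :=
  average_le_const hφ hδ' ht (isWeight_muSharp h t) fun ρ _ => muSharp_le_one h t ρ

include hδ'1

theorem exp_le_bK (k : ℤ) (ξ : ℝ) :
    Real.exp (-(4 * δ * √(bracket ξ))) ≤ bK φ δ₀ δ δ' k t ξ := by
  have hδ := h.pos
  apply const_le_average hφ hδ' ht (isWeight_wK h k t) (Real.exp_pos _).le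
  · apply Real.exp_le_one_iff.2
    have : 0 ≤ 4 * δ * √(bracket ξ) := by positivity
    linarith
  · intro ρ hρ
    refine le_trans (Real.exp_le_exp.2 ?_) (exp_le_wK h k ht ρ)
    have h1 := abs_le_of_window hδ' hδ'1 ht hρ
    have h2 : √|ρ| ≤ 2 * √(bracket ξ) := by
      rw [Real.sqrt_le_left (by positivity), mul_pow, Real.sq_sqrt (bracket_pos _).le]
      linarith
    nlinarith

theorem bK_pos (k : ℤ) (ξ : ℝ) : 0 < bK φ δ₀ δ δ' k t ξ :=
  (Real.exp_pos _).trans_le (exp_le_bK hφ h hδ' hδ'1 ht k ξ)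

theorem gain_pos (k : ℤ) (ξ : ℝ) : 0 < gain φ δ₀ δ δ' k t ξ :=
  mul_pos (Real.exp_pos _) (bK_pos hφ h hδ' hδ'1 ht k ξ)

theorem mainTerm_nonneg (k : ℤ) (ξ : ℝ) : 0 ≤ mainTerm φ δ₀ δ δ' k t ξ := by
  have := gain_pos hφ h hδ' hδ'1 ht k ξ
  exact div_nonneg (muStar_nonneg hφ h hδ' ht ξ) (by linarith)

theorem mainTerm_le_muStar (k : ℤ) (ξ : ℝ) :
    mainTerm φ δ₀ δ δ' k t ξ ≤ muStar φ δ δ' t ξ := by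
  have := gain_pos hφ h hδ' hδ'1 ht k ξ
  exact div_le_self (muStar_nonneg hφ h hδ' ht ξ) (by linarith)

theorem gain_le_of_bK {k : ℤ} {ξ η A : ℝ} (hA : bK φ δ₀ δ δ' k t η ≤ A * bK φ δ₀ δ δ' k t ξ)
    {z : ℝ} (hz : √δ * |√(bracket ξ) - √(bracket η)| ≤ z) :
    gain φ δ₀ δ δ' k t η ≤ A * Real.exp z * gain φ δ₀ δ δ' k t ξ := by
  have hb := bK_pos hφ h hδ' hδ'1 ht k η
  have hs := h.sqrt_pos
  rw [gain, gain]
  have h1 : Real.exp (√δ * (√|(k : ℝ)| - √(bracket η)))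
      ≤ Real.exp z * Real.exp (√δ * (√|(k : ℝ)| - √(bracket ξ))) := by
    rw [← Real.exp_add]
    apply Real.exp_le_exp.2
    have := mul_le_mul_of_nonneg_left (le_abs_self (√(bracket ξ) - √(bracket η))) hs.le
    linarith
  calc _ ≤ (Real.exp z * Real.exp (√δ * (√|(k : ℝ)| - √(bracket ξ))))
        * (A * bK φ δ₀ δ δ' k t ξ) := by gcongr
    _ = _ := by ring

theorem muStar_eq_zero {ξ : ℝ} (hlate : ∀ ρ, |ρ - ξ| ≤ 8 / 5 * avgLength δ' t ξ → 2 * |ρ| < t) :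
    muStar φ δ δ' t ξ = 0 := by
  apply le_antisymm _ (muStar_nonneg hφ h hδ' ht ξ)
  apply average_le_const hφ hδ' ht (isWeight_muSharp h t)
  intro ρ hρ
  rcases le_or_gt |ρ| (threshold δ) with h1 | h1
  · rw [muSharp_of_le h1]
  · rw [← muSharp_abs, muSharp_late h h1 (hlate ρ hρ)]

end

section global

variable {φ : ℝ → ℝ} (hφ : IsCutoff φ) {δ₀ δ : ℝ} (h : IsSmall δ₀ δ) {δ' : ℝ} (hδ' : 0 < δ')
  (hδ'1 : δ' ≤ 1 / 2)
include hφ h hδ' hδ'1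

theorem bK_le_mul_exp_sqrt : ∃ C : ℝ, 1 ≤ C ∧ ∀ (k : ℤ) (t : ℝ), 0 ≤ t → ∀ ξ η : ℝ,
    bK φ δ₀ δ δ' k t η ≤ C * Real.exp (√δ / 10 * √|ξ - η|) * bK φ δ₀ δ δ' k t ξ := by
  obtain ⟨C, hC, hw⟩ := wK_le_mul_exp_sqrt h
  refine ⟨C, hC, fun k t ht ξ η => ?_⟩
  have := average_le hφ hδ' ht (ξ := η) (η := ξ) (f := wK δ₀ δ k t) (g := wK δ₀ δ k t)
    (isWeight_wK h k t) (isWeight_wK h k t) (A := C * Real.exp (√δ / 10 * √|ξ - η|)) (e := 0)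
    (fun y hy => by
      have h1 := abs_sub_le_of_avgLength hφ hδ' ht hδ'1 ξ η hy
      refine (hw k t ht (ξ - avgLength δ' t ξ * y) _).trans ?_
      have h2 : √δ / 20 * √|(ξ - avgLength δ' t ξ * y) - (η - avgLength δ' t η * y)|
          ≤ √δ / 10 * √|ξ - η| := by
        have : √|(ξ - avgLength δ' t ξ * y) - (η - avgLength δ' t η * y)| ≤ 2 * √|ξ - η| := by
          rw [Real.sqrt_le_left (by positivity), mul_pow, Real.sq_sqrt (abs_nonneg _)]
          linarith [abs_nonneg (ξ - η)]
        nlinarith [h.sqrt_pos]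
      have h3 := (wK_pos h k t (ξ - avgLength δ' t ξ * y)).le
      have h4 := Real.exp_le_exp.2 h2
      calc _ ≤ C * (wK δ₀ δ k t (ξ - avgLength δ' t ξ * y) * Real.exp (√δ / 10 * √|ξ - η|)) := by
            gcongr
        _ = _ := by ring)
  rwa [add_zero] at this

theorem muStar_le_mul {σ₀ : ℝ} (hσ₀ : 0 < σ₀) (hσ₀' : σ₀ ≤ 1 / 100) :
    ∃ C : ℝ, 1 ≤ C ∧ ∀ t : ℝ, 0 ≤ t → ∀ ξ η : ℝ,
      muStar φ δ δ' t ξ ≤ C * (1 + |ξ - η|) ^ 2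
        * (muStar φ δ δ' t η + √(bracket η) / bracket t ^ (1 + σ₀)) := by
  obtain ⟨C, hC, hm⟩ := muSharp_le_mul h hσ₀ hσ₀'
  -- Doubling the distance between corresponding points costs `4`, and replacing `√⟨ρ⟩` on the
  -- window of `η` by `√⟨η⟩` costs `3`.
  refine ⟨12 * C, by linarith, fun t ht ξ η => ?_⟩
  have hB := bracket_rpow_pos hσ₀ hσ₀' t
  have hΔ := abs_nonneg (ξ - η)
  have hA : 0 ≤ √(bracket η) / bracket t ^ (1 + σ₀) := by positivity
  have := average_le hφ hδ' ht (ξ := ξ) (η := η) (f := muSharp δ t) (g := muSharp δ t)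
    (isWeight_muSharp h t) (isWeight_muSharp h t) (A := 4 * C * (1 + |ξ - η|) ^ 2)
    (e := 12 * C * (1 + |ξ - η|) ^ 2 * (√(bracket η) / bracket t ^ (1 + σ₀)))
    (fun y hy => by
      have h1 := abs_sub_le_of_avgLength hφ hδ' ht hδ'1 ξ η hy
      refine (hm t ht _ (η - avgLength δ' t η * y)).trans ?_
      have hL := one_pos.trans_le (one_le_avgLength hδ' ht η)
      have h2 := abs_le_of_window hδ' hδ'1 ht (ξ := η) (ρ := η - avgLength δ' t η * y) (by
        rw [sub_sub_cancel_left, abs_neg, abs_mul, abs_of_pos hL, mul_comm]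
        gcongr)
      have h3 := bracket_le (η - avgLength δ' t η * y)
      have h4 := one_le_bracket η
      have h5 : √(bracket (η - avgLength δ' t η * y)) ≤ 3 * √(bracket η) := by
        rw [Real.sqrt_le_left (by positivity), mul_pow, Real.sq_sqrt (bracket_pos _).le]
        linarith
      have h6 := muSharp_nonneg δ t (η - avgLength δ' t η * y)
      have h7 : (1 + |ξ - avgLength δ' t ξ * y - (η - avgLength δ' t η * y)|) ^ 2
          ≤ 4 * (1 + |ξ - η|) ^ 2 := by
        rw [show (4 : ℝ) = 2 ^ 2 by norm_num, ← mul_pow]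
        gcongr
        linarith
      calc _ ≤ C * (4 * (1 + |ξ - η|) ^ 2) * (muSharp δ t (η - avgLength δ' t η * y)
            + 3 * √(bracket η) / bracket t ^ (1 + σ₀)) := by gcongr
        _ = _ := by ring)
  refine this.trans ?_
  have h1 := muStar_nonneg hφ h hδ' ht η
  have h2 : 0 ≤ C * (1 + |ξ - η|) ^ 2 * muStar φ δ δ' t η := by positivity
  rw [← muStar]
  linarith

theorem one_div_le_of_gain_le {t : ℝ} (ht : 0 ≤ t) {k : ℤ} {ξ η A : ℝ} (hA : 1 ≤ A)
    (hg : gain φ δ₀ δ δ' k t η ≤ A * gain φ δ₀ δ δ' k t ξ) {x : ℝ} (hx : 0 ≤ x) :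
    x / (1 + gain φ δ₀ δ δ' k t ξ) ≤ A * (x / (1 + gain φ δ₀ δ δ' k t η)) := by
  have h1 := gain_pos hφ h hδ' hδ'1 ht k ξ
  have h2 := gain_pos hφ h hδ' hδ'1 ht k η
  rw [← mul_div_assoc, div_le_div_iff₀ (by linarith) (by linarith), mul_right_comm, mul_comm,
    mul_right_comm]
  nlinarith

/-- In units of `√δ |ξ-η|^{1/2}` the exponents are: `1` from `e^{√δ√⟨ξ⟩}`, `1/10` from `b_k`, and
`1/2` reserved for absorbing the polynomial loss of `μ^*`. Their sum is below `2`. The decay term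
produced by the comparison of `μ^*` is part of `μ_k(t, η)`. -/
theorem muK_le_mul_exp_sqrt {σ₀ : ℝ} (hσ₀ : 0 < σ₀) (hσ₀' : σ₀ ≤ 1 / 100) :
    ∃ C : ℝ, 1 ≤ C ∧ ∀ (k : ℤ) (t : ℝ), 0 ≤ t → ∀ ξ η : ℝ,
      muK φ σ₀ δ₀ δ δ' k t ξ
        ≤ C * (muK φ σ₀ δ₀ δ δ' k t η * Real.exp (2 * √δ * √|ξ - η|)) := by
  obtain ⟨C₁, hC₁, hb⟩ := bK_le_mul_exp_sqrt hφ h hδ' hδ'1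
  obtain ⟨C₂, hC₂, hm⟩ := muStar_le_mul hφ h hδ' hδ'1 hσ₀ hσ₀'
  have hs := h.sqrt_pos
  set C₃ := 2 + 48 / (√δ / 2) ^ 4
  have hC₃ : 1 ≤ C₃ := by
    have : 0 ≤ 48 / (√δ / 2) ^ 4 := by positivity
    linarith
  refine ⟨(1 + C₂ * C₁) * C₃, ?_, ?_⟩
  · have : 1 * 1 ≤ C₂ * C₁ := by gcongr
    nlinarith
  intro k t ht ξ η
  rw [muK_eq, muK_eq]
  have hΔ := abs_nonneg (ξ - η)
  have a1 := decayTerm_le hσ₀ hσ₀' k t ξ η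
  have a0 := (decayTerm_pos hσ₀ hσ₀' k t η).le
  have b0 := mainTerm_nonneg hφ h hδ' hδ'1 ht k η
  have hg := gain_le_of_bK hφ h hδ' hδ'1 ht (hb k t ht ξ η)
    (mul_le_mul_of_nonneg_left (abs_sqrt_bracket_sub_le ξ η).1 hs.le)
  set z := √δ * √|ξ - η|
  have hz : 0 ≤ z := by positivity
  have e1 : C₁ * Real.exp (√δ / 10 * √|ξ - η|) * Real.exp z = C₁ * Real.exp (11 / 10 * z) := by
    rw [mul_assoc, ← Real.exp_add]
    congr 2
    simp only [z]; ring
  rw [e1] at hg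
  have hexp1 : 1 ≤ Real.exp (11 / 10 * z) := Real.one_le_exp (by positivity)
  have hA : 1 ≤ C₁ * Real.exp (11 / 10 * z) := by nlinarith
  have b1 := one_div_le_of_gain_le hφ h hδ' hδ'1 ht hA hg (muStar_nonneg hφ h hδ' ht ξ)
  rw [← mainTerm] at b1
  have hgη := gain_pos hφ h hδ' hδ'1 ht k η
  have b2 : muStar φ δ δ' t ξ / (1 + gain φ δ₀ δ δ' k t η)
      ≤ C₂ * (1 + |ξ - η|) ^ 2 * (decayTerm σ₀ k t η + mainTerm φ δ₀ δ δ' k t η) := by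
    have hd : √(bracket η) / bracket t ^ (1 + σ₀) / (1 + gain φ δ₀ δ δ' k t η)
        ≤ decayTerm σ₀ k t η :=
      (div_le_self (div_nonneg (Real.sqrt_nonneg _) (bracket_rpow_pos hσ₀ hσ₀' t).le)
        (by linarith)).trans (le_decayTerm hσ₀ hσ₀' k t η)
    calc _ ≤ C₂ * (1 + |ξ - η|) ^ 2
          * (muStar φ δ δ' t η + √(bracket η) / bracket t ^ (1 + σ₀))
            / (1 + gain φ δ₀ δ δ' k t η) := by
          gcongr
          exact hm t ht ξ η
      _ = C₂ * (1 + |ξ - η|) ^ 2 * (√(bracket η) / bracket t ^ (1 + σ₀)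
            / (1 + gain φ δ₀ δ δ' k t η) + mainTerm φ δ₀ δ δ' k t η) := by
          rw [mainTerm]; ring
      _ ≤ _ := by gcongr
  have c1 : (1 + |ξ - η|) ^ 2 ≤ C₃ * Real.exp (1 / 2 * z) := by
    have := one_add_sq_le_exp (show 0 < √δ / 2 by positivity) hΔ
    refine this.trans_eq ?_
    congr 2
    simp only [z]; ring
  have hM : 0 ≤ decayTerm σ₀ k t η + mainTerm φ δ₀ δ δ' k t η := by linarith
  calc decayTerm σ₀ k t ξ + mainTerm φ δ₀ δ δ' k t ξ
      ≤ (1 + |ξ - η|) ^ 2 * (decayTerm σ₀ k t η + mainTerm φ δ₀ δ δ' k t η)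
        + C₁ * Real.exp (11 / 10 * z) * (C₂ * (1 + |ξ - η|) ^ 2
          * (decayTerm σ₀ k t η + mainTerm φ δ₀ δ δ' k t η)) := by
        apply add_le_add
        · refine a1.trans ?_
          gcongr
          · nlinarith
          · linarith
        · exact b1.trans (by gcongr)
    _ = (1 + C₂ * C₁ * Real.exp (11 / 10 * z)) * (1 + |ξ - η|) ^ 2
          * (decayTerm σ₀ k t η + mainTerm φ δ₀ δ δ' k t η) := by ring
    _ ≤ ((1 + C₂ * C₁) * Real.exp (11 / 10 * z)) * (C₃ * Real.exp (1 / 2 * z))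
          * (decayTerm σ₀ k t η + mainTerm φ δ₀ δ δ' k t η) := by
        gcongr
        nlinarith
    _ = (1 + C₂ * C₁) * C₃ * ((decayTerm σ₀ k t η + mainTerm φ δ₀ δ δ' k t η)
          * Real.exp (11 / 10 * z + 1 / 2 * z)) := by rw [Real.exp_add]; ring
    _ ≤ _ := by
        gcongr
        simp only [z]
        nlinarith

/-- The bound for `μ_k` by `μ_R`, for frequencies that are not comparable. -/
theorem muK_add_le_muR {σ₀ : ℝ} (hσ₀ : 0 < σ₀) (hσ₀' : σ₀ ≤ 1 / 100) :
    ∃ C : ℝ, 1 ≤ C ∧ ∀ (k : ℤ) (t : ℝ), 0 ≤ t → ∀ ξ η : ℝ,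
      pairBracket k η / 100 ≤ bracket (ξ - η) →
      muK φ σ₀ δ₀ δ δ' k t ξ + muK φ σ₀ δ₀ δ δ' k t η
        ≤ C * (muR φ σ₀ δ δ' t (ξ - η) * Real.exp (4 * √δ * √(pairNorm k η))) := by
  obtain ⟨C₂, hC₂, hm⟩ := muStar_le_mul hφ h hδ' hδ'1 hσ₀ hσ₀'
  have hs := h.sqrt_pos
  set C₃ := 2 + 48 / (√δ) ^ 4
  have hC₃ : 1 ≤ C₃ := by
    have : 0 ≤ 48 / (√δ) ^ 4 := by positivity
    linarith
  refine ⟨(22 + 2 * C₂) * C₃, by nlinarith, ?_⟩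
  intro k t ht ξ η hle
  have hB := bracket_rpow_pos hσ₀ hσ₀' t
  have hm0 := muStar_nonneg hφ h hδ' ht (ξ - η)
  have hR0 : 0 ≤ √(bracket (ξ - η)) / bracket t ^ (1 + σ₀) := by positivity
  have hR : 0 ≤ muR φ σ₀ δ δ' t (ξ - η) := add_nonneg hR0 hm0
  -- Both frequencies are covered: `⟨k,η⟩ ≤ 100⟨ξ-η⟩` and `⟨k,ξ⟩ ≤ 101⟨ξ-η⟩`. The number `121` is a
  -- convenient square above these.
  have hdec : ∀ ζ, pairBracket k ζ ≤ 121 * bracket (ξ - η) →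
      decayTerm σ₀ k t ζ ≤ 11 * muR φ σ₀ δ δ' t (ξ - η) := by
    intro ζ hζ
    have h1 : √(pairBracket k ζ) ≤ 11 * √(bracket (ξ - η)) := by
      rw [Real.sqrt_le_left (by positivity), mul_pow, Real.sq_sqrt (bracket_pos _).le]
      linarith
    calc decayTerm σ₀ k t ζ ≤ 11 * √(bracket (ξ - η)) / bracket t ^ (1 + σ₀) := by
          rw [decayTerm]; gcongr
      _ = 11 * (√(bracket (ξ - η)) / bracket t ^ (1 + σ₀)) := by ring
      _ ≤ _ := by
          rw [muR]
          linarith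
  have hb0 := bracket_pos (ξ - η)
  have d1 := hdec η (by linarith)
  have d2 := hdec ξ (by
    have := (abs_le.1 (abs_pairBracket_sub_le k ξ η)).2
    have := abs_le_bracket (ξ - η)
    linarith)
  have hη := abs_nonneg η
  have m1 : muStar φ δ δ' t ξ ≤ C₂ * (1 + |η|) ^ 2 * muR φ σ₀ δ δ' t (ξ - η) := by
    have := hm t ht ξ (ξ - η)
    rw [sub_sub_cancel, add_comm (muStar φ δ δ' t (ξ - η))] at this
    exact this
  -- Comparison with the frequency `0`: its window lies below the threshold, so `μ^*` vanishes there
  -- and only `⟨t⟩^{-1-σ₀}` is left, which the first term of `μ_R` dominates.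
  have m2 : muStar φ δ δ' t η ≤ C₂ * (1 + |η|) ^ 2 * muR φ σ₀ δ δ' t (ξ - η) := by
    have h1 := hm t ht η 0
    have hz : muStar φ δ δ' t 0 = 0 := by
      apply le_antisymm _ (muStar_nonneg hφ h hδ' ht 0)
      apply average_le_const hφ hδ' ht (isWeight_muSharp h t)
      intro ρ hρ
      have h2 := abs_le_of_window hδ' hδ'1 ht hρ
      have h3 : bracket 0 = 1 := by simp [bracket]
      rw [h3] at h2
      rw [muSharp_of_le]
      refine h2.trans ?_
      rw [threshold, le_inv_comm₀ (by norm_num) (pow_pos h.pos 10)]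
      calc δ ^ 10 ≤ δ ^ 1 := pow_le_pow_of_le_one h.pos.le h.le_one (by norm_num)
        _ ≤ _ := by
          rw [pow_one]
          exact h.le_div.trans (by norm_num)
    have h3 : √(bracket 0) = 1 := by simp [bracket]
    rw [hz, h3, sub_zero, zero_add] at h1
    refine h1.trans ?_
    gcongr
    refine le_trans ?_ (le_add_of_nonneg_right hm0)
    gcongr
    rw [Real.one_le_sqrt]
    exact one_le_bracket _
  have t1 := mainTerm_le_muStar hφ h hδ' hδ'1 ht k ξ
  have t2 := mainTerm_le_muStar hφ h hδ' hδ'1 ht k η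
  have c1 : (1 + |η|) ^ 2 ≤ C₃ * Real.exp (4 * √δ * √(pairNorm k η)) := by
    refine (one_add_sq_le_exp hs hη).trans ?_
    have h1 := abs_le_pairNorm k η
    gcongr
    linarith
  have c2 : 1 ≤ (1 + |η|) ^ 2 := by nlinarith
  rw [muK_eq, muK_eq]
  calc _ ≤ (22 + 2 * C₂ * (1 + |η|) ^ 2) * muR φ σ₀ δ δ' t (ξ - η) := by linarith
    _ ≤ ((22 + 2 * C₂) * (1 + |η|) ^ 2) * muR φ σ₀ δ δ' t (ξ - η) := by
        gcongr
        nlinarith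
    _ ≤ ((22 + 2 * C₂) * (C₃ * Real.exp (4 * √δ * √(pairNorm k η))))
          * muR φ σ₀ δ δ' t (ξ - η) := by gcongr
    _ = _ := by ring

/-- The main term is negligible for large `k`. -/
theorem mainTerm_le_decayTerm {σ₀ : ℝ} (hσ₀ : 0 < σ₀) (hσ₀' : σ₀ ≤ 1 / 100) :
    ∃ C : ℝ, 1 ≤ C ∧ ∀ (k : ℤ) (t : ℝ), 0 ≤ t → ∀ ξ : ℝ, 3 * bracket ξ ≤ |(k : ℝ)| →
      mainTerm φ δ₀ δ δ' k t ξ ≤ C * (decayTerm σ₀ k t ξ / pairBracket k ξ) := by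
  have hs := h.sqrt_pos
  have hδ := h.pos
  set C := 2 + 48 / (√δ / 8) ^ 4
  have hC : 1 ≤ C := by
    have : 0 ≤ 48 / (√δ / 8) ^ 4 := by positivity
    linarith
  refine ⟨32 * C ^ 2, by nlinarith, ?_⟩
  intro k t ht ξ hk
  have hb := one_le_bracket ξ
  have hA := decayTerm_pos hσ₀ hσ₀' k t ξ
  have hp := one_le_pairBracket k ξ
  have hp0 := pairBracket_pos k ξ
  -- After time `8⟨ξ⟩` every frequency of the window is past its cutoff, and the main term is zero.
  -- Before it, `⟨t⟩ ≲ |k|` bounds the decay term below by a power of `|k|`.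
  rcases lt_or_ge (8 * bracket ξ) t with hlt | hle
  · rw [mainTerm, muStar_eq_zero hφ h hδ' hδ'1 ht, zero_div]
    · positivity
    · intro ρ hρ
      have := abs_le_of_window hδ' hδ'1 ht hρ
      linarith
  have hy3 : 3 ≤ |(k : ℝ)| := by linarith
  have hp2 := pairBracket_le k ξ
  set y := |(k : ℝ)| with hy
  have hy0 : 0 < y := by linarith
  have hA2 : 1 / (16 * y ^ 2) ≤ decayTerm σ₀ k t ξ := by
    rw [decayTerm, div_le_div_iff₀ (by positivity) (bracket_rpow_pos hσ₀ hσ₀' t), one_mul]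
    have h1 : 1 ≤ √(pairBracket k ξ) := by rwa [Real.one_le_sqrt]
    have h2 : bracket t ≤ 4 * y := by
      have := bracket_le t
      rw [abs_of_nonneg ht] at this
      linarith
    have h3 := bracket_pos t
    calc _ ≤ bracket t ^ 2 := bracket_rpow_le_sq hσ₀ hσ₀' t
      _ ≤ (4 * y) ^ 2 := by gcongr
      _ = 1 * (16 * y ^ 2) := by ring
      _ ≤ _ := by gcongr
  -- From `3⟨ξ⟩ ≤ |k|` one gets `√⟨ξ⟩ ≤ (3/5)√|k|`, so the exponent is at least `(2/5)√δ√|k|`. The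
  -- possible smallness of `b_k` costs only `O(δ√|k|)`.
  have hgain : Real.exp (√δ / 4 * √y) ≤ gain φ δ₀ δ δ' k t ξ := by
    have h1 := exp_le_bK hφ h hδ' hδ'1 ht k ξ
    rw [gain]
    refine le_trans ?_ (mul_le_mul_of_nonneg_left h1 (Real.exp_pos _).le)
    rw [← Real.exp_add]
    apply Real.exp_le_exp.2
    rw [← hy]
    have h2 : √(bracket ξ) ≤ 3 / 5 * √y := by
      rw [Real.sqrt_le_left (by positivity), mul_pow, Real.sq_sqrt hy0.le]
      linarith
    have h3 := h.le_sqrt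
    have h4 : 4 * δ * √(bracket ξ) ≤ 4 * (√δ / 10 ^ 4) * (3 / 5 * √y) := by
      gcongr
      linarith
    have h5 : √δ * √(bracket ξ) ≤ √δ * (3 / 5 * √y) := by gcongr
    have h6 : 0 ≤ √δ * √y := by positivity
    nlinarith
  have hpow : (1 + y) ^ 4 ≤ C ^ 2 * Real.exp (√δ / 4 * √y) := by
    have h1 := one_add_sq_le_exp (show 0 < √δ / 8 by positivity) hy0.le
    calc (1 + y) ^ 4 = ((1 + y) ^ 2) ^ 2 := by ring
      _ ≤ (C * Real.exp (√δ / 8 * √y)) ^ 2 := by gcongr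
      _ = C ^ 2 * Real.exp (√δ / 4 * √y) := by
        rw [mul_pow, ← Real.exp_nat_mul]
        congr 2
        push_cast; ring
  have hm := muStar_le_one hφ h hδ' ht ξ
  have hg0 := gain_pos hφ h hδ' hδ'1 ht k ξ
  have f1 : mainTerm φ δ₀ δ δ' k t ξ ≤ C ^ 2 / (1 + y) ^ 4 := by
    rw [mainTerm, div_le_div_iff₀ (by linarith) (by positivity)]
    calc _ ≤ 1 * (C ^ 2 * Real.exp (√δ / 4 * √y)) := by
          gcongr
      _ ≤ C ^ 2 * (1 + gain φ δ₀ δ δ' k t ξ) := by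
          rw [one_mul]
          gcongr
          linarith
  refine f1.trans ?_
  have f2 : 1 / (16 * y ^ 2) / (2 * y) ≤ decayTerm σ₀ k t ξ / pairBracket k ξ := by
    gcongr
    linarith
  have f3 : C ^ 2 / (1 + y) ^ 4 ≤ 32 * C ^ 2 * (1 / (16 * y ^ 2) / (2 * y)) := by
    have e : 32 * C ^ 2 * (1 / (16 * y ^ 2) / (2 * y)) = C ^ 2 / y ^ 3 := by field_simp; norm_num
    rw [e]
    gcongr
    calc y ^ 3 ≤ (1 + y) ^ 3 := by gcongr; linarith
      _ ≤ (1 + y) ^ 4 := pow_le_pow_right₀ (by linarith) (by norm_num)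
  exact f3.trans (by gcongr)

end global

end GevreyWeights

namespace GevreyWeights

/-! ### Differences of the main term -/

section difference

variable {φ : ℝ → ℝ} (hφ : IsCutoff φ) {δ₀ δ : ℝ} (h : IsSmall δ₀ δ) {δ' : ℝ} (hδ' : 0 < δ')
  (hδ'1 : δ' ≤ 1 / 2) {t : ℝ} (ht : 0 ≤ t)
include hφ h hδ' hδ'1 ht

theorem abs_gain_sub_le {k : ℤ} {ξ η κ z : ℝ}
    (hκ : |bK φ δ₀ δ δ' k t ξ - bK φ δ₀ δ δ' k t η| ≤ κ * bK φ δ₀ δ δ' k t ξ)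
    (hz : √δ * |√(bracket ξ) - √(bracket η)| ≤ z) :
    |gain φ δ₀ δ δ' k t η - gain φ δ₀ δ δ' k t ξ|
      ≤ Real.exp z * (κ + z) * gain φ δ₀ δ δ' k t ξ := by
  have hb := bK_pos hφ h hδ' hδ'1 ht k ξ
  have hs := h.sqrt_pos
  have hx : |√δ * (√(bracket ξ) - √(bracket η))| ≤ z := by rwa [abs_mul, abs_of_pos hs]
  have e : Real.exp (√δ * (√|(k : ℝ)| - √(bracket η)))
      = Real.exp (√δ * (√|(k : ℝ)| - √(bracket ξ)))
        * Real.exp (√δ * (√(bracket ξ) - √(bracket η))) := by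
    rw [← Real.exp_add]; congr 1; ring
  have h1 := exp_sub_one_le hx
  have h2 : Real.exp (√δ * (√(bracket ξ) - √(bracket η))) ≤ Real.exp z :=
    Real.exp_le_exp.2 ((le_abs_self _).trans hx)
  rw [gain, gain, e]
  set E := Real.exp (√δ * (√|(k : ℝ)| - √(bracket ξ)))
  set F := Real.exp (√δ * (√(bracket ξ) - √(bracket η)))
  have hE : 0 < E := Real.exp_pos _
  have hF : 0 < F := Real.exp_pos _
  set b := bK φ δ₀ δ δ' k t ξ
  set b' := bK φ δ₀ δ δ' k t η
  have e2 : E * F * b' - E * b = E * (F * (b' - b) + (F - 1) * b) := by ring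
  rw [e2, abs_mul, abs_of_pos hE]
  calc _ ≤ E * (F * |b' - b| + |F - 1| * b) := by
        gcongr
        refine (abs_add_le _ _).trans_eq ?_
        rw [abs_mul, abs_mul, abs_of_pos hF, abs_of_pos hb]
    _ ≤ E * (Real.exp z * (κ * b) + z * Real.exp z * b) := by
        rw [abs_sub_comm b' b]
        gcongr
    _ = _ := by ring

/-- Quotient rule for `a/(1+B)` with the main term at `η` factored out. The relative change of `1+B`
is at most that of `B`, which has one part from `b_k` and one from the exponential; `A` bounds the
ratio of the values of `b_k`. -/
theorem abs_mainTerm_sub_le {k : ℤ} {ξ η A κ z u v : ℝ} (hA1 : 1 ≤ A)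
    (hA : bK φ δ₀ δ δ' k t η ≤ A * bK φ δ₀ δ δ' k t ξ)
    (hκ : |bK φ δ₀ δ δ' k t ξ - bK φ δ₀ δ δ' k t η| ≤ κ * bK φ δ₀ δ δ' k t ξ)
    (hz : √δ * |√(bracket ξ) - √(bracket η)| ≤ z) (hu : 0 ≤ u) (hv : 0 ≤ v)
    (ha : |muStar φ δ δ' t ξ - muStar φ δ δ' t η| ≤ u * muStar φ δ δ' t η + v) :
    |mainTerm φ δ₀ δ δ' k t ξ - mainTerm φ δ₀ δ δ' k t η|
      ≤ Real.exp z * (u * A + κ + z) * mainTerm φ δ₀ δ δ' k t η + v := by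
  have hz0 : 0 ≤ z := (by have := h.sqrt_pos; positivity : (0 : ℝ) ≤ _).trans hz
  have hb := bK_pos hφ h hδ' hδ'1 ht k ξ
  have h1 := abs_gain_sub_le hφ h hδ' hδ'1 ht hκ hz
  have h2 := gain_le_of_bK hφ h hδ' hδ'1 ht hA hz
  have hg := gain_pos hφ h hδ' hδ'1 ht k ξ
  have hg' := gain_pos hφ h hδ' hδ'1 ht k η
  have hAz : 1 ≤ A * Real.exp z := one_le_mul_of_one_le_of_one_le hA1 (Real.one_le_exp hz0)
  have ha0 := muStar_nonneg hφ h hδ' ht η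
  have h3 := one_div_le_of_gain_le hφ h hδ' hδ'1 ht hAz h2 ha0
  rw [mainTerm, mainTerm]
  set B := gain φ δ₀ δ δ' k t ξ
  set B' := gain φ δ₀ δ δ' k t η
  set a := muStar φ δ δ' t ξ
  set a' := muStar φ δ δ' t η
  have hB : 0 < 1 + B := by linarith
  have hB' : 0 < 1 + B' := by linarith
  have e : a / (1 + B) - a' / (1 + B') = (a - a') / (1 + B) + a' / (1 + B') * ((B' - B) / (1 + B)) := by
    field_simp; ring
  rw [e]
  refine (abs_add_le _ _).trans ?_
  rw [abs_div, abs_mul, abs_div (B' - B), abs_of_pos hB, abs_of_nonneg (show 0 ≤ a' / (1 + B') by positivity)]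
  have f1 : |a - a'| / (1 + B) ≤ u * (A * Real.exp z * (a' / (1 + B'))) + v := by
    calc |a - a'| / (1 + B) ≤ (u * a' + v) / (1 + B) := by gcongr
      _ = u * (a' / (1 + B)) + v / (1 + B) := by ring
      _ ≤ _ := by
        gcongr
        exact div_le_self hv (by linarith)
  have f2 : |B' - B| / (1 + B) ≤ Real.exp z * (κ + z) := by
    rw [div_le_iff₀ hB]
    have : 0 ≤ Real.exp z * (κ + z) := by
      have := (abs_nonneg _).trans h1
      exact nonneg_of_mul_nonneg_left this hg
    linarith
  have f3 : a' / (1 + B') * (|B' - B| / (1 + B)) ≤ a' / (1 + B') * (Real.exp z * (κ + z)) := by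
    gcongr
  linarith

end difference

/-! ### Frequencies near `s^8` and the averaging length there. -/

section comparable

variable {s ξ : ℝ}

/-- Points close to `s ^ 8` are comparable to `s ^ 8`. -/
theorem mem_of_abs_sub_pow_le {ρ : ℝ} (hs : 10 ≤ s) (hρ : |ρ - s ^ 8| ≤ 10 * s ^ 4) :
    2 / 3 * s ^ 8 ≤ ρ ∧ ρ ≤ 4 / 3 * s ^ 8 := by
  have h4 : (10 : ℝ) ^ 4 ≤ s ^ 4 := by gcongr
  have h8 : 10 * s ^ 4 ≤ 1 / 3 * s ^ 8 := by
    rw [show s ^ 8 = s ^ 4 * s ^ 4 by ring]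
    nlinarith
  have := abs_le.1 hρ
  constructor <;> linarith

theorem le_sqrt_of_pow (hs : 10 ≤ s) : s ^ 4 / 2 ≤ √(2 / 3 * s ^ 8) := by
  apply Real.le_sqrt_of_sq_le
  have : 0 ≤ s ^ 8 := by positivity
  nlinarith

theorem sqrt_bracket_le_of_pow (hs : 10 ≤ s) (hξ : |ξ - s ^ 8| ≤ 2 * s) :
    √(bracket ξ) ≤ 1 + s ^ 4 := by
  rw [Real.sqrt_le_left (by positivity)]
  have h1 := bracket_le ξ
  have h2 := abs_le.1 hξ
  have h3 : s ≤ s ^ 4 := le_self_pow₀ (by linarith) (by norm_num)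
  have h4 : s ^ 4 ≤ s ^ 8 := pow_le_pow_right₀ (by linarith) (by norm_num)
  have h5 : |ξ| ≤ s ^ 8 + 2 * s := abs_le.2 ⟨by linarith, by linarith⟩
  nlinarith

theorem avgLength_le_of_pow {δ' t : ℝ} (hδ' : 0 < δ') (hδ'1 : δ' ≤ 1 / 2) (ht : 0 ≤ t)
    (hs : 10 ≤ s) (hξ : |ξ - s ^ 8| ≤ 2 * s) : avgLength δ' t ξ ≤ s ^ 4 := by
  have h1 := avgLength_le_bracket hδ' hδ'1 ht ξ
  have h2 := sqrt_bracket_le_of_pow hs hξ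
  have h3 : (10 : ℝ) ^ 4 ≤ s ^ 4 := by gcongr
  linarith

theorem le_avgLength_of_pow {δ' t : ℝ} (hδ' : 0 < δ') (hδ'1 : δ' ≤ 1 / 2) (ht : 0 ≤ t)
    (hs : 10 ≤ s) (hts : t ≤ s ^ 6) : δ' / 2 * s ^ 2 ≤ avgLength δ' t (s ^ 8) := by
  have h0 := avgLength_denom_pos hδ' ht (s ^ 8)
  have h1 := sqrt_bracket_le_of_pow (ξ := s ^ 8) hs (by simp; linarith)
  have h2 : (10 : ℝ) ^ 2 ≤ s ^ 2 := by gcongr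
  have h3 : (10 : ℝ) ^ 4 ≤ s ^ 4 := by gcongr
  have h4 : √(bracket (s ^ 8)) ≤ s ^ 6 := by
    rw [show s ^ 6 = s ^ 4 * s ^ 2 by ring]
    nlinarith
  have h5 : δ' * t ≤ s ^ 6 := by nlinarith
  have h6 := abs_le_bracket (s ^ 8)
  rw [abs_of_nonneg (by positivity)] at h6
  rw [avgLength]
  have h7 : δ' / 2 * s ^ 2 ≤ δ' * bracket (s ^ 8) / (√(bracket (s ^ 8)) + δ' * t) := by
    rw [le_div_iff₀ h0]
    calc _ ≤ δ' / 2 * s ^ 2 * (2 * s ^ 6) := by gcongr; linarith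
      _ = δ' * s ^ 8 := by ring
      _ ≤ _ := by gcongr
  linarith

end comparable

/-- Averages of a weight that is comparable on the whole window. -/
theorem exists_average_compare {φ : ℝ → ℝ} (hφ : IsCutoff φ) : ∃ K : ℝ, 0 ≤ K ∧
    ∀ δ' t : ℝ, 0 < δ' → δ' ≤ 1 / 2 → 0 ≤ t → ∀ (f : ℝ → ℝ), IsWeight f → ∀ ξ η M : ℝ, 1 ≤ M →
      |ξ - η| ≤ avgLength δ' t ξ →
      (∀ ρ ρ', |ρ - ξ| ≤ 6 * avgLength δ' t ξ → |ρ' - ξ| ≤ 6 * avgLength δ' t ξ →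
        f ρ ≤ M * f ρ') →
      average φ δ' t η f ≤ M * average φ δ' t ξ f ∧
      |average φ δ' t ξ f - average φ δ' t η f|
        ≤ K * (|ξ - η| / avgLength δ' t ξ) * (M * average φ δ' t ξ f) ∧
      |average φ δ' t ξ f - average φ δ' t η f|
        ≤ K * (|ξ - η| / avgLength δ' t ξ) * (M * average φ δ' t η f) := by
  obtain ⟨K, hK0, hK⟩ := exists_abs_average_sub_le hφ
  refine ⟨K, hK0, ?_⟩
  intro δ' t hδ' hδ'1 ht f hf ξ η M hM hξη hcomp
  have hL := one_pos.trans_le (one_le_avgLength hδ' ht ξ)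
  have hLL := abs_le.1 (abs_avgLength_sub_le hδ' ht ξ η)
  have hΔ := abs_nonneg (ξ - η)
  have hLη : avgLength δ' t η ≤ 3 / 2 * avgLength δ' t ξ := by nlinarith
  have hwin : ∀ ρ, |ρ - η| ≤ 8 / 5 * avgLength δ' t η → |ρ - ξ| ≤ 6 * avgLength δ' t ξ := by
    intro ρ hρ
    have := abs_sub_le ρ η ξ
    rw [abs_sub_comm η ξ] at this
    linarith
  have hM0 : 0 < M := by linarith
  have key : ∀ ζ, (∀ ρ, |ρ - ζ| ≤ 8 / 5 * avgLength δ' t ζ → |ρ - ξ| ≤ 6 * avgLength δ' t ξ) →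
      ∀ ρ, |ρ - ξ| ≤ 6 * avgLength δ' t ξ → f ρ ≤ M * average φ δ' t ζ f := by
    intro ζ hζ ρ hρ
    rw [← div_le_iff₀' hM0]
    apply const_le_average hφ hδ' ht hf (div_nonneg (hf.nonneg _) hM0.le)
    · rw [div_le_one hM0]
      exact (hf.le_one _).trans hM
    · intro ρ' hρ'
      rw [div_le_iff₀' hM0]
      exact hcomp ρ ρ' hρ (hζ ρ' hρ')
  have kξ := key ξ fun ρ hρ => hρ.trans (by linarith)
  exact ⟨average_le_const hφ hδ' ht hf fun ρ hρ => kξ ρ (hwin ρ hρ),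
    hK δ' t hδ' hδ'1 ht f hf ξ η _ hξη kξ, hK δ' t hδ' hδ'1 ht f hf ξ η _ hξη (key η hwin)⟩

/-! ### Small times: differentiation of the averaging kernel. -/

section smallTime

variable {φ : ℝ → ℝ} (hφ : IsCutoff φ) {δ₀ δ : ℝ} (h : IsSmall δ₀ δ) {δ' : ℝ} (hδ' : 0 < δ')
  (hδ'1 : δ' ≤ 1 / 2)
include hφ h hδ' hδ'1

/-- For `t ≤ s^6` the averaging length satisfies `L ≥ (δ'/2)s²`, while `L t ≲ s^8` keeps the phase
change over one window bounded. Thus `w_k` and `μ^#` are comparable on windows with a constant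
depending on `δ` alone, jumps of `k₀` included, and the kernel derivative gives `|ξ-η|/L ≲
|ξ-η|/(δ's)`. Only the explicit exponential contributes the part `√δ` without decay in `s`. -/
theorem abs_mainTerm_sub_le_of_time_le : ∃ K : ℝ, 10 ≤ K ∧ ∃ C : ℝ, 0 ≤ C ∧
    ∀ (k : ℤ) (t : ℝ), 0 ≤ t → ∀ s : ℝ, K ≤ s → t ≤ s ^ 6 → ∀ η : ℝ, |s ^ 8 - η| ≤ 2 * s →
      |mainTerm φ δ₀ δ δ' k t (s ^ 8) - mainTerm φ δ₀ δ δ' k t η|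
        ≤ Real.exp (√δ * √|s ^ 8 - η|) * (|s ^ 8 - η| * (C / s + √δ))
          * mainTerm φ δ₀ δ δ' k t η := by
  have hδ := h.pos
  obtain ⟨K, hK0, hK⟩ := exists_average_compare hφ
  set M := Real.exp (8 * 200 + 1 / δ) + (1 + 8 / δ + 200)
  have hd : 0 ≤ 8 / δ := by positivity
  have hexp := Real.exp_pos (8 * 200 + 1 / δ)
  have hM : 1 ≤ M := by simp only [M]; linarith
  refine ⟨10 + threshold δ + 4 / δ', ?_, K * M * (2 / δ') * (M + 1), by positivity, ?_⟩
  · have := threshold_pos hδ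
    have : 0 < 4 / δ' := by positivity
    linarith
  intro k t ht s hs hts η hη
  have hth := threshold_pos hδ
  have hδs : 4 / δ' ≤ s := by linarith
  have hd4 : 0 < 4 / δ' := by positivity
  have hs10 : 10 ≤ s := by linarith
  have hsth : threshold δ ≤ s := by linarith
  have hs0 : 0 < s := by linarith
  have hL0 := one_pos.trans_le (one_le_avgLength hδ' ht (s ^ 8))
  have hL1 := avgLength_le_of_pow (ξ := s ^ 8) hδ' hδ'1 ht hs10 (by simp; linarith)
  have hL2 := le_avgLength_of_pow hδ' hδ'1 ht hs10 hts
  have hLt := avgLength_mul_le hδ' ht (s ^ 8)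
  have hbs := bracket_le (s ^ 8)
  rw [abs_of_pos (by positivity)] at hbs
  have hs68 : s ^ 6 ≤ s ^ 8 := pow_le_pow_right₀ (by linarith) (by norm_num)
  have hs18 : 1 ≤ s ^ 8 := one_le_pow₀ (by linarith)
  have hs2 : s ^ 2 ≤ s ^ 8 := pow_le_pow_right₀ (by linarith) (by norm_num)
  have hσ : threshold δ < 2 / 3 * s ^ 8 := by nlinarith
  have hΔL : |s ^ 8 - η| ≤ avgLength δ' t (s ^ 8) := by
    rw [div_le_iff₀ hδ'] at hδs
    nlinarith
  have hsq := le_sqrt_of_pow hs10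
  set L := avgLength δ' t (s ^ 8)
  have hdist : ∀ ρ ρ' : ℝ, |ρ - s ^ 8| ≤ 6 * L → |ρ' - s ^ 8| ≤ 6 * L → |ρ - ρ'| ≤ 12 * L := by
    intro ρ ρ' h1 h2
    have := abs_sub_le ρ (s ^ 8) ρ'
    rw [abs_sub_comm (s ^ 8) ρ'] at this
    linarith
  have hmem : ∀ ρ : ℝ, |ρ - s ^ 8| ≤ 6 * L → 2 / 3 * s ^ 8 ≤ ρ ∧ ρ ≤ 4 / 3 * s ^ 8 := fun ρ h1 =>
    mem_of_abs_sub_pow_le hs10 (h1.trans (by linarith))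
  -- Two points of the enlarged window are at distance at most `12L`, and `tL ≤ t + ⟨s^8⟩` is at
  -- most about `2s^8`. The quotient by `σ ≥ (2/3)s^8` is below `200`.
  have hN : ∀ ρ ρ' : ℝ, |ρ - s ^ 8| ≤ 6 * L → |ρ' - s ^ 8| ≤ 6 * L → ∀ σ, 2 / 3 * s ^ 8 ≤ σ →
      2 * t / σ * |ρ - ρ'| ≤ 200 := by
    intro ρ ρ' h1 h2 σ hσ'
    have := hdist ρ ρ' h1 h2
    rw [div_mul_eq_mul_div, div_le_iff₀ (by nlinarith)]
    nlinarith
  have cw : ∀ ρ ρ' : ℝ, |ρ - s ^ 8| ≤ 6 * L → |ρ' - s ^ 8| ≤ 6 * L →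
      wK δ₀ δ k t ρ ≤ M * wK δ₀ δ k t ρ' := by
    intro ρ ρ' h1 h2
    have m1 := hmem ρ h1
    have m2 := hmem ρ' h2
    have hd := hdist ρ' ρ h2 h1
    have := wK_le_window h (σ := 2 / 3 * s ^ 8) (t := t) (ρ := ρ') (ρ' := ρ) (N := 200) hσ m2.1 m1.1
      (by linarith) (by linarith) ht k (hN ρ' ρ h2 h1 _ le_rfl) (by linarith)
    refine this.trans ?_
    rw [mul_comm]
    have := (wK_pos h k t ρ').le
    gcongr
    simp only [M]
    linarith
  have cm : ∀ ρ ρ' : ℝ, |ρ - s ^ 8| ≤ 6 * L → |ρ' - s ^ 8| ≤ 6 * L →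
      muSharp δ t ρ ≤ M * muSharp δ t ρ' := by
    intro ρ ρ' h1 h2
    have m1 := hmem ρ h1
    have m2 := hmem ρ' h2
    have := muSharp_le_window h (t := t) (ρ := ρ) (ρ' := ρ') (N := 200) ht (by linarith) (by linarith)
      (by linarith) (by linarith) (hN ρ ρ' h1 h2 _ m1.1)
    refine this.trans ?_
    have := muSharp_nonneg δ t ρ'
    gcongr
    simp only [M]
    linarith
  obtain ⟨b1, b2, -⟩ := hK δ' t hδ' hδ'1 ht _ (isWeight_wK h k t) (s ^ 8) η M hM hΔL cw
  obtain ⟨-, -, a3⟩ := hK δ' t hδ' hδ'1 ht _ (isWeight_muSharp h t) (s ^ 8) η M hM hΔL cm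
  rw [← mul_assoc] at b2 a3
  have hs0' := h.sqrt_pos
  have hz := abs_sqrt_bracket_sub_le (s ^ 8) η
  set Δ := |s ^ 8 - η|
  have hΔ : 0 ≤ Δ := abs_nonneg _
  set z := √δ * |√(bracket (s ^ 8)) - √(bracket η)|
  have hκ : 0 ≤ K * (Δ / L) * M := by positivity
  have fin := abs_mainTerm_sub_le hφ h hδ' hδ'1 ht (z := z) hM b1 b2 le_rfl hκ le_rfl
    (by rw [add_zero]; exact a3)
  rw [add_zero] at fin
  refine fin.trans ?_
  have hm := mainTerm_nonneg hφ h hδ' hδ'1 ht k η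
  have z1 : z ≤ √δ * √Δ := mul_le_mul_of_nonneg_left hz.1 hs0'.le
  have z2 : z ≤ √δ * Δ := mul_le_mul_of_nonneg_left hz.2 hs0'.le
  have hΔL2 : Δ / L ≤ Δ * (2 / δ' / s) := by
    rw [div_eq_mul_inv]
    gcongr
    rw [inv_le_comm₀ hL0 (by positivity)]
    refine le_trans (le_of_eq ?_) ((mul_le_mul_of_nonneg_left (le_self_pow₀ (by linarith : (1 : ℝ) ≤ s)
      (by norm_num : 2 ≠ 0)) (by positivity : 0 ≤ δ' / 2)).trans hL2)
    field_simp
  gcongr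
  calc K * (Δ / L) * M * M + K * (Δ / L) * M + z
      ≤ K * (Δ * (2 / δ' / s)) * M * M + K * (Δ * (2 / δ' / s)) * M + √δ * Δ := by gcongr
    _ = _ := by ring

end smallTime

end GevreyWeights

namespace GevreyWeights

theorem abs_sub_le_of_le_exp_mul {b b' X : ℝ} (hb : 0 ≤ b) (hX : 0 ≤ X)
    (h1 : b ≤ Real.exp X * b') (h2 : b' ≤ Real.exp X * b) : |b - b'| ≤ X * Real.exp X * b := by
  have hexp : Real.exp X - 1 ≤ X * Real.exp X :=
    (le_abs_self _).trans (exp_sub_one_le (abs_of_nonneg hX).le)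
  have he : 1 ≤ Real.exp X := Real.one_le_exp hX
  have h3 : (Real.exp X - 1) * b ≤ X * Real.exp X * b := by gcongr
  rw [abs_le]
  constructor
  · linarith
  · rcases le_total b b' with hbb | hbb
    · have : 0 ≤ X * Real.exp X * b := by positivity
      linarith
    · nlinarith

theorem abs_sub_le_of_le_mul_add {a a' u v : ℝ} (hu : 0 ≤ u)
    (h1 : a ≤ (1 + u) * a' + v) (h2 : a' ≤ (1 + u) * a + v) : |a - a'| ≤ u * a' + v := by
  rw [abs_le]
  constructor
  · rcases le_total a a' with haa | haa <;> nlinarith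
  · linarith

theorem exp_mul_add_le {z X u w r : ℝ} (hX : 0 ≤ X) (hw : 0 ≤ w) (hu : u ≤ w) (hXw : X ≤ w)
    (hz : z ≤ w) (hr : z + X ≤ r) :
    Real.exp z * (u * Real.exp X + X * Real.exp X + z) ≤ Real.exp r * (4 * w) := by
  have hE := Real.one_le_exp hX
  have g1 : u * Real.exp X ≤ w * Real.exp X := mul_le_mul_of_nonneg_right hu (by linarith)
  have g2 : X * Real.exp X ≤ w * Real.exp X := mul_le_mul_of_nonneg_right hXw (by linarith)
  have g3 : z ≤ w * Real.exp X := hz.trans (le_mul_of_one_le_right hw hE)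
  calc _ ≤ Real.exp z * (3 * (w * Real.exp X)) :=
        mul_le_mul_of_nonneg_left (by linarith) (Real.exp_pos z).le
    _ = Real.exp (z + X) * (3 * w) := by rw [Real.exp_add]; ring
    _ ≤ Real.exp r * (4 * w) :=
        mul_le_mul (Real.exp_le_exp.2 hr) (by linarith) (by positivity) (Real.exp_pos _).le

/-! ### Large times: pointwise comparison after the transition time. -/

section largeTime

variable {φ : ℝ → ℝ} (hφ : IsCutoff φ) {δ₀ δ : ℝ} (h : IsSmall δ₀ δ) {δ' : ℝ} (hδ' : 0 < δ')
  (hδ'1 : δ' ≤ 1 / 2)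

section windows

variable {t s : ℝ} (hs10 : 10 ≤ s) (hsth : threshold δ ≤ s) (hsδ : 4 / (δ * √δ) ≤ s)
  (hst : s ^ 6 ≤ t) {ξ η : ℝ} (hξ : |ξ - s ^ 8| ≤ 2 * s) (hη : |η - s ^ 8| ≤ 2 * s)

include hδ' hδ'1 hs10 hst hξ in
theorem mem_window_of_pow {ρ : ℝ} (hρ : |ρ - ξ| ≤ 8 / 5 * avgLength δ' t ξ) :
    2 / 3 * s ^ 8 ≤ ρ ∧ ρ ≤ 4 / 3 * s ^ 8 := by
  have ht : 0 ≤ t := le_trans (by positivity) hst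
  apply mem_of_abs_sub_pow_le hs10
  have h1 := avgLength_le_of_pow hδ' hδ'1 ht hs10 hξ
  have h2 := abs_sub_le ρ ξ (s ^ 8)
  have h3 : s ≤ s ^ 4 := le_self_pow₀ (by linarith) (by norm_num)
  linarith

include hδ' hδ'1 hs10 hst hξ in
theorem mem_window_mul_of_pow {y : ℝ} (hy : |y| ≤ 8 / 5) :
    2 / 3 * s ^ 8 ≤ ξ - avgLength δ' t ξ * y ∧ ξ - avgLength δ' t ξ * y ≤ 4 / 3 * s ^ 8 := by
  have ht : 0 ≤ t := le_trans (by positivity) hst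
  have hL := one_pos.trans_le (one_le_avgLength hδ' ht ξ)
  apply mem_window_of_pow hδ' hδ'1 hs10 hst hξ
  rw [sub_sub_cancel_left, abs_neg, abs_mul, abs_of_pos hL, mul_comm]
  gcongr

include hs10 hsth in
theorem threshold_lt_of_pow : threshold δ < 2 / 3 * s ^ 8 := by
  have : s ^ 2 ≤ s ^ 8 := pow_le_pow_right₀ (by linarith) (by norm_num)
  nlinarith

include h hs10 hsδ hst in
theorem sqrt_div_le_of_pow {x : ℝ} (hx : x ≤ s ^ 4) : 4 * x / (δ * √δ) ≤ t := by
  have hδ := h.pos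
  have hs := h.sqrt_pos
  have h1 : 1 ≤ s := by linarith
  rw [div_le_iff₀ (by positivity)]
  rw [div_le_iff₀ (by positivity)] at hsδ
  have h2 : s ≤ s ^ 2 := le_self_pow₀ h1 (by norm_num)
  have hc : 0 ≤ δ * √δ := by positivity
  have hsc : 0 ≤ s * (δ * √δ) := by positivity
  calc 4 * x ≤ 4 * s ^ 4 := by gcongr
    _ ≤ s * (δ * √δ) * s ^ 4 := by gcongr
    _ ≤ s ^ 2 * (δ * √δ) * s ^ 4 := by gcongr
    _ = s ^ 6 * (δ * √δ) := by ring
    _ ≤ _ := by gcongr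

include hφ h hδ' hδ'1 hs10 hsth hsδ hst hξ hη

/-- For `t ≥ s^6` all frequencies in the windows are past their transition times, of order
`δ^{-3/2}s^4`, so `μ^#` varies through a 1-Lipschitz distance multiplied by `δ²`. The term `3/s^8`
pays for the cutoff at `t = 2ρ`. -/
theorem muStar_le_of_le_time :
    muStar φ δ δ' t ξ ≤ (1 + 2 * δ ^ 2 * |ξ - η|) * muStar φ δ δ' t η + 3 / s ^ 8 := by
  have ht : 0 ≤ t := le_trans (by positivity) hst
  have hδ := h.pos
  have hs := h.sqrt_pos
  have h8 : 0 < s ^ 8 := by positivity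
  apply average_le hφ hδ' ht (isWeight_muSharp h t) (isWeight_muSharp h t)
  intro y hy
  have m1 := mem_window_mul_of_pow hδ' hδ'1 hs10 hst hξ hy
  have m2 := mem_window_mul_of_pow hδ' hδ'1 hs10 hst hη hy
  have hth := threshold_lt_of_pow hs10 hsth
  have hd := abs_sub_le_of_avgLength hφ hδ' ht hδ'1 ξ η hy
  have hξη : |ξ - η| ≤ 4 * s := by
    have := abs_sub_le ξ (s ^ 8) η
    rw [abs_sub_comm (s ^ 8) η] at this
    linarith
  set p := ξ - avgLength δ' t ξ * y
  set q := η - avgLength δ' t η * y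
  have hp : 0 < p := by linarith
  have hs28 : 10 ^ 7 * s ≤ s ^ 8 := by
    rw [show s ^ 8 = s ^ 7 * s by ring]
    gcongr
  have hsp : √p ≤ 2 * s ^ 4 := by
    rw [Real.sqrt_le_left (by positivity)]
    nlinarith
  have htp : 2 * (p / (δ * √δ * √p)) ≤ t := by
    refine le_trans (le_of_eq ?_) (sqrt_div_le_of_pow h hs10 hsδ hst (x := √p / 2) (by linarith))
    rw [← div_div, div_right_comm, Real.div_sqrt]
    ring
  have := muSharp_le_late h (t := t) (ρ := p) (ρ' := q) (by linarith) (by linarith) (by linarith) htp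
  refine this.trans ?_
  have hq := muSharp_nonneg δ t q
  have e1 : 2 / p ≤ 3 / s ^ 8 := by
    rw [div_le_div_iff₀ hp h8]
    linarith
  have e2 : δ ^ 2 * |p - q| ≤ 2 * δ ^ 2 * |ξ - η| := by
    calc _ ≤ δ ^ 2 * (2 * |ξ - η|) := by gcongr
      _ = _ := by ring
  gcongr

/-- Corresponding points are past the transition time, where `w_k` has no jumps and both moduli hold
without additive constants. The `14` is `2 + 6·2`, the distance of corresponding points being at
most `2|ξ-η|`. -/
theorem bK_le_of_le_time (k : ℤ) :
    bK φ δ₀ δ δ' k t ξ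
      ≤ Real.exp (min (14 * δ * |ξ - η|) (√δ / 50 * √|ξ - η|)) * bK φ δ₀ δ δ' k t η := by
  have ht : 0 ≤ t := le_trans (by positivity) hst
  have hδ := h.pos
  have hs := h.sqrt_pos
  have h8 : 0 < s ^ 8 := by positivity
  rw [← add_zero (_ * _)]
  apply average_le hφ hδ' ht (isWeight_wK h k t) (isWeight_wK h k t)
  intro y hy
  have m1 := mem_window_mul_of_pow hδ' hδ'1 hs10 hst hξ hy
  have m2 := mem_window_mul_of_pow hδ' hδ'1 hs10 hst hη hy
  have hth := threshold_lt_of_pow hs10 hsth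
  have hd := abs_sub_le_of_avgLength hφ hδ' ht hδ'1 ξ η hy
  have hsq1 := le_sqrt_of_pow hs10
  have h4 : (10 : ℝ) ^ 4 ≤ s ^ 4 := by gcongr
  have hsq2 : √(2 / 3 * s ^ 8) ≤ s ^ 4 := by
    rw [Real.sqrt_le_left (by positivity)]
    nlinarith
  set p := ξ - avgLength δ' t ξ * y
  set q := η - avgLength δ' t η * y
  have hX : min (δ * (|q - p| + 6 * (|q - p| / √(2 / 3 * s ^ 8)))) (√δ / 100 * √|q - p|)
      ≤ min (14 * δ * |ξ - η|) (√δ / 50 * √|ξ - η|) := by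
    rw [abs_sub_comm q p]
    apply min_le_min
    · have : |p - q| / √(2 / 3 * s ^ 8) ≤ |p - q| := div_le_self (abs_nonneg _) (by linarith)
      calc _ ≤ δ * (2 * |ξ - η| + 6 * (2 * |ξ - η|)) := by gcongr; linarith
        _ = _ := by ring
    · have : √|p - q| ≤ 2 * √|ξ - η| := by
        rw [Real.sqrt_le_left (by positivity), mul_pow, Real.sq_sqrt (abs_nonneg _)]
        linarith [abs_nonneg (ξ - η)]
      calc _ ≤ √δ / 100 * (2 * √|ξ - η|) := by gcongr
        _ = _ := by ring
  have := wK_le_late h (t := t) hth m2.1 m1.1 (by linarith) (by linarith)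
    (sqrt_div_le_of_pow h hs10 hsδ hst hsq2) k hX
  rw [add_zero, mul_comm]
  exact this

theorem muStar_eq_zero_of_lt_time (hlt : 3 * s ^ 8 < t) : muStar φ δ δ' t ξ = 0 := by
  have ht : 0 ≤ t := le_trans (by positivity) hst
  apply muStar_eq_zero hφ h hδ' hδ'1 ht
  intro ρ hρ
  have := mem_window_of_pow hδ' hδ'1 hs10 hst hξ hρ
  have h8 : 0 < s ^ 8 := by positivity
  rw [abs_of_nonneg (by linarith)]
  linarith

end windows

/-- Since `1 + σ₀ ≤ 5/4` and `t ≲ s^8`, the decay term is at least of order `s^4/s^{10} = s^{-6}`.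
The error `s^{-8}` of the cutoff is therefore smaller by more than a factor `1/s`. -/
theorem div_pow_le_decayTerm {σ₀ : ℝ} (hσ₀ : 0 < σ₀) (hσ₀' : σ₀ ≤ 1 / 100) {t s η : ℝ} (ht : 0 ≤ t)
    (hs10 : 10 ≤ s) (hη : |η - s ^ 8| ≤ 2 * s) (hts : t ≤ 3 * s ^ 8) (k : ℤ) :
    3 / s ^ 8 ≤ 48 / s * decayTerm σ₀ k t η := by
  have h8 : 0 < s ^ 8 := by positivity
  have h28 : 10 ^ 7 * s ≤ s ^ 8 := by
    rw [show s ^ 8 = s ^ 7 * s by ring]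
    gcongr
  have hB := bracket_rpow_pos hσ₀ hσ₀' t
  have h1 : s ^ 4 / 2 ≤ √(bracket η) := by
    apply Real.le_sqrt_of_sq_le
    have := abs_le_bracket η
    have := le_abs_self η
    have := (abs_le.1 hη).1
    nlinarith
  have h2 : bracket t ≤ 4 * s ^ 8 := by
    have := bracket_le t
    rw [abs_of_nonneg ht] at this
    linarith
  have h3 : √√(bracket t) ≤ 2 * s ^ 2 := by
    rw [Real.sqrt_le_left (by positivity), Real.sqrt_le_left (by positivity)]
    nlinarith
  have h4 : bracket t ^ (1 + σ₀) ≤ 4 * s ^ 8 * (2 * s ^ 2) :=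
    (bracket_rpow_le hσ₀ hσ₀' t).trans (by gcongr)
  have h5 := le_decayTerm hσ₀ hσ₀' k t η
  have h6 : 1 / (16 * s ^ 6) ≤ decayTerm σ₀ k t η := by
    refine le_trans ?_ h5
    calc 1 / (16 * s ^ 6) = s ^ 4 / 2 / (4 * s ^ 8 * (2 * s ^ 2)) := by field_simp; norm_num
      _ ≤ _ := by gcongr
  calc 3 / s ^ 8 ≤ 3 / s ^ 7 := by
        gcongr
        · linarith
        · norm_num
    _ = 48 / s * (1 / (16 * s ^ 6)) := by field_simp; norm_num
    _ ≤ _ := by gcongr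

include hφ h hδ' hδ'1

theorem abs_mainTerm_sub_le_of_le_time {σ₀ : ℝ} (hσ₀ : 0 < σ₀) (hσ₀' : σ₀ ≤ 1 / 100) {t s : ℝ}
    (hs10 : 10 ≤ s) (hsth : threshold δ ≤ s)
    (hsδ : 4 / (δ * √δ) ≤ s) (hst : s ^ 6 ≤ t) (k : ℤ) {η : ℝ} (hη : |s ^ 8 - η| ≤ 2 * s) :
    |mainTerm φ δ₀ δ δ' k t (s ^ 8) - mainTerm φ δ₀ δ δ' k t η|
      ≤ Real.exp (2 * √δ * √|s ^ 8 - η|) * (|s ^ 8 - η| * (4 * √δ)) * mainTerm φ δ₀ δ δ' k t η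
        + 48 / s * decayTerm σ₀ k t η := by
  have ht : 0 ≤ t := le_trans (by positivity) hst
  have hδ := h.pos
  have hs := h.sqrt_pos
  have hd0 := decayTerm_pos hσ₀ hσ₀' k t η
  have hm := mainTerm_nonneg hφ h hδ' hδ'1 ht k η
  have hξ0 : |s ^ 8 - s ^ 8| ≤ 2 * s := by simp; linarith
  have hη' : |η - s ^ 8| ≤ 2 * s := by rwa [abs_sub_comm]
  rcases lt_or_ge (3 * s ^ 8) t with hlt | hle
  · rw [mainTerm, mainTerm, muStar_eq_zero_of_lt_time hφ h hδ' hδ'1 hs10 hsth hsδ hst hξ0 hη' hlt,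
      muStar_eq_zero_of_lt_time hφ h hδ' hδ'1 hs10 hsth hsδ hst hη' hη' hlt, zero_div, zero_div,
      sub_self, abs_zero, mul_zero, zero_add]
    positivity
  have a1 := muStar_le_of_le_time hφ h hδ' hδ'1 hs10 hsth hsδ hst hξ0 hη'
  have a2 := muStar_le_of_le_time hφ h hδ' hδ'1 hs10 hsth hsδ hst hη' hξ0
  have b1 := bK_le_of_le_time hφ h hδ' hδ'1 hs10 hsth hsδ hst hξ0 hη' k
  have b2 := bK_le_of_le_time hφ h hδ' hδ'1 hs10 hsth hsδ hst hη' hξ0 k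
  rw [abs_sub_comm η] at a2 b2
  have hz := abs_sqrt_bracket_sub_le (s ^ 8) η
  have hv := div_pow_le_decayTerm hσ₀ hσ₀' ht hs10 hη' hle k
  have hbp := bK_pos hφ h hδ' hδ'1 ht k (s ^ 8)
  set Δ := |s ^ 8 - η|
  have hΔ : 0 ≤ Δ := abs_nonneg _
  -- Both bounds are needed: `X` appears as a prefactor, where it must be linear in `Δ` with a
  -- coefficient below `√δ`, and in an exponent, where only a multiple of `√δ√Δ` is affordable.
  set X := min (14 * δ * Δ) (√δ / 50 * √Δ)
  set z := √δ * |√(bracket (s ^ 8)) - √(bracket η)|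
  have hX : 0 ≤ X := le_min (by positivity) (by positivity)
  have hX1 : X ≤ 14 * δ * Δ := min_le_left _ _
  have hX2 : X ≤ √δ / 50 * √Δ := min_le_right _ _
  have z0 : 0 ≤ z := by positivity
  have z1 : z ≤ √δ * √Δ := mul_le_mul_of_nonneg_left hz.1 hs.le
  have z2 : z ≤ √δ * Δ := mul_le_mul_of_nonneg_left hz.2 hs.le
  have h0 : 0 ≤ 48 / s * decayTerm σ₀ k t η := by positivity
  have hu : 0 ≤ 2 * δ ^ 2 * Δ := by positivity
  have hκ := abs_sub_le_of_le_exp_mul hbp.le hX b1 b2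
  have ha := abs_sub_le_of_le_mul_add (v := 48 / s * decayTerm σ₀ k t η) hu
    (a1.trans (by linarith)) (a2.trans (by linarith))
  refine (abs_mainTerm_sub_le hφ h hδ' hδ'1 ht (Real.one_le_exp hX) b2 hκ le_rfl hu h0 ha).trans ?_
  have hl := h.le_sqrt
  have hδ2 : δ ^ 2 ≤ δ := by nlinarith [h.le_one]
  have hw : 0 ≤ √δ * √Δ := by positivity
  have := exp_mul_add_le (u := 2 * δ ^ 2 * Δ) (w := √δ * Δ) (z := z) (r := 2 * √δ * √Δ) hX
    (by positivity) (mul_le_mul_of_nonneg_right (by linarith) hΔ)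
    (hX1.trans (mul_le_mul_of_nonneg_right (by linarith) hΔ)) z2 (by linarith)
  rw [show 4 * (√δ * Δ) = Δ * (4 * √δ) by ring] at this
  linarith [mul_le_mul_of_nonneg_right this hm]

/-- The main term varies slowly at frequencies near `s ^ 8`, when `s` is large. -/
theorem exists_abs_mainTerm_sub_le {σ₀ : ℝ} (hσ₀ : 0 < σ₀) (hσ₀' : σ₀ ≤ 1 / 100) :
    ∃ K : ℝ, 10 ≤ K ∧ ∃ C : ℝ, 0 ≤ C ∧ ∀ (k : ℤ) (t : ℝ), 0 ≤ t → ∀ s : ℝ, K ≤ s →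
      ∀ η : ℝ, |s ^ 8 - η| ≤ 2 * s →
      |mainTerm φ δ₀ δ δ' k t (s ^ 8) - mainTerm φ δ₀ δ δ' k t η|
        ≤ bracket (s ^ 8 - η) * (C / s + 4 * √δ) * (Real.exp (2 * √δ * √|s ^ 8 - η|)
          * (decayTerm σ₀ k t η + mainTerm φ δ₀ δ δ' k t η)) := by
  obtain ⟨K, hK, C, hC, hsmall⟩ := abs_mainTerm_sub_le_of_time_le hφ h hδ' hδ'1
  have hδ := h.pos
  have hs' := h.sqrt_pos
  have hth := threshold_pos hδ
  have hd : 0 < 4 / (δ * √δ) := by positivity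
  refine ⟨K + threshold δ + 4 / (δ * √δ), by linarith, C + 48, by linarith, ?_⟩
  intro k t ht s hs η hη
  have hs10 : 10 ≤ s := by linarith
  have hd0 := decayTerm_pos hσ₀ hσ₀' k t η
  have hm := mainTerm_nonneg hφ h hδ' hδ'1 ht k η
  have hJ := abs_le_bracket (s ^ 8 - η)
  have hJ1 := one_le_bracket (s ^ 8 - η)
  have he : 1 ≤ Real.exp (2 * √δ * √|s ^ 8 - η|) := Real.one_le_exp (by positivity)
  have hJ0 := abs_nonneg (s ^ 8 - η)
  rcases le_total t (s ^ 6) with hts | hts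
  · refine (hsmall k t ht s (by linarith) hts η hη).trans ?_
    calc _ ≤ Real.exp (2 * √δ * √|s ^ 8 - η|) * (bracket (s ^ 8 - η) * ((C + 48) / s + 4 * √δ))
          * (decayTerm σ₀ k t η + mainTerm φ δ₀ δ δ' k t η) := by
          gcongr
          · linarith
          · linarith
          · linarith
          · linarith
      _ = _ := by ring
  · refine (abs_mainTerm_sub_le_of_le_time hφ h hδ' hδ'1 hσ₀ hσ₀' hs10 (by linarith) (by linarith) hts
      k hη).trans ?_
    set E := Real.exp (2 * √δ * √|s ^ 8 - η|)
    set J := bracket (s ^ 8 - η)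
    have f1 : E * (|s ^ 8 - η| * (4 * √δ)) * mainTerm φ δ₀ δ δ' k t η
        ≤ E * (J * ((C + 48) / s + 4 * √δ)) * mainTerm φ δ₀ δ δ' k t η := by
      gcongr
      have : 0 ≤ (C + 48) / s := by positivity
      linarith
    have f2 : 48 / s * decayTerm σ₀ k t η
        ≤ E * (J * ((C + 48) / s + 4 * √δ)) * decayTerm σ₀ k t η := by
      gcongr
      have h1 : 48 / s ≤ (C + 48) / s + 4 * √δ := by
        have : 48 / s ≤ (C + 48) / s := by gcongr; linarith
        linarith
      have h0 : 0 ≤ 48 / s := by positivity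
      have h2 : 1 * (48 / s) ≤ J * ((C + 48) / s + 4 * √δ) := by gcongr
      have h3 : 1 * (1 * (48 / s)) ≤ E * (J * ((C + 48) / s + 4 * √δ)) := by gcongr
      linarith
    linarith

end largeTime

end GevreyWeights

namespace GevreyWeights

/-! ### Reflection, and the difference of `μ_k` -/

section

variable {φ : ℝ → ℝ} (hφ : IsCutoff φ) {δ₀ δ : ℝ} (h : IsSmall δ₀ δ) {δ' : ℝ} (hδ' : 0 < δ')
include hφ h hδ'

theorem mainTerm_neg {t : ℝ} (ht : 0 ≤ t) (k : ℤ) (ξ : ℝ) :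
    mainTerm φ δ₀ δ δ' (-k) t (-ξ) = mainTerm φ δ₀ δ δ' k t ξ := by
  have h1 : muStar φ δ δ' t (-ξ) = muStar φ δ δ' t ξ := by
    rw [muStar, muStar, ← average_neg hφ hδ' ht ξ]
    simp only [muSharp_neg]
  have h2 : bK φ δ₀ δ δ' (-k) t (-ξ) = bK φ δ₀ δ δ' k t ξ := by
    rw [bK, bK, ← average_neg hφ hδ' ht ξ]
    congr 1
    ext ρ
    rw [← wK_neg δ₀ h.pos k t (-ρ), neg_neg]
  rw [mainTerm, mainTerm, gain, gain, h1, h2, bracket_neg, Int.cast_neg, abs_neg]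

end

theorem decayTerm_neg (σ₀ : ℝ) (k : ℤ) (t ξ : ℝ) :
    decayTerm σ₀ (-k) t (-ξ) = decayTerm σ₀ k t ξ := by
  simp [decayTerm, pairBracket]

section

variable {φ : ℝ → ℝ} (hφ : IsCutoff φ) {δ₀ δ : ℝ} (h : IsSmall δ₀ δ) {δ' : ℝ} (hδ' : 0 < δ')
  (hδ'1 : δ' ≤ 1 / 2) {σ₀ : ℝ} (hσ₀ : 0 < σ₀) (hσ₀' : σ₀ ≤ 1 / 100)
include hφ h hδ' hδ'1 hσ₀ hσ₀'

theorem exists_abs_mainTerm_sub_le_abs :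
    ∃ K : ℝ, 10 ≤ K ∧ ∃ C : ℝ, 0 ≤ C ∧ ∀ (k : ℤ) (t : ℝ), 0 ≤ t → ∀ s : ℝ, K ≤ s →
      ∀ ξ η : ℝ, |ξ| = s ^ 8 → |ξ - η| ≤ 2 * s →
      |mainTerm φ δ₀ δ δ' k t ξ - mainTerm φ δ₀ δ δ' k t η|
        ≤ bracket (ξ - η) * (C / s + 4 * √δ) * (Real.exp (2 * √δ * √|ξ - η|)
          * (decayTerm σ₀ k t η + mainTerm φ δ₀ δ δ' k t η)) := by
  obtain ⟨K, hK, C, hC, hmain⟩ := exists_abs_mainTerm_sub_le hφ h hδ' hδ'1 hσ₀ hσ₀'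
  refine ⟨K, hK, C, hC, fun k t ht s hs ξ η hξ hξη => ?_⟩
  rcases le_total 0 ξ with h0 | h0
  · rw [abs_of_nonneg h0] at hξ
    subst hξ
    exact hmain k t ht s hs η hξη
  · rw [abs_of_nonpos h0] at hξ
    have e : s ^ 8 - -η = -(ξ - η) := by rw [← hξ]; ring
    have := hmain (-k) t ht s hs (-η) (by rwa [e, abs_neg])
    rwa [e, abs_neg, bracket_neg, ← hξ, mainTerm_neg hφ h hδ' ht, mainTerm_neg hφ h hδ' ht,
      decayTerm_neg] at this

/-- The difference of the main term at two frequencies, for large `k`. -/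
theorem exists_abs_mainTerm_sub_le_of_le : ∃ C : ℝ, 1 ≤ C ∧ ∀ (k : ℤ) (t : ℝ), 0 ≤ t →
    ∀ ξ η X : ℝ, 20 ≤ X → X ^ 8 = pairBracket k ξ → |ξ - η| ≤ X → 4 * bracket ξ ≤ |(k : ℝ)| →
      |mainTerm φ δ₀ δ δ' k t ξ - mainTerm φ δ₀ δ δ' k t η|
        ≤ bracket (ξ - η) * (C / X) * decayTerm σ₀ k t η := by
  obtain ⟨C, hC, hmain⟩ := mainTerm_le_decayTerm hφ h hδ' hδ'1 hσ₀ hσ₀'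
  refine ⟨4 * C, by linarith, fun k t ht ξ η X hX hX8 hξη hk => ?_⟩
  have hX0 : 0 < X := by linarith
  have h1 := pairBracket_le k ξ
  have h2 := bracket_pos ξ
  have h3 := abs_bracket_sub_le ξ η
  have h4 : 20 ^ 7 * X ≤ X ^ 8 := by
    rw [show X ^ 8 = X ^ 7 * X by ring]
    gcongr
  have h5 := abs_le.1 h3
  have h6 := abs_le.1 (abs_pairBracket_sub_le k ξ η)
  have hP' : X ^ 8 / 2 ≤ pairBracket k η := by linarith
  have m1 := hmain k t ht ξ (by linarith)
  -- The margin between `4⟨ξ⟩ ≤ |k|` and the required `3⟨η⟩ ≤ |k|` covers the shift `|ξ-η| ≤ X`,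
  -- which is tiny compared with `X^8 ≤ |k| + ⟨ξ⟩`.
  have m2 := hmain k t ht η (by linarith)
  have n1 := mainTerm_nonneg hφ h hδ' hδ'1 ht k ξ
  have n2 := mainTerm_nonneg hφ h hδ' hδ'1 ht k η
  have d1 := decayTerm_le hσ₀ hσ₀' k t ξ η
  have d0 := decayTerm_pos hσ₀ hσ₀' k t η
  have j1 := abs_le_bracket (ξ - η)
  have j2 := one_le_bracket (ξ - η)
  have hXX : X ≤ X ^ 8 := le_self_pow₀ (by linarith) (by norm_num)
  set d' := decayTerm σ₀ k t η
  set J := bracket (ξ - η)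
  rw [← hX8] at m1
  have f1 : mainTerm φ δ₀ δ δ' k t ξ ≤ C * (2 * J * d' / X) := by
    refine m1.trans ?_
    have : decayTerm σ₀ k t ξ ≤ 2 * J * d' := d1.trans (by gcongr; linarith)
    gcongr
  have f2 : mainTerm φ δ₀ δ δ' k t η ≤ C * (2 * J * d' / X) := by
    refine m2.trans ?_
    calc C * (d' / pairBracket k η) ≤ C * (d' / (X / 2)) := by gcongr; linarith
      _ = C * (2 * 1 * d' / X) := by field_simp
      _ ≤ _ := by gcongr
  have e : J * (4 * C / X) * d' = C * (2 * J * d' / X) + C * (2 * J * d' / X) := by ring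
  rw [e, abs_le]
  constructor <;> linarith

/-- The difference of `μ_k` at two frequencies. -/
theorem exists_abs_muK_sub_le : ∃ C : ℝ, 1 ≤ C ∧ ∀ (k : ℤ) (t : ℝ), 0 ≤ t → ∀ ξ η : ℝ,
    |muK φ σ₀ δ₀ δ δ' k t ξ - muK φ σ₀ δ₀ δ δ' k t η|
      ≤ bracket (ξ - η) * (C / pairBracket k ξ ^ (1 / 8 : ℝ) + 4 * √δ)
        * (Real.exp (2 * √δ * √|ξ - η|) * muK φ σ₀ δ₀ δ δ' k t η) := by
  obtain ⟨C₂, hC₂, hglob⟩ := muK_le_mul_exp_sqrt hφ h hδ' hδ'1 hσ₀ hσ₀'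
  obtain ⟨K, hK, C₃, hC₃, hnear⟩ := exists_abs_mainTerm_sub_le_abs hφ h hδ' hδ'1 hσ₀ hσ₀'
  obtain ⟨C₄, hC₄, hfar⟩ := exists_abs_mainTerm_sub_le_of_le hφ h hδ' hδ'1 hσ₀ hσ₀'
  have hC0 : 0 ≤ (C₂ + 1) * (2 * K) := by positivity
  refine ⟨(C₂ + 1) * (2 * K) + C₄ + 2 * C₃ + 2, by linarith, fun k t ht ξ η => ?_⟩
  have hs := h.sqrt_pos
  have hP := one_le_pairBracket k ξ
  set X := pairBracket k ξ ^ (1 / 8 : ℝ) with hX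
  have hX1 : 1 ≤ X := Real.one_le_rpow hP (by norm_num)
  have hX0 : 0 < X := by linarith
  have hX8 : X ^ 8 = pairBracket k ξ := by
    have := Real.rpow_inv_natCast_pow (n := 8) (pairBracket_pos k ξ).le (by norm_num)
    rw [hX]
    convert this using 3
    norm_num
  have d0 := decayTerm_pos hσ₀ hσ₀' k t η
  have d0' := decayTerm_pos hσ₀ hσ₀' k t ξ
  have n1 := mainTerm_nonneg hφ h hδ' hδ'1 ht k ξ
  have n2 := mainTerm_nonneg hφ h hδ' hδ'1 ht k η
  have hE : 1 ≤ Real.exp (2 * √δ * √|ξ - η|) := Real.one_le_exp (by positivity)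
  have hg := hglob k t ht ξ η
  have dd := abs_decayTerm_sub_le hσ₀ hσ₀' k t ξ η
  have nr := hnear k t ht
  have j1 := abs_le_bracket (ξ - η)
  have j2 := one_le_bracket (ξ - η)
  rw [muK_eq, muK_eq] at *
  set d := decayTerm σ₀ k t ξ
  set d' := decayTerm σ₀ k t η
  set m := mainTerm φ δ₀ δ δ' k t ξ
  set m' := mainTerm φ δ₀ δ δ' k t η
  set J := bracket (ξ - η)
  set E := Real.exp (2 * √δ * √|ξ - η|)
  -- In this case `⟨ξ-η⟩ · 2K/X ≥ 1`, and the global comparison already gives the claim.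
  by_cases hA : X ≤ 2 * K ∨ X ≤ J
  · have h1 : 1 ≤ J * (2 * K / X) := by
      rw [← mul_div_assoc, le_div_iff₀ hX0]
      rcases hA with hA | hA <;> nlinarith
    have h2 : |d + m - (d' + m')| ≤ (C₂ + 1) * (E * (d' + m')) := by
      have : d' + m' ≤ E * (d' + m') := le_mul_of_one_le_left (by linarith) hE
      rw [abs_le]
      constructor <;> linarith
    refine h2.trans ?_
    gcongr
    calc C₂ + 1 ≤ (C₂ + 1) * (J * (2 * K / X)) := le_mul_of_one_le_right (by linarith) h1
      _ = J * ((C₂ + 1) * (2 * K) / X + 0) := by ring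
      _ ≤ _ := by
        gcongr
        · linarith
        · positivity
  rw [not_or, not_le, not_le] at hA
  obtain ⟨hXK, hXJ⟩ := hA
  have h4 : 20 ^ 7 * X ≤ X ^ 8 := by
    rw [show X ^ 8 = X ^ 7 * X by ring]
    gcongr
    linarith
  have hP' : X / 2 ≤ pairBracket k η := by
    have := abs_le.1 (abs_pairBracket_sub_le k ξ η)
    linarith
  have hdec : |d - d'| ≤ J * (2 / X) * d' := by
    refine dd.trans ?_
    calc _ ≤ J / (X / 2) * d' := by gcongr
      _ = _ := by ring
  have hsplit : |d + m - (d' + m')| ≤ |d - d'| + |m - m'| := by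
    rw [add_sub_add_comm]
    exact abs_add_le _ _
  have hmain : |m - m'| ≤ J * ((C₄ + 2 * C₃) / X + 4 * √δ) * (E * (d' + m')) := by
    rcases le_or_gt (4 * bracket ξ) |(k : ℝ)| with hk | hk
    · refine (hfar k t ht ξ η X (by linarith) hX8 (by linarith) hk).trans ?_
      gcongr
      · calc C₄ / X ≤ (C₄ + 2 * C₃) / X := by gcongr; linarith
          _ ≤ _ := by linarith
      · calc d' ≤ 1 * (d' + m') := by linarith
          _ ≤ _ := by gcongr
    · set s := |ξ| ^ (1 / 8 : ℝ) with hs_def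
      have hs0 : 0 ≤ s := by positivity
      have hs8 : |ξ| = s ^ 8 := by
        have := Real.rpow_inv_natCast_pow (n := 8) (abs_nonneg ξ) (by norm_num)
        rw [hs_def, eq_comm]
        convert this using 3
        norm_num
      have h5 := pairBracket_le k ξ
      have h6 := bracket_le ξ
      -- Here `X^8 ≤ |k| + ⟨ξ⟩ < 5⟨ξ⟩`, which for large `X` is less than `2^8 |ξ|`. Hence `s ≥ K`
      -- and `|ξ-η| ≤ X ≤ 2s`, as the estimate near `s^8` requires.
      have hXs : X ≤ 2 * s := by
        refine le_of_pow_le_pow_left₀ (n := 8) (by norm_num) (by positivity) ?_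
        rw [mul_pow]
        linarith
      refine (nr s (by linarith) ξ η hs8 (by linarith)).trans ?_
      have hsp : 0 < s := by linarith
      gcongr ?_ * _
      gcongr ?_ * (?_ + _)
      calc C₃ / s ≤ C₃ / (X / 2) := by gcongr; linarith
        _ = 2 * C₃ / X := by ring
        _ ≤ _ := by gcongr; linarith
  have hdec2 : J * (2 / X) * d' ≤ J * (((C₂ + 1) * (2 * K) + 2) / X) * (E * (d' + m')) := by
    gcongr
    · linarith
    · calc d' ≤ 1 * (d' + m') := by linarith
        _ ≤ _ := by gcongr
  calc _ ≤ J * (((C₂ + 1) * (2 * K) + 2) / X) * (E * (d' + m'))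
        + J * ((C₄ + 2 * C₃) / X + 4 * √δ) * (E * (d' + m')) := by linarith
    _ = _ := by ring

end

end GevreyWeights

theorem mainTheorem6 (φ : ℝ → ℝ) (hφ : IsCutoff φ) (σ₀ : ℝ) (hσ₀ : 0 < σ₀)
    (hσ₀' : σ₀ ≤ 1 / 100) (δ₀ : ℝ) (hδ₀ : 0 < δ₀) :
    ∃ C : ℝ, 0 < C ∧ ∃ δmax : ℝ, 0 < δmax ∧ ∀ δ : ℝ, 0 < δ → δ ≤ δmax →
      ∃ δ'max : ℝ, 0 < δ'max ∧ δ'max < 1 ∧ ∀ δ' : ℝ, 0 < δ' → δ' ≤ δ'max →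
        ∃ C₁ : ℝ, 1 ≤ C₁ ∧ ∃ C₂ : ℝ, 1 ≤ C₂ ∧
          ∀ (t : ℝ), 0 ≤ t → ∀ (ξ η : ℝ) (k : ℤ),
            (pairBracket k η / 100 ≤ bracket (ξ - η) →
              muK φ σ₀ δ₀ δ δ' k t ξ + muK φ σ₀ δ₀ δ δ' k t η
                ≤ C₂ * (muR φ σ₀ δ δ' t (ξ - η)
                    * Real.exp (4 * √δ * √(pairNorm k η)))) ∧
            (bracket (ξ - η) ≤ (pairBracket k ξ + pairBracket k η) / 8 →
              |muK φ σ₀ δ₀ δ δ' k t ξ - muK φ σ₀ δ₀ δ δ' k t η|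
                ≤ C * (bracket (ξ - η) * muK φ σ₀ δ₀ δ δ' k t η
                    * Real.exp (4 * √δ * √|ξ - η|)
                    * (C₁ / pairBracket k ξ ^ (1 / 8 : ℝ) + √δ))) ∧
            (muK φ σ₀ δ₀ δ δ' k t ξ
              ≤ C₂ * (muK φ σ₀ δ₀ δ δ' k t η
                  * Real.exp (6 * √δ * √|ξ - η|))) := by
  -- The constant `4` is the coefficient of `√δ` in `exists_abs_muK_sub_le`, independent of `δ` and
  -- `δ'`; the bound for `δ` is `IsSmall.small` solved for `δ`.
  refine ⟨4, by norm_num, (1 / (10 ^ 4 * (1 + 2 * δ₀) ^ 2)) ^ 2, by positivity, ?_⟩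
  intro δ hδ hδmax
  have h : IsSmall δ₀ δ := ⟨hδ₀, hδ, by
    have h1 : √δ ≤ 1 / (10 ^ 4 * (1 + 2 * δ₀) ^ 2) := Real.sqrt_le_iff.2 ⟨by positivity, hδmax⟩
    rwa [le_div_iff₀' (by positivity)] at h1⟩
  have hs := h.sqrt_pos
  refine ⟨1 / 2, by norm_num, by norm_num, ?_⟩
  intro δ' hδ' hδ'1
  obtain ⟨C₁, hC₁, hdiff⟩ := exists_abs_muK_sub_le hφ h hδ' hδ'1 hσ₀ hσ₀'
  obtain ⟨A, hA, hsum⟩ := muK_add_le_muR hφ h hδ' hδ'1 hσ₀ hσ₀'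
  obtain ⟨B, hB, hglob⟩ := muK_le_mul_exp_sqrt hφ h hδ' hδ'1 hσ₀ hσ₀'
  refine ⟨C₁, hC₁, A + B, by linarith, ?_⟩
  intro t ht ξ η k
  have hm : 0 ≤ muK φ σ₀ δ₀ δ δ' k t η := by
    rw [muK_eq]
    exact add_nonneg (decayTerm_pos hσ₀ hσ₀' k t η).le (mainTerm_nonneg hφ h hδ' hδ'1 ht k η)
  have hR : 0 ≤ muR φ σ₀ δ δ' t (ξ - η) :=
    add_nonneg (div_nonneg (Real.sqrt_nonneg _) (bracket_rpow_pos hσ₀ hσ₀' t).le)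
      (muStar_nonneg hφ h hδ' ht (ξ - η))
  have hz : 0 ≤ √δ * √|ξ - η| := by positivity
  refine ⟨fun hle => ?_, fun _ => ?_, ?_⟩
  · refine (hsum k t ht ξ η hle).trans ?_
    gcongr
    linarith
  · refine (hdiff k t ht ξ η).trans ?_
    have hJ := bracket_pos (ξ - η)
    have hX : 0 < pairBracket k ξ ^ (1 / 8 : ℝ) := Real.rpow_pos_of_pos (pairBracket_pos k ξ) _
    calc _ ≤ bracket (ξ - η) * (4 * (C₁ / pairBracket k ξ ^ (1 / 8 : ℝ) + √δ))
          * (Real.exp (4 * √δ * √|ξ - η|) * muK φ σ₀ δ₀ δ δ' k t η) := by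
          have : 0 ≤ C₁ / pairBracket k ξ ^ (1 / 8 : ℝ) := by positivity
          gcongr
          · linarith
          · linarith
      _ = _ := by ring
  · refine (hglob k t ht ξ η).trans ?_
    gcongr
    · linarith
    · linarith
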